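/- Identify roots of unity in $\mathbb C^\times$ with $\mathbb Q/\mathbb Z$. For $(A,f)$, $k$ and the abelian 3-cocycle $(\omega_k,c_k)$ on $A$ take either (1) $A=\mathbb Z/2\,v\oplus\mathbb Z/2\,f$ and $4k=0$, with $\omega_k(x,y,z)=2kx_v$ if $y_v+z_v\ge 2$ and $0$ otherwise, $c_k(x,y)=\tfrac12(x_v+x_f)y_f+k\,x_vy_v$ (coordinates in $\{0,1\}$); or (2) $A=\mathbb Z/4\,v$, $f=2v$ and $4k=\tfrac12$, with $\omega_k(x,y,z)=\tfrac12x_v$ if $y_v+z_v\ge4$ and $0$ otherwise, $c_k(x,y)=k\,x_vy_v$ (coordinates in $\{0,1,2,3\}$). Let $\mathcal B=\mathrm{Vec}_A^{(\omega_k,c_k)}$ be the category of finite-dimensional $A$-graded complex vector spaces with the associativity constraint $X\otimes(Y\otimes Z)\to(X\otimes Y)\otimes Z$ given by $\omega_k$ and the braiding given by $c_k$; these are the pointed spin-modular categories of rank four, with fermion $f$ (so $f\otimes f\cong\mathbf 1$ and $c_{f,f}=-\mathrm{id}$). Let $\underline{\mathrm{Aut}}_\otimes^{br}(\mathcal B,f)$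 be the monoidal category (under composition) of $\mathbb C$-linear braided tensor autoequivalences $F$ of $\mathcal B$ with $F(f)\cong f$, with tensor natural isomorphisms as morphisms, and let $\mathrm{Aut}_\otimes^{br}(\mathcal B,f)$ be its group of isomorphism classes; it acts on $A$, the group of isomorphism classes of simple objects. Write $b(x,y)$ for the double braiding of $x,y\in A$, and let $r:A\to\mathbb Z/2$ be the homomorphism with $b(x,f)=(-1)^{r(x)}$; its kernel is $\{0,f\}$. Let $G$ be a finite group and $\rho:G\to\mathrm{Aut}_\otimes^{br}(\mathcal B,f)$ a homomorphism, through which $G$ acts on $A$. A bosonic action realizing $\rho$ is a monoidal functor $\tilde\rho:\underline G\to\underline{\mathrm{Aut}}_\otimes^{br}(\mathcal B,f)$, where $\underline G$ is the discrete monoidal category of $G$, such that $\tilde\rho(g)$ has isomorphism class $\rho(g)$ for all $g$. For $\alpha\in H^2(G,\mathbb Z/2)$ (equivalently, for a finite super-group $(G,\alpha)$) it is a fermionic action of $(G,\alpha)$ if its restriction to the fusion subcategory $\langle f\rangle$ corresponds to $\alpha$, that is, if as a monoidal functor it is isomorphic to the action with all $g_*=\mathrm{id}$ and with $g_*h_*\to(gh)_*$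 given by a 2-cocycle representing $\alpha$ with values in the character group $\widehat{\langle f\rangle}\cong\mathbb Z/2$. Actions are considered up to isomorphism of monoidal functors. Let $d_2:H^2(G,\mathbb Z/2)\to H^3(G,\mathbb Z/2)$ be the connecting homomorphism of the exact sequence of $G$-modules $0\to\mathbb Z/2\xrightarrow{1\mapsto f}A\xrightarrow{\ r\ }\mathbb Z/2\to0$. Then: (a) $\mathrm{Aut}_\otimes^{br}(\mathcal B,f)\cong\mathbb Z/2$. (b) Every homomorphism $\rho:G\to\mathrm{Aut}_\otimes^{br}(\mathcal B,f)\cong\mathbb Z/2$ is realized by a bosonic action. (c) $\rho$ is realized by a fermionic action of $(G,\alpha)$ if and only if $d_2(\alpha)=0$. (d) If $d_2(\alpha)=0$, the set of equivalence classes of fermionic actions of $(G,\alpha)$ realizing $\rho$ is a torsor over $\mathrm{Ker}\big(r_*:H^2(G,A)\to H^2(G,\mathbb Z/2)\big)$, where the class of a 2-cocycle $z$ acts by multiplying each isomorphism $g_*h_*\to(gh)_*$ by the automorphism of $(gh)_*$ given by the character $b(z(g,h),-)$ of $A$. -/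

import Mathlib

open CategoryTheory MonoidalCategory TensorProduct

noncomputable section

set_option linter.unusedVariables false

/-- A (normalized) abelian 3-cocycle `(ω, c)` on `A` with values in `ℂˣ`. -/
structure AbelianCocycle (A : Type) [AddCommGroup A] where
  ω : A → A → A → ℂˣ
  c : A → A → ℂˣ
  ω_zero : ∀ g h, ω g 0 h = 1
  pentagon : ∀ g h k l,
    ω g h k * ω g (h + k) l * ω h k l = ω (g + h) k l * ω g h (k + l)
  hexagon_left : ∀ g h k,
    c g (h + k) / (c g h * c g k) = ω g h k * ω h k g / ω h g k
  hexagon_right : ∀ g h k,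
    c (g + h) k / (c g k * c h k) = ω g k h / (ω g h k * ω k g h)

/-- Objects of `Vec_A^{(ω,c)}`: finite-dimensional complex vector spaces with an `A`-grading,
the grading being recorded by its projections `proj a : V → V` onto the homogeneous components. -/
structure GrVec {A : Type} [AddCommGroup A] (Ω : AbelianCocycle A) [Fintype A] where
  carrier : Type
  [addCommGroup : AddCommGroup carrier]
  [module : Module ℂ carrier]
  [finite : FiniteDimensional ℂ carrier]
  proj : A → Module.End ℂ carrier
  complete : CompleteOrthogonalIdempotents proj

namespace GrVec

variable {A : Type} [AddCommGroup A] {Ω : AbelianCocycle A} [Fintype A]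

attribute [instance] addCommGroup module finite

/-- `v` is homogeneous of degree `a`. -/
def Homog (X : GrVec Ω) (a : A) (v : X.carrier) : Prop := X.proj a v = v

/-- Morphisms of `Vec_A^{(ω,c)}`: degree-preserving linear maps. -/
@[ext]
structure Hom (X Y : GrVec Ω) where
  lin : X.carrier →ₗ[ℂ] Y.carrier
  comm : ∀ a v, lin (X.proj a v) = Y.proj a (lin v)

instance : Category (GrVec Ω) where
  Hom X Y := Hom X Y
  id X := ⟨LinearMap.id, fun _ _ => rfl⟩
  comp f g := ⟨g.lin.comp f.lin, fun a v => by simp [f.comm, g.comm]⟩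

@[ext]
theorem hom_ext {X Y : GrVec Ω} {f g : X ⟶ Y} (h : f.lin = g.lin) : f = g := Hom.ext h

@[simp] theorem id_lin (X : GrVec Ω) : Hom.lin (𝟙 X) = LinearMap.id := rfl
@[simp] theorem comp_lin {X Y Z : GrVec Ω} (f : X ⟶ Y) (g : Y ⟶ Z) :
    Hom.lin (f ≫ g) = g.lin.comp f.lin := rfl

/-! The linear structure on morphism spaces. -/

instance (X Y : GrVec Ω) : Zero (X ⟶ Y) := ⟨(⟨0, by simp⟩ : Hom X Y)⟩
instance (X Y : GrVec Ω) : Add (X ⟶ Y) :=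
  ⟨fun f g => (⟨f.lin + g.lin, by simp [f.comm, g.comm]⟩ : Hom X Y)⟩
instance (X Y : GrVec Ω) : Neg (X ⟶ Y) :=
  ⟨fun f => (⟨-f.lin, by simp [f.comm]⟩ : Hom X Y)⟩
instance (X Y : GrVec Ω) : Sub (X ⟶ Y) :=
  ⟨fun f g => (⟨f.lin - g.lin, by simp [f.comm, g.comm]⟩ : Hom X Y)⟩
instance (X Y : GrVec Ω) : SMul ℂ (X ⟶ Y) :=
  ⟨fun r f => (⟨r • f.lin, by simp [f.comm]⟩ : Hom X Y)⟩
instance (X Y : GrVec Ω) : SMul ℕ (X ⟶ Y) :=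
  ⟨fun r f => (⟨r • f.lin, by simp [f.comm]⟩ : Hom X Y)⟩
instance (X Y : GrVec Ω) : SMul ℤ (X ⟶ Y) :=
  ⟨fun r f => (⟨r • f.lin, by simp [f.comm]⟩ : Hom X Y)⟩

@[simp] theorem add_lin {X Y : GrVec Ω} (f g : X ⟶ Y) : Hom.lin (f + g) = f.lin + g.lin := rfl
@[simp] theorem smul_lin {X Y : GrVec Ω} (r : ℂ) (f : X ⟶ Y) :
    Hom.lin (r • f) = r • f.lin := rfl

theorem lin_injective (X Y : GrVec Ω) :
    Function.Injective (fun f : X ⟶ Y => f.lin) := fun _ _ h => hom_ext h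

instance (X Y : GrVec Ω) : AddCommGroup (X ⟶ Y) :=
  (lin_injective X Y).addCommGroup _ rfl (fun _ _ => rfl) (fun _ => rfl) (fun _ _ => rfl)
    (fun _ _ => rfl) (fun _ _ => rfl)

instance (X Y : GrVec Ω) : Module ℂ (X ⟶ Y) :=
  (lin_injective X Y).module ℂ ⟨⟨fun f : X ⟶ Y => f.lin, rfl⟩, fun _ _ => rfl⟩ (fun _ _ => rfl)

instance : Preadditive (GrVec Ω) where
  homGroup _ _ := inferInstance
  add_comp _ _ _ _ _ _ := hom_ext (LinearMap.comp_add _ _ _)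
  comp_add _ _ _ _ _ _ := hom_ext (LinearMap.add_comp _ _ _)

instance : Linear ℂ (GrVec Ω) where
  homModule _ _ := inferInstance
  smul_comp _ _ _ _ _ _ := hom_ext (LinearMap.comp_smul _ _ _)
  comp_smul _ _ _ _ _ _ := hom_ext (LinearMap.smul_comp _ _ _)

/-! Homogeneous vectors. -/

theorem proj_proj (X : GrVec Ω) (a : A) (v : X.carrier) :
    X.proj a (X.proj a v) = X.proj a v :=
  LinearMap.congr_fun (X.complete.idem a) v

theorem proj_proj_ne (X : GrVec Ω) {a b : A} (h : a ≠ b) (v : X.carrier) :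
    X.proj a (X.proj b v) = 0 :=
  LinearMap.congr_fun (X.complete.ortho h) v

theorem sum_proj (X : GrVec Ω) (v : X.carrier) : ∑ a, X.proj a v = v := by
  have := LinearMap.congr_fun X.complete.complete v
  simpa using this

theorem homog_proj (X : GrVec Ω) (a : A) (v : X.carrier) : X.Homog a (X.proj a v) :=
  X.proj_proj a v

open Classical in
theorem Homog.proj_eq {X : GrVec Ω} {a : A} {v : X.carrier} (h : X.Homog a v) (b : A) :
    X.proj b v = if b = a then v else 0 := by
  split_ifs with hb
  · subst hb; exact h
  · have h' : X.proj a v = v := h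
    rw [← h']; exact X.proj_proj_ne hb v

theorem Homog.smul {X : GrVec Ω} {a : A} {v : X.carrier} (h : X.Homog a v) (r : ℂ) :
    X.Homog a (r • v) := by
  have h' : X.proj a v = v := h
  simp [Homog, h']

theorem Homog.map {X Y : GrVec Ω} (f : X ⟶ Y) {a : A} {v : X.carrier} (h : X.Homog a v) :
    Y.Homog a (f.lin v) := by
  have h' : X.proj a v = v := h
  have := f.comm a v
  rw [h'] at this
  exact this.symm

theorem homog_induction (X : GrVec Ω) {P : X.carrier → Prop} (zero : P 0)
    (add : ∀ v w, P v → P w → P (v + w)) (homog : ∀ a v, X.Homog a v → P v) (v : X.carrier) :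
    P v := by
  rw [← X.sum_proj v]
  exact Finset.sum_induction _ P add zero fun a _ => homog a _ (X.homog_proj a v)

/-! The tensor product: `(V ⊗ W)_a = ⨁ b, V_b ⊗ W_{a - b}`. -/

/-- The projections of the grading of `V ⊗ W`. -/
def tproj (X Y : GrVec Ω) (a : A) : Module.End ℂ (X.carrier ⊗[ℂ] Y.carrier) :=
  ∑ b, TensorProduct.map (X.proj b) (Y.proj (a - b))

theorem tensor_induction (X Y : GrVec Ω) {P : X.carrier ⊗[ℂ] Y.carrier → Prop} (zero : P 0)
    (add : ∀ v w, P v → P w → P (v + w))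
    (homog : ∀ a b v w, X.Homog a v → Y.Homog b w → P (v ⊗ₜ w)) (t : X.carrier ⊗[ℂ] Y.carrier) :
    P t := by
  refine TensorProduct.induction_on t zero (fun v w => ?_) add
  refine X.homog_induction (P := fun v => P (v ⊗ₜ w)) (by simpa using zero)
    (fun v v' h h' => by simpa [TensorProduct.add_tmul] using add _ _ h h') (fun a v hv => ?_) v
  refine Y.homog_induction (P := fun w => P (v ⊗ₜ w)) (by simpa using zero)
    (fun v v' h h' => by simpa [TensorProduct.tmul_add] using add _ _ h h')
    (fun b w hw => homog a b v w hv hw) w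

open Classical in
theorem tproj_tmul {X Y : GrVec Ω} {a b : A} {v : X.carrier} {w : Y.carrier}
    (hv : X.Homog a v) (hw : Y.Homog b w) (d : A) :
    tproj X Y d (v ⊗ₜ w) = if d = a + b then v ⊗ₜ w else 0 := by
  simp only [tproj, LinearMap.sum_apply, TensorProduct.map_tmul, hv.proj_eq, hw.proj_eq]
  rw [Finset.sum_eq_single a]
  · by_cases h : d = a + b
    · subst h; simp
    · have : d - a ≠ b := fun h' => h (by rw [← h']; abel)
      simp [h, this]
  · intro b' _ hb'; simp [hb']
  · simp

/-- The tensor product of graded vector spaces. -/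
abbrev tensor (X Y : GrVec Ω) : GrVec Ω where
  carrier := X.carrier ⊗[ℂ] Y.carrier
  proj := tproj X Y
  complete := by
    classical
    refine ⟨OrthogonalIdempotents.iff_mul_eq.mpr fun i j => LinearMap.ext fun t => ?_,
      LinearMap.ext fun t => ?_⟩
    · refine tensor_induction X Y (P := fun t => (tproj X Y i * tproj X Y j) t =
        (if i = j then tproj X Y i else 0 : Module.End ℂ (X.carrier ⊗[ℂ] Y.carrier)) t) (by simp)
        (fun v w h h' => by rw [map_add, map_add, h, h']) ?_ t
      intro a b v w hv hw
      have hw' := tproj_tmul hv hw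
      by_cases h : i = j
      · subst h
        simp only [Module.End.mul_apply, hw', if_true]
        split_ifs <;> simp [*]
      · simp only [Module.End.mul_apply, hw', if_neg h, LinearMap.zero_apply]
        split_ifs with h'
        · rw [hw', if_neg (fun h'' => h (h''.trans h'.symm))]
        · simp
    · refine tensor_induction X Y (P := fun t => (∑ d, tproj X Y d) t =
        (1 : Module.End ℂ (X.carrier ⊗[ℂ] Y.carrier)) t) (by simp)
        (fun v w h h' => by rw [map_add, map_add, h, h']) ?_ t
      intro a b v w hv hw
      simp [LinearMap.sum_apply, tproj_tmul hv hw]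

theorem Homog.tmul {X Y : GrVec Ω} {a b : A} {v : X.carrier} {w : Y.carrier}
    (hv : X.Homog a v) (hw : Y.Homog b w) : (tensor X Y).Homog (a + b) (v ⊗ₜ[ℂ] w) := by
  classical
  exact (tproj_tmul hv hw (a + b)).trans (if_pos rfl)

/-- Degreewise scalar operators on `V ⊗ W`: multiplication by `s a b` on `V_a ⊗ W_b`. -/
def scale₂ (X Y : GrVec Ω) (s : A → A → ℂ) : Module.End ℂ (X.carrier ⊗[ℂ] Y.carrier) :=
  ∑ a, ∑ b, s a b • TensorProduct.map (X.proj a) (Y.proj b)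

/-- Degreewise scalar operators on `V ⊗ (W ⊗ U)`: multiplication by `s a b d` on
`V_a ⊗ (W_b ⊗ U_d)`. -/
def scale₃ (X Y Z : GrVec Ω) (s : A → A → A → ℂ) :
    Module.End ℂ (X.carrier ⊗[ℂ] (Y.carrier ⊗[ℂ] Z.carrier)) :=
  ∑ a, ∑ b, ∑ d, s a b d •
    TensorProduct.map (X.proj a) (TensorProduct.map (Y.proj b) (Z.proj d))

theorem scale₂_tmul {X Y : GrVec Ω} {s : A → A → ℂ} {a b : A} {v : X.carrier} {w : Y.carrier}
    (hv : X.Homog a v) (hw : Y.Homog b w) :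
    scale₂ X Y s (v ⊗ₜ w) = s a b • (v ⊗ₜ w) := by
  classical
  simp only [scale₂, LinearMap.sum_apply, LinearMap.smul_apply, TensorProduct.map_tmul,
    hv.proj_eq, hw.proj_eq]
  rw [Finset.sum_eq_single a, Finset.sum_eq_single b] <;> simp +contextual

theorem scale₃_tmul {X Y Z : GrVec Ω} {s : A → A → A → ℂ} {a b d : A} {v : X.carrier}
    {w : Y.carrier} {u : Z.carrier} (hv : X.Homog a v) (hw : Y.Homog b w) (hu : Z.Homog d u) :
    scale₃ X Y Z s (v ⊗ₜ (w ⊗ₜ u)) = s a b d • (v ⊗ₜ (w ⊗ₜ u)) := by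
  classical
  simp only [scale₃, LinearMap.sum_apply, LinearMap.smul_apply, TensorProduct.map_tmul,
    hv.proj_eq, hw.proj_eq, hu.proj_eq]
  rw [Finset.sum_eq_single a, Finset.sum_eq_single b, Finset.sum_eq_single d] <;>
    simp +contextual

theorem ext₁ {X : GrVec Ω} {M : Type} [AddCommGroup M] [Module ℂ M]
    {f g : X.carrier →ₗ[ℂ] M} (h : ∀ a v, X.Homog a v → f v = g v) : f = g :=
  LinearMap.ext fun t => X.homog_induction (P := fun t => f t = g t) (by simp)
    (fun v w h h' => by simp only [map_add, h, h']) h t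

theorem ext₂ {X Y : GrVec Ω} {M : Type} [AddCommGroup M] [Module ℂ M]
    {f g : X.carrier ⊗[ℂ] Y.carrier →ₗ[ℂ] M}
    (h : ∀ a b v w, X.Homog a v → Y.Homog b w → f (v ⊗ₜ w) = g (v ⊗ₜ w)) : f = g :=
  LinearMap.ext fun t => tensor_induction X Y (P := fun t => f t = g t) (by simp)
    (fun v w h h' => by simp only [map_add, h, h']) h t

theorem ext₃ {X Y Z : GrVec Ω} {M : Type} [AddCommGroup M] [Module ℂ M]
    {f g : X.carrier ⊗[ℂ] (Y.carrier ⊗[ℂ] Z.carrier) →ₗ[ℂ] M}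
    (h : ∀ a b d v w u, X.Homog a v → Y.Homog b w → Z.Homog d u →
      f (v ⊗ₜ (w ⊗ₜ u)) = g (v ⊗ₜ (w ⊗ₜ u))) : f = g := by
  refine TensorProduct.ext (ext₁ fun a v hv => ext₂ fun b d w u hw hu => ?_)
  exact h a b d v w u hv hw hu

theorem ext₃' {X Y Z : GrVec Ω} {M : Type} [AddCommGroup M] [Module ℂ M]
    {f g : (X.carrier ⊗[ℂ] Y.carrier) ⊗[ℂ] Z.carrier →ₗ[ℂ] M}
    (h : ∀ a b d v w u, X.Homog a v → Y.Homog b w → Z.Homog d u →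
      f ((v ⊗ₜ w) ⊗ₜ u) = g ((v ⊗ₜ w) ⊗ₜ u)) : f = g := by
  refine TensorProduct.ext (ext₂ fun a b v w hv hw => ext₁ fun d u hu => ?_)
  exact h a b d v w u hv hw hu

theorem ext₄ {X Y Z T : GrVec Ω} {M : Type} [AddCommGroup M] [Module ℂ M]
    {f g : ((X.carrier ⊗[ℂ] Y.carrier) ⊗[ℂ] Z.carrier) ⊗[ℂ] T.carrier →ₗ[ℂ] M}
    (h : ∀ a b d e v w u t, X.Homog a v → Y.Homog b w → Z.Homog d u → T.Homog e t →
      f (((v ⊗ₜ w) ⊗ₜ u) ⊗ₜ t) = g (((v ⊗ₜ w) ⊗ₜ u) ⊗ₜ t)) : f = g := by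
  refine TensorProduct.ext (ext₃' fun a b d v w u hv hw hu => ext₁ fun e t ht => ?_)
  exact h a b d e v w u t hv hw hu ht

theorem comm_of_homog {X Y : GrVec Ω} (f : X.carrier →ₗ[ℂ] Y.carrier)
    (h : ∀ a v, X.Homog a v → Y.Homog a (f v)) (d : A) (v : X.carrier) :
    f (X.proj d v) = Y.proj d (f v) := by
  classical
  refine X.homog_induction (P := fun v => f (X.proj d v) = Y.proj d (f v)) (by simp)
    (fun v w h h' => by simp only [map_add, h, h']) (fun b v hv => ?_) v
  rw [hv.proj_eq, (h b v hv).proj_eq]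
  split_ifs <;> simp

theorem comm_of_tmul {X Y T : GrVec Ω} (f : X.carrier ⊗[ℂ] Y.carrier →ₗ[ℂ] T.carrier)
    (h : ∀ a b v w, X.Homog a v → Y.Homog b w → T.Homog (a + b) (f (v ⊗ₜ w))) (d : A)
    (t : X.carrier ⊗[ℂ] Y.carrier) :
    f (tproj X Y d t) = T.proj d (f t) := by
  classical
  refine tensor_induction X Y (P := fun t => f (tproj X Y d t) = T.proj d (f t)) (by simp)
    (fun v w h h' => by simp only [map_add, h, h']) (fun a b v w hv hw => ?_) t
  rw [tproj_tmul hv hw, (h a b v w hv hw).proj_eq]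
  split_ifs <;> simp

theorem comm_of_tmul₃ {X Y Z T : GrVec Ω}
    (f : X.carrier ⊗[ℂ] (Y.carrier ⊗[ℂ] Z.carrier) →ₗ[ℂ] T.carrier)
    (h : ∀ a b d v w u, X.Homog a v → Y.Homog b w → Z.Homog d u →
      T.Homog (a + (b + d)) (f (v ⊗ₜ (w ⊗ₜ u)))) (d : A)
    (t : X.carrier ⊗[ℂ] (Y.carrier ⊗[ℂ] Z.carrier)) :
    f (tproj X (tensor Y Z) d t) = T.proj d (f t) := by
  classical
  refine LinearMap.congr_fun (f := f ∘ₗ tproj X (tensor Y Z) d) (g := T.proj d ∘ₗ f)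
    (ext₃ fun a b e v w u hv hw hu => ?_) t
  rw [LinearMap.comp_apply, LinearMap.comp_apply, (h a b e v w u hv hw hu).proj_eq,
    tproj_tmul hv (hw.tmul hu)]
  split_ifs <;> simp

theorem comm_of_tmul₃' {X Y Z T : GrVec Ω}
    (f : (X.carrier ⊗[ℂ] Y.carrier) ⊗[ℂ] Z.carrier →ₗ[ℂ] T.carrier)
    (h : ∀ a b d v w u, X.Homog a v → Y.Homog b w → Z.Homog d u →
      T.Homog (a + b + d) (f ((v ⊗ₜ w) ⊗ₜ u))) (d : A)
    (t : (X.carrier ⊗[ℂ] Y.carrier) ⊗[ℂ] Z.carrier) :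
    f (tproj (tensor X Y) Z d t) = T.proj d (f t) := by
  classical
  refine LinearMap.congr_fun (f := f ∘ₗ tproj (tensor X Y) Z d) (g := T.proj d ∘ₗ f)
    (ext₃' fun a b e v w u hv hw hu => ?_) t
  rw [LinearMap.comp_apply, LinearMap.comp_apply, (h a b e v w u hv hw hu).proj_eq,
    tproj_tmul (hv.tmul hw) hu]
  split_ifs <;> simp

open Classical in
/-- The simple object `ℂ_a`: the line `ℂ` in degree `a`. -/
abbrev line (Ω : AbelianCocycle A) (a : A) : GrVec Ω where
  carrier := ℂ
  proj b := if b = a then 1 else 0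
  complete := by
    refine ⟨OrthogonalIdempotents.iff_mul_eq.mpr fun i j => ?_, by simp⟩
    by_cases h : i = a <;> by_cases h' : j = a <;> (simp [h, h']; try aesop)

theorem line_homog (a : A) (z : ℂ) : (line Ω a).Homog a z := by
  simp only [Homog, line, if_true]
  rfl

/-- The linear map underlying the associativity constraint: `ω a b d ⁻¹` on
`(V_a ⊗ W_b) ⊗ U_d`. -/
def assocLin (X Y Z : GrVec Ω) :
    (X.carrier ⊗[ℂ] Y.carrier) ⊗[ℂ] Z.carrier →ₗ[ℂ] X.carrier ⊗[ℂ] (Y.carrier ⊗[ℂ] Z.carrier) :=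
  scale₃ X Y Z (fun a b d => ((Ω.ω a b d)⁻¹ : ℂˣ)) ∘ₗ
    (TensorProduct.assoc ℂ X.carrier Y.carrier Z.carrier).toLinearMap

/-- The linear map underlying the inverse associativity constraint: `ω a b d` on
`V_a ⊗ (W_b ⊗ U_d)`. -/
def assocInvLin (X Y Z : GrVec Ω) :
    X.carrier ⊗[ℂ] (Y.carrier ⊗[ℂ] Z.carrier) →ₗ[ℂ] (X.carrier ⊗[ℂ] Y.carrier) ⊗[ℂ] Z.carrier :=
  (TensorProduct.assoc ℂ X.carrier Y.carrier Z.carrier).symm.toLinearMap ∘ₗ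
    scale₃ X Y Z (fun a b d => Ω.ω a b d)

theorem assocLin_tmul {X Y Z : GrVec Ω} {a b d : A} {v : X.carrier}
    {w : Y.carrier} {u : Z.carrier} (hv : X.Homog a v) (hw : Y.Homog b w) (hu : Z.Homog d u) :
    assocLin X Y Z ((v ⊗ₜ w) ⊗ₜ u) = (((Ω.ω a b d)⁻¹ : ℂˣ) : ℂ) • (v ⊗ₜ (w ⊗ₜ u)) := by
  simp [assocLin, scale₃_tmul hv hw hu]

theorem assocInvLin_tmul {X Y Z : GrVec Ω} {a b d : A} {v : X.carrier}
    {w : Y.carrier} {u : Z.carrier} (hv : X.Homog a v) (hw : Y.Homog b w) (hu : Z.Homog d u) :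
    assocInvLin X Y Z (v ⊗ₜ (w ⊗ₜ u)) = (Ω.ω a b d : ℂ) • ((v ⊗ₜ w) ⊗ₜ u) := by
  simp [assocInvLin, scale₃_tmul hv hw hu]

/-- The linear map underlying the braiding: `v ⊗ w ↦ c a b • w ⊗ v` on `V_a ⊗ W_b`. -/
def braidLin (X Y : GrVec Ω) :
    X.carrier ⊗[ℂ] Y.carrier →ₗ[ℂ] Y.carrier ⊗[ℂ] X.carrier :=
  (TensorProduct.comm ℂ X.carrier Y.carrier).toLinearMap ∘ₗ scale₂ X Y (fun a b => Ω.c a b)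

/-- The linear map underlying the inverse braiding. -/
def braidInvLin (X Y : GrVec Ω) :
    Y.carrier ⊗[ℂ] X.carrier →ₗ[ℂ] X.carrier ⊗[ℂ] Y.carrier :=
  scale₂ X Y (fun a b => ((Ω.c a b)⁻¹ : ℂˣ)) ∘ₗ (TensorProduct.comm ℂ Y.carrier X.carrier).toLinearMap

theorem braidLin_tmul {X Y : GrVec Ω} {a b : A} {v : X.carrier}
    {w : Y.carrier} (hv : X.Homog a v) (hw : Y.Homog b w) :
    braidLin X Y (v ⊗ₜ w) = (Ω.c a b : ℂ) • (w ⊗ₜ v) := by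
  simp [braidLin, scale₂_tmul hv hw]

theorem braidInvLin_tmul {X Y : GrVec Ω} {a b : A} {v : X.carrier}
    {w : Y.carrier} (hv : X.Homog a v) (hw : Y.Homog b w) :
    braidInvLin X Y (w ⊗ₜ v) = (((Ω.c a b)⁻¹ : ℂˣ) : ℂ) • (v ⊗ₜ w) := by
  simp [braidInvLin, scale₂_tmul hv hw]

/-- The tensor product of morphisms. -/
def tmap {X₁ Y₁ X₂ Y₂ : GrVec Ω} (f : X₁ ⟶ Y₁) (g : X₂ ⟶ Y₂) : tensor X₁ X₂ ⟶ tensor Y₁ Y₂ :=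
  (⟨TensorProduct.map f.lin g.lin,
    comm_of_tmul (T := tensor Y₁ Y₂) _ fun _ _ _ _ hv hw => (hv.map f).tmul (hw.map g)⟩ : Hom _ _)

/-- The associativity constraint. -/
def assocIso (X Y Z : GrVec Ω) : tensor (tensor X Y) Z ≅ tensor X (tensor Y Z) where
  hom := (⟨assocLin X Y Z, comm_of_tmul₃' (T := tensor X (tensor Y Z)) _
    fun a b d v w u hv hw hu => by
      rw [assocLin_tmul hv hw hu, add_assoc]
      exact (hv.tmul (hw.tmul hu)).smul _⟩ : Hom _ _)
  inv := (⟨assocInvLin X Y Z, comm_of_tmul₃ (T := tensor (tensor X Y) Z) _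
    fun a b d v w u hv hw hu => by
      rw [assocInvLin_tmul hv hw hu, ← add_assoc]
      exact ((hv.tmul hw).tmul hu).smul _⟩ : Hom _ _)
  hom_inv_id := hom_ext (ext₃' fun a b d v w u hv hw hu => by
    simp [assocLin_tmul hv hw hu, assocInvLin_tmul hv hw hu, smul_smul])
  inv_hom_id := hom_ext (ext₃ fun a b d v w u hv hw hu => by
    simp [assocLin_tmul hv hw hu, assocInvLin_tmul hv hw hu, smul_smul])

/-- The braiding. -/
def braidIso (X Y : GrVec Ω) : tensor X Y ≅ tensor Y X where
  hom := (⟨braidLin X Y, comm_of_tmul (T := tensor Y X) _ fun a b v w hv hw => by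
      rw [braidLin_tmul hv hw, add_comm]
      exact (hw.tmul hv).smul _⟩ : Hom _ _)
  inv := (⟨braidInvLin X Y, comm_of_tmul (T := tensor X Y) _ fun a b v w hv hw => by
      rw [braidInvLin_tmul hw hv, add_comm]
      exact (hw.tmul hv).smul _⟩ : Hom _ _)
  hom_inv_id := hom_ext (ext₂ fun a b v w hv hw => by
    simp [braidLin_tmul hv hw, braidInvLin_tmul hv hw, smul_smul])
  inv_hom_id := hom_ext (ext₂ fun a b v w hv hw => by
    simp [braidLin_tmul hw hv, braidInvLin_tmul hw hv, smul_smul])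

theorem homog_zero (X : GrVec Ω) (a : A) : X.Homog a 0 := map_zero _

theorem eq_zero_of_line {a b : A} {z : ℂ} (h : (line Ω a).Homog b z) : b = a ∨ z = 0 := by
  by_cases hb : b = a
  · exact Or.inl hb
  · right
    have h' : (line Ω a).proj b z = z := h
    rw [← h']
    simp [hb]

/-- The left unit constraint. -/
def leftIso (X : GrVec Ω) : tensor (line Ω 0) X ≅ X where
  hom := (⟨(TensorProduct.lid ℂ X.carrier).toLinearMap,
    comm_of_tmul (X := line Ω 0) (T := X) _ fun a b z v hz hv => by
      rcases eq_zero_of_line hz with rfl | rfl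
      · simpa using hv.smul z
      · simpa using X.homog_zero _⟩ : Hom _ _)
  inv := (⟨(TensorProduct.lid ℂ X.carrier).symm.toLinearMap,
    comm_of_homog (Y := tensor (line Ω 0) X) _ fun d v hv => by
      have := (line_homog (Ω := Ω) 0 1).tmul hv
      rw [zero_add] at this
      exact this⟩ : Hom _ _)
  hom_inv_id := hom_ext (LinearMap.ext fun t => (TensorProduct.lid ℂ X.carrier).symm_apply_apply t)
  inv_hom_id := hom_ext (LinearMap.ext fun t => (TensorProduct.lid ℂ X.carrier).apply_symm_apply t)

/-- The right unit constraint. -/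
def rightIso (X : GrVec Ω) : tensor X (line Ω 0) ≅ X where
  hom := (⟨(TensorProduct.rid ℂ X.carrier).toLinearMap,
    comm_of_tmul (Y := line Ω 0) (T := X) _ fun a b v z hv hz => by
      rcases eq_zero_of_line hz with rfl | rfl
      · simpa using hv.smul z
      · simpa using X.homog_zero _⟩ : Hom _ _)
  inv := (⟨(TensorProduct.rid ℂ X.carrier).symm.toLinearMap,
    comm_of_homog (Y := tensor X (line Ω 0)) _ fun d v hv => by
      have := hv.tmul (line_homog (Ω := Ω) 0 1)
      rw [add_zero] at this
      exact this⟩ : Hom _ _)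
  hom_inv_id := hom_ext (LinearMap.ext fun t => (TensorProduct.rid ℂ X.carrier).symm_apply_apply t)
  inv_hom_id := hom_ext (LinearMap.ext fun t => (TensorProduct.rid ℂ X.carrier).apply_symm_apply t)

instance : MonoidalCategoryStruct (GrVec Ω) where
  tensorObj X Y := tensor X Y
  tensorUnit := line Ω 0
  tensorHom f g := tmap f g
  whiskerLeft X _ _ g := tmap (𝟙 X) g
  whiskerRight f Y := tmap f (𝟙 Y)
  associator := assocIso
  leftUnitor := leftIso
  rightUnitor := rightIso

theorem assoc_natural {X₁ X₂ X₃ Y₁ Y₂ Y₃ : GrVec Ω} (f₁ : X₁ ⟶ Y₁) (f₂ : X₂ ⟶ Y₂)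
    (f₃ : X₃ ⟶ Y₃) :
    tmap (tmap f₁ f₂) f₃ ≫ (assocIso Y₁ Y₂ Y₃).hom =
      (assocIso X₁ X₂ X₃).hom ≫ tmap f₁ (tmap f₂ f₃) := by
  refine hom_ext (ext₃' fun a b d v w u hv hw hu => ?_)
  simp [tmap, assocIso, assocLin_tmul hv hw hu, assocLin_tmul (hv.map f₁) (hw.map f₂) (hu.map f₃)]

theorem assoc_pentagon (W X Y Z : GrVec Ω) :
    tmap (assocIso W X Y).hom (𝟙 Z) ≫ (assocIso W (tensor X Y) Z).hom ≫
      tmap (𝟙 W) (assocIso X Y Z).hom =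
    (assocIso (tensor W X) Y Z).hom ≫ (assocIso W X (tensor Y Z)).hom := by
  refine hom_ext (ext₄ fun a b d e v w u t hv hw hu ht => ?_)
  have h := congrArg (fun z : ℂˣ => ((z⁻¹ : ℂˣ) : ℂ)) (Ω.pentagon a b d e)
  simp only [mul_inv, Units.val_mul] at h
  simp only [tmap, assocIso, comp_lin, id_lin, LinearMap.comp_apply, TensorProduct.map_tmul,
    assocLin_tmul hv hw hu, assocLin_tmul hw hu ht, LinearMap.id_apply,
    assocLin_tmul (hv.tmul hw) hu ht, assocLin_tmul hv hw (hu.tmul ht), map_smul,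
    ← TensorProduct.smul_tmul', assocLin_tmul hv (hw.tmul hu) ht, TensorProduct.tmul_smul,
    smul_smul]
  congr 1
  linear_combination h

theorem assoc_triangle (X Y : GrVec Ω) :
    (assocIso X (line Ω 0) Y).hom ≫ tmap (𝟙 X) (leftIso Y).hom =
      tmap (rightIso X).hom (𝟙 Y) := by
  refine hom_ext (ext₃' fun a b d v w u hv hw hu => ?_)
  rcases eq_zero_of_line hw with rfl | rfl
  · simp [tmap, assocIso, assocLin_tmul hv hw hu, leftIso, rightIso, Ω.ω_zero,
      TensorProduct.smul_tmul]
  · simp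

instance : MonoidalCategory (GrVec Ω) where
  tensorHom_def f g := hom_ext (ext₂ fun a b v w _ _ => rfl)
  id_tensorHom_id X Y := hom_ext (ext₂ fun a b v w _ _ => rfl)
  tensorHom_comp_tensorHom f₁ f₂ g₁ g₂ := hom_ext (ext₂ fun a b v w _ _ => rfl)
  whiskerLeft_id X Y := hom_ext (ext₂ fun a b v w _ _ => rfl)
  id_whiskerRight X Y := hom_ext (ext₂ fun a b v w _ _ => rfl)
  associator_naturality := assoc_natural
  leftUnitor_naturality {X Y} f := hom_ext (ext₂ (X := line Ω 0) fun a b v w _ _ =>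
    (f.lin.map_smul v w).symm)
  rightUnitor_naturality {X Y} f := hom_ext (ext₂ (Y := line Ω 0) fun a b v w _ _ =>
    (f.lin.map_smul w v).symm)
  pentagon := assoc_pentagon
  triangle := assoc_triangle

theorem braid_natural {X₁ X₂ Y₁ Y₂ : GrVec Ω} (f₁ : X₁ ⟶ Y₁) (f₂ : X₂ ⟶ Y₂) :
    tmap f₁ f₂ ≫ (braidIso Y₁ Y₂).hom = (braidIso X₁ X₂).hom ≫ tmap f₂ f₁ := by
  refine hom_ext (ext₂ fun a b v w hv hw => ?_)
  simp [tmap, braidIso, braidLin_tmul hv hw, braidLin_tmul (hv.map f₁) (hw.map f₂)]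

theorem braid_hexagon (X Y Z : GrVec Ω) :
    (assocIso X Y Z).hom ≫ (braidIso X (tensor Y Z)).hom ≫ (assocIso Y Z X).hom =
      tmap (braidIso X Y).hom (𝟙 Z) ≫ (assocIso Y X Z).hom ≫ tmap (𝟙 Y) (braidIso X Z).hom := by
  refine hom_ext (ext₃' fun a b d v w u hv hw hu => ?_)
  have h := congrArg (fun z : ℂˣ => (z : ℂ)) (Ω.hexagon_left a b d)
  simp only [tmap, assocIso, braidIso, comp_lin, id_lin, LinearMap.comp_apply,
    TensorProduct.map_tmul, assocLin_tmul hv hw hu, LinearMap.id_apply,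
    braidLin_tmul hv (hw.tmul hu), braidLin_tmul hv hw, braidLin_tmul hv hu,
    assocLin_tmul hw hu hv, assocLin_tmul hw hv hu, map_smul,
    ← TensorProduct.smul_tmul', TensorProduct.tmul_smul, smul_smul]
  congr 1
  simp only [Units.val_div_eq_div_val, Units.val_mul, Units.val_inv_eq_inv_val] at h ⊢
  field_simp at h ⊢
  linear_combination h

theorem braid_hexagon' (X Y Z : GrVec Ω) :
    (assocIso X Y Z).inv ≫ (braidIso (tensor X Y) Z).hom ≫ (assocIso Z X Y).inv =
      tmap (𝟙 X) (braidIso Y Z).hom ≫ (assocIso X Z Y).inv ≫ tmap (braidIso X Z).hom (𝟙 Y) := by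
  refine hom_ext (ext₃ fun a b d v w u hv hw hu => ?_)
  have h := congrArg (fun z : ℂˣ => (z : ℂ)) (Ω.hexagon_right a b d)
  simp only [tmap, assocIso, braidIso, comp_lin, id_lin, LinearMap.comp_apply,
    TensorProduct.map_tmul, assocInvLin_tmul hv hw hu, LinearMap.id_apply,
    braidLin_tmul (hv.tmul hw) hu, braidLin_tmul hw hu, braidLin_tmul hv hu,
    assocInvLin_tmul hu hv hw, assocInvLin_tmul hv hu hw, map_smul,
    ← TensorProduct.smul_tmul', TensorProduct.tmul_smul, smul_smul]
  congr 1
  simp only [Units.val_div_eq_div_val, Units.val_mul] at h ⊢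
  field_simp at h ⊢
  linear_combination h

instance : BraidedCategory (GrVec Ω) where
  braiding := braidIso
  braiding_naturality_right X _ _ f := braid_natural (𝟙 X) f
  braiding_naturality_left f Z := braid_natural f (𝟙 Z)
  hexagon_forward := braid_hexagon
  hexagon_reverse := braid_hexagon'

end GrVec

/-! Braided tensor autoequivalences. -/

/-- A pointed spin-modular category of rank four in the form `Vec_A^{(ω,c)}`: an abelian
3-cocycle on a group `A` of order four whose braiding is non-degenerate, together with a fermion,
that is an element `f` of `A` with `f + f = 0` and `c f f = -1`. -/
structure SpinDatum where
  A : Type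
  [grp : AddCommGroup A]
  [fin : Fintype A]
  Ω : AbelianCocycle A
  f : A
  f_add_f : f + f = 0
  c_f_f : Ω.c f f = -1
  nondegenerate : ∀ a, (∀ b, Ω.c a b * Ω.c b a = 1) → a = 0
  card_eq : Fintype.card A = 4

attribute [instance] SpinDatum.grp SpinDatum.fin

namespace SpinDatum

/-- The braided fusion category `Vec_A^{(ω,c)}`. -/
abbrev Cat (B : SpinDatum) : Type 1 := GrVec B.Ω

/-- The simple object `ℂ_a`. -/
abbrev simpleObj (B : SpinDatum) (a : B.A) : B.Cat := GrVec.line B.Ω a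

end SpinDatum

/-- A braided tensor autoequivalence (ℂ-linear, as always for fusion categories) of
`Vec_A^{(ω,c)}` which maps the fermion `f` to an object isomorphic to `f`. -/
structure BrAut (B : SpinDatum) where
  F : B.Cat ⥤ B.Cat
  [braided : F.Braided]
  [additive : F.Additive]
  [linear : F.Linear ℂ]
  [isEquivalence : F.IsEquivalence]
  fermion : Nonempty (F.obj (B.simpleObj B.f) ≅ B.simpleObj B.f)

namespace BrAut

variable {B : SpinDatum}

attribute [instance] braided additive linear isEquivalence

/-- Morphisms are tensor natural isomorphisms. -/
@[ext]
structure Hom (S T : BrAut B) where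
  iso : S.F ≅ T.F
  [isMonoidal : NatTrans.IsMonoidal iso.hom]

attribute [instance] Hom.isMonoidal

instance : Category (BrAut B) where
  Hom S T := Hom S T
  id S := { iso := Iso.refl _, isMonoidal := inferInstanceAs (NatTrans.IsMonoidal (𝟙 S.F)) }
  comp η θ :=
    { iso := η.iso ≪≫ θ.iso
      isMonoidal := inferInstanceAs (NatTrans.IsMonoidal (η.iso.hom ≫ θ.iso.hom)) }

@[ext]
theorem hom_ext {S T : BrAut B} {η θ : S ⟶ T}
    (h : ∀ X, η.iso.hom.app X = θ.iso.hom.app X) : η = θ :=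
  Hom.ext (Iso.ext (NatTrans.ext (funext h)))

@[simp] theorem id_app (S : BrAut B) (X : B.Cat) : (Hom.iso (𝟙 S)).hom.app X = 𝟙 _ := rfl
@[simp] theorem comp_app {S T U : BrAut B} (η : S ⟶ T) (θ : T ⟶ U) (X : B.Cat) :
    (Hom.iso (η ≫ θ)).hom.app X = η.iso.hom.app X ≫ θ.iso.hom.app X := rfl

/-- The composite `S ∘ T`. -/
abbrev comp (S T : BrAut B) : BrAut B where
  F := T.F ⋙ S.F
  fermion := ⟨S.F.mapIso T.fermion.some ≪≫ S.fermion.some⟩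

/-- The identity functor. -/
abbrev one (B : SpinDatum) : BrAut B where
  F := 𝟭 _
  fermion := ⟨Iso.refl _⟩

/-- Horizontal composition of tensor natural isomorphisms. -/
def hcomp {S₁ T₁ S₂ T₂ : BrAut B} (η : S₁ ⟶ T₁) (θ : S₂ ⟶ T₂) : comp S₁ S₂ ⟶ comp T₁ T₂ :=
  ({ iso := NatIso.hcomp θ.iso η.iso
     isMonoidal := inferInstanceAs (NatTrans.IsMonoidal (θ.iso.hom ◫ η.iso.hom)) } : Hom _ _)

theorem isMonoidal_inv {S T : BrAut B} (η : S ⟶ T) : NatTrans.IsMonoidal η.iso.inv :=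
  inferInstance

/-- The inverse of a tensor natural isomorphism. -/
def homInv {S T : BrAut B} (η : S ⟶ T) : T ⟶ S :=
  ({ iso := η.iso.symm, isMonoidal := isMonoidal_inv η } : Hom _ _)

/-- Tensor natural isomorphisms are invertible. -/
def toIso {S T : BrAut B} (η : S ⟶ T) : S ≅ T where
  hom := η
  inv := homInv η
  hom_inv_id := hom_ext fun X => η.iso.hom_inv_id_app X
  inv_hom_id := hom_ext fun X => η.iso.inv_hom_id_app X

/-- The tensor product of autoequivalences is their composition. -/
instance : MonoidalCategoryStruct (BrAut B) where
  tensorObj S T := comp S T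
  tensorUnit := one B
  tensorHom η θ := hcomp η θ
  whiskerLeft S _ _ θ := hcomp (𝟙 S) θ
  whiskerRight η T := hcomp η (𝟙 T)
  associator S T U := toIso
    ({ iso := (Functor.associator U.F T.F S.F).symm
       isMonoidal := inferInstanceAs
        (NatTrans.IsMonoidal (Functor.associator U.F T.F S.F).inv) } :
      Hom (comp (comp S T) U) (comp S (comp T U)))
  leftUnitor S := toIso
    ({ iso := Functor.rightUnitor S.F
       isMonoidal := inferInstanceAs (NatTrans.IsMonoidal (Functor.rightUnitor S.F).hom) } :
      Hom (comp (one B) S) S)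
  rightUnitor S := toIso
    ({ iso := Functor.leftUnitor S.F
       isMonoidal := inferInstanceAs (NatTrans.IsMonoidal (Functor.leftUnitor S.F).hom) } :
      Hom (comp S (one B)) S)

theorem hcomp_app {S₁ T₁ S₂ T₂ : BrAut B} (η : S₁ ⟶ T₁) (θ : S₂ ⟶ T₂) (X : B.Cat) :
    (hcomp η θ).iso.hom.app X =
      η.iso.hom.app (S₂.F.obj X) ≫ T₁.F.map (θ.iso.hom.app X) := rfl

instance : MonoidalCategory (BrAut B) where
  tensorHom_def {S₁ T₁ S₂ T₂} η θ := hom_ext fun X => by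
    change (hcomp η θ).iso.hom.app X =
      (hcomp η (𝟙 S₂)).iso.hom.app X ≫ (hcomp (𝟙 T₁) θ).iso.hom.app X
    simp only [hcomp_app, id_app, CategoryTheory.Functor.map_id, Category.comp_id, Category.id_comp]
  id_tensorHom_id S T := hom_ext fun X => by
    change (hcomp (𝟙 S) (𝟙 T)).iso.hom.app X = 𝟙 (S.F.obj (T.F.obj X))
    simp only [hcomp_app, id_app, CategoryTheory.Functor.map_id, Category.id_comp]
  tensorHom_comp_tensorHom {S₁ T₁ U₁ S₂ T₂ U₂} η₁ η₂ θ₁ θ₂ := hom_ext fun X => by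
    change (hcomp η₁ η₂).iso.hom.app X ≫ (hcomp θ₁ θ₂).iso.hom.app X =
      (hcomp (η₁ ≫ θ₁) (η₂ ≫ θ₂)).iso.hom.app X
    simp only [hcomp_app, comp_app, Functor.map_comp, Category.assoc,
      NatTrans.naturality_assoc]
  whiskerLeft_id S T := hom_ext fun X => by
    change (hcomp (𝟙 S) (𝟙 T)).iso.hom.app X = 𝟙 (S.F.obj (T.F.obj X))
    simp only [hcomp_app, id_app, CategoryTheory.Functor.map_id, Category.id_comp]
  id_whiskerRight S T := hom_ext fun X => by
    change (hcomp (𝟙 S) (𝟙 T)).iso.hom.app X = 𝟙 (S.F.obj (T.F.obj X))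
    simp only [hcomp_app, id_app, CategoryTheory.Functor.map_id, Category.id_comp]
  associator_naturality {S₁ S₂ S₃ T₁ T₂ T₃} η₁ η₂ η₃ := hom_ext fun X => by
    refine (Category.comp_id _).trans (Eq.trans ?_ (Category.id_comp _).symm)
    change (η₁.iso.hom.app (S₂.F.obj (S₃.F.obj X)) ≫ T₁.F.map (η₂.iso.hom.app (S₃.F.obj X))) ≫
        T₁.F.map (T₂.F.map (η₃.iso.hom.app X)) =
      η₁.iso.hom.app (S₂.F.obj (S₃.F.obj X)) ≫
        T₁.F.map (η₂.iso.hom.app (S₃.F.obj X) ≫ T₂.F.map (η₃.iso.hom.app X))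
    rw [CategoryTheory.Functor.map_comp, Category.assoc]
  leftUnitor_naturality {S T} η := hom_ext fun X => by
    refine (Category.comp_id _).trans (Eq.trans ?_ (Category.id_comp _).symm)
    exact Category.id_comp (η.iso.hom.app X)
  rightUnitor_naturality {S T} η := hom_ext fun X => by
    refine (Category.comp_id _).trans (Eq.trans ?_ (Category.id_comp _).symm)
    change η.iso.hom.app X ≫ T.F.map (𝟙 X) = η.iso.hom.app X
    rw [CategoryTheory.Functor.map_id, Category.comp_id]
  pentagon S T U V := hom_ext fun X => by
    change (𝟙 (S.F.obj (T.F.obj (U.F.obj (V.F.obj X)))) ≫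
        S.F.map (T.F.map (U.F.map (𝟙 (V.F.obj X))))) ≫
      𝟙 (S.F.obj (T.F.obj (U.F.obj (V.F.obj X)))) ≫
      (𝟙 (S.F.obj (T.F.obj (U.F.obj (V.F.obj X)))) ≫
        S.F.map (𝟙 (T.F.obj (U.F.obj (V.F.obj X))))) =
      𝟙 (S.F.obj (T.F.obj (U.F.obj (V.F.obj X)))) ≫ 𝟙 (S.F.obj (T.F.obj (U.F.obj (V.F.obj X))))
    simp only [CategoryTheory.Functor.map_id, Category.comp_id]
  triangle S T := hom_ext fun X => by
    change 𝟙 (S.F.obj (T.F.obj X)) ≫ (𝟙 (S.F.obj (T.F.obj X)) ≫ S.F.map (𝟙 (T.F.obj X))) =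
      𝟙 (S.F.obj (T.F.obj X)) ≫ S.F.map (𝟙 (T.F.obj X))
    simp only [CategoryTheory.Functor.map_id, Category.comp_id]

end BrAut

/-! The action of autoequivalences on the group `A` of isomorphism classes of simple objects. -/

namespace GrVec

variable {A : Type} [AddCommGroup A] {Ω : AbelianCocycle A} [Fintype A]

/-- A linear equivalence preserving degrees is an isomorphism. -/
def isoOfEquiv {X Y : GrVec Ω} (e : X.carrier ≃ₗ[ℂ] Y.carrier)
    (h : ∀ a v, X.Homog a v → Y.Homog a (e v)) : X ≅ Y where
  hom := (⟨e.toLinearMap, comm_of_homog _ h⟩ : Hom X Y)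
  inv := (⟨e.symm.toLinearMap, fun d v => by
    apply e.injective
    have := comm_of_homog e.toLinearMap h d (e.symm v)
    simp only [LinearEquiv.coe_coe, LinearEquiv.apply_symm_apply] at this ⊢
    exact this.symm⟩ : Hom Y X)
  hom_inv_id := hom_ext (LinearMap.ext fun v => e.symm_apply_apply v)
  inv_hom_id := hom_ext (LinearMap.ext fun v => e.apply_symm_apply v)

/-- The linear equivalence underlying an isomorphism. -/
def equivOfIso {X Y : GrVec Ω} (i : X ≅ Y) : X.carrier ≃ₗ[ℂ] Y.carrier :=
  LinearEquiv.ofLinearMap (Hom.lin i.hom) (Hom.lin i.inv)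
    (by rw [← comp_lin, i.inv_hom_id, id_lin]) (by rw [← comp_lin, i.hom_inv_id, id_lin])

theorem finrank_eq_of_iso {X Y : GrVec Ω} (i : X ≅ Y) :
    Module.finrank ℂ X.carrier = Module.finrank ℂ Y.carrier := (equivOfIso i).finrank_eq

theorem finrank_tensorObj (X Y : GrVec Ω) : Module.finrank ℂ (X ⊗ Y : GrVec Ω).carrier =
    Module.finrank ℂ X.carrier * Module.finrank ℂ Y.carrier :=
  Module.finrank_tensorProduct

/-- `ℂ_a ⊗ ℂ_b ≅ ℂ_{a+b}`. -/
def lineTensor (a b : A) : line Ω a ⊗ line Ω b ≅ line Ω (a + b) :=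
  isoOfEquiv (X := tensor (line Ω a) (line Ω b)) (Y := line Ω (a + b)) (TensorProduct.lid ℂ ℂ)
    fun d t ht => by
      obtain ⟨z, rfl⟩ := (TensorProduct.lid ℂ ℂ).symm.surjective t
      by_cases h : d = a + b
      · subst h; exact line_homog _ _
      · have h1 : (tensor (line Ω a) (line Ω b)).Homog (a + b)
            ((TensorProduct.lid ℂ ℂ).symm z) :=
          (line_homog (Ω := Ω) a 1).tmul (line_homog (Ω := Ω) b z)
        have h2 := h1.proj_eq d
        rw [if_neg h] at h2
        have h3 : (TensorProduct.lid ℂ ℂ).symm z = 0 := ht.symm.trans h2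
        rw [h3, map_zero]
        exact homog_zero _ _

theorem eq_of_line_iso {a b : A} (i : line Ω a ≅ line Ω b) : a = b := by
  have h : (line Ω b).Homog a (Hom.lin i.hom (1 : ℂ)) := (line_homog (Ω := Ω) a 1).map i.hom
  rcases eq_zero_of_line h with h | h
  · exact h
  · exact absurd ((equivOfIso i).injective (h.trans (map_zero (equivOfIso i)).symm)) one_ne_zero

theorem exists_line_iso {X : GrVec Ω} (h : Module.finrank ℂ X.carrier = 1) :
    ∃ a, Nonempty (X ≅ line Ω a) := by
  obtain ⟨v, hv⟩ : ∃ v : X.carrier, v ≠ 0 := by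
    have : Nontrivial X.carrier := Module.nontrivial_of_finrank_pos (R := ℂ) (by omega)
    exact exists_ne 0
  obtain ⟨a, ha⟩ : ∃ a, X.proj a v ≠ 0 := by
    by_contra hcon
    push Not at hcon
    exact hv (by rw [← X.sum_proj v]; simp [hcon])
  have hs := (finrank_eq_one_iff_of_nonzero' _ ha).mp h
  refine ⟨a, ⟨(isoOfEquiv (X := line Ω a) (Y := X) (LinearEquiv.ofBijective
    (LinearMap.toSpanSingleton ℂ X.carrier (X.proj a v)) ⟨?_, ?_⟩) ?_).symm⟩⟩
  · intro z w hzw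
    exact smul_left_injective ℂ ha hzw
  · intro w
    obtain ⟨c, hc⟩ := hs w
    exact ⟨c, hc⟩
  · intro d z hz
    rcases eq_zero_of_line hz with rfl | rfl
    · exact (X.homog_proj _ v).smul z
    · simpa using X.homog_zero d

end GrVec

namespace BrAut

variable {B : SpinDatum}

theorem finrank_map (S : BrAut B) (a : B.A) :
    Module.finrank ℂ (S.F.obj (B.simpleObj a)).carrier = 1 := by
  have i : S.F.obj (B.simpleObj a) ⊗ S.F.obj (B.simpleObj (-a)) ≅ B.simpleObj 0 :=
    Functor.Monoidal.μIso S.F _ _ ≪≫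
      S.F.mapIso (GrVec.lineTensor a (-a) ≪≫ eqToIso (congrArg (GrVec.line B.Ω) (add_neg_cancel a))) ≪≫
      (Functor.Monoidal.εIso S.F).symm
  have h := GrVec.finrank_eq_of_iso i
  rw [GrVec.finrank_tensorObj] at h
  have h1 : Module.finrank ℂ (B.simpleObj 0).carrier = 1 := Module.finrank_self ℂ
  exact Nat.eq_one_of_mul_eq_one_right (h.trans h1)

/-- `S` maps `ℂ_a` to a simple object: there is `b` with `S(ℂ_a) ≅ ℂ_b`. -/
theorem exists_perm (S : BrAut B) (a : B.A) :
    ∃ b, Nonempty (S.F.obj (B.simpleObj a) ≅ B.simpleObj b) :=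
  GrVec.exists_line_iso (S.finrank_map a)

/-- The element `S(a)` of `A` with `S(ℂ_a) ≅ ℂ_{S(a)}`. -/
def permFun (S : BrAut B) (a : B.A) : B.A := (S.exists_perm a).choose

/-- The isomorphism `S(ℂ_a) ≅ ℂ_{S(a)}`. -/
def permIso (S : BrAut B) (a : B.A) :
    S.F.obj (B.simpleObj a) ≅ B.simpleObj (S.permFun a) := (S.exists_perm a).choose_spec.some

theorem permFun_eq (S : BrAut B) {a b : B.A}
    (i : S.F.obj (B.simpleObj a) ≅ B.simpleObj b) : S.permFun a = b :=
  GrVec.eq_of_line_iso ((S.permIso a).symm ≪≫ i)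

/-- The automorphism of `A` induced by an autoequivalence. -/
def perm (S : BrAut B) : B.A ≃+ B.A :=
  AddEquiv.ofBijective
    (AddMonoidHom.mk' S.permFun fun a b => S.permFun_eq
      (S.F.mapIso (GrVec.lineTensor a b).symm ≪≫ (Functor.Monoidal.μIso S.F _ _).symm ≪≫
        (S.permIso a ⊗ᵢ S.permIso b) ≪≫ GrVec.lineTensor _ _))
    (Finite.injective_iff_bijective.mp fun a b h => GrVec.eq_of_line_iso
      (S.F.preimageIso (S.permIso a ≪≫ eqToIso (by
        change S.permFun a = S.permFun b at h
        rw [h]) ≪≫ (S.permIso b).symm)))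

theorem perm_apply (S : BrAut B) (a : B.A) : S.perm a = S.permFun a := rfl

theorem perm_fermion (S : BrAut B) : S.perm B.f = B.f := S.permFun_eq S.fermion.some

end BrAut

/-- The group `Aut_⊗^br(𝓑, f)` of isomorphism classes of braided tensor autoequivalences fixing
`f`, with multiplication induced by composition. -/
abbrev AutGroup (B : SpinDatum) : Type 1 := Skeleton (BrAut B)

namespace BrAut

variable {B : SpinDatum}

theorem perm_eq_of_iso {S T : BrAut B} (i : S ≅ T) (a : B.A) : S.perm a = T.perm a :=
  S.permFun_eq (i.hom.iso.app _ ≪≫ T.permIso a)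

theorem perm_out (S : BrAut B) (a : B.A) : (toSkeleton S).out.perm a = S.perm a :=
  perm_eq_of_iso (fromSkeletonToSkeletonIso S) a

end BrAut

/-- The action of `Aut_⊗^br(𝓑, f)` on `A`, as a homomorphism to the monoid of ℤ-linear
endomorphisms. -/
def permRep (B : SpinDatum) : Representation ℤ (AutGroup B) B.A where
  toFun x := x.out.perm.toAddMonoidHom.toIntLinearMap
  map_one' := by
    refine LinearMap.ext fun a => ?_
    change (toSkeleton (𝟙_ (BrAut B))).out.perm a = a
    rw [BrAut.perm_out]
    exact BrAut.permFun_eq _ (Iso.refl _)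
  map_mul' x y := by
    refine LinearMap.ext fun a => ?_
    change (toSkeleton (x.out ⊗ y.out)).out.perm a = x.out.perm (y.out.perm a)
    rw [BrAut.perm_out]
    exact BrAut.permFun_eq _ (x.out.F.mapIso (y.out.permIso a) ≪≫ x.out.permIso _)

theorem permRep_toSkeleton (B : SpinDatum) (S : BrAut B) (a : B.A) :
    permRep B (toSkeleton S) a = S.perm a := BrAut.perm_out S a

theorem permRep_fermion (B : SpinDatum) (x : AutGroup B) : permRep B x B.f = B.f :=
  x.out.perm_fermion

/-! The exact sequence `0 → ℤ/2 → A → ℤ/2 → 0` and its connecting homomorphism. -/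

namespace AbelianCocycle

variable {A : Type} [AddCommGroup A] (Ω : AbelianCocycle A)

/-- The symmetric bicharacter `b(x, y) = c(x, y) c(y, x)`, i.e. the double braiding. -/
def b (x y : A) : ℂˣ := Ω.c x y * Ω.c y x

theorem b_comm (x y : A) : Ω.b x y = Ω.b y x := mul_comm _ _

theorem b_add (x y z : A) : Ω.b (x + y) z = Ω.b x z * Ω.b y z := by
  have h1 := Ω.hexagon_right x y z
  have h2 := Ω.hexagon_left z x y
  rw [div_eq_iff_eq_mul] at h1 h2
  rw [b, b, b, h1, h2]
  simp only [div_eq_mul_inv, mul_inv]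
  have : ∀ p q s t u v w : ℂˣ, p * (q⁻¹ * s⁻¹) * (t * u) * (s * q * p⁻¹ * (v * w)) =
      t * v * (u * w) := by
    intro p q s t u v w
    calc _ = (p * p⁻¹) * (q * q⁻¹) * (s * s⁻¹) * (t * v * (u * w)) := by ac_rfl
      _ = _ := by simp
  exact this _ _ _ _ _ _ _

theorem b_zero (z : A) : Ω.b 0 z = 1 := by
  have h := Ω.b_add 0 0 z
  rw [add_zero] at h
  exact left_eq_mul.mp h

end AbelianCocycle

namespace SpinDatum

variable (B : SpinDatum)

theorem f_ne_zero : B.f ≠ 0 := by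
  intro hf
  have h := B.Ω.hexagon_left 0 0 0
  have hc := B.c_f_f
  rw [hf] at hc
  rw [add_zero, B.Ω.ω_zero, hc] at h
  have := congrArg (fun u : ℂˣ => (u : ℂ)) h
  norm_num at this

theorem b_f (a : B.A) : B.Ω.b a B.f = 1 ∨ B.Ω.b a B.f = -1 := by
  have h := B.Ω.b_add B.f B.f a
  rw [B.f_add_f, B.Ω.b_zero, B.Ω.b_comm] at h
  have h' : ((B.Ω.b a B.f : ℂˣ) : ℂ) * (B.Ω.b a B.f : ℂˣ) = 1 := by
    rw [← Units.val_mul, ← h, Units.val_one]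
  rcases mul_self_eq_one_iff.mp h' with h | h
  · exact Or.inl (Units.ext h)
  · exact Or.inr (Units.ext h)

theorem neg_one_ne : (-1 : ℂˣ) ≠ 1 := by
  intro h
  have := congrArg (fun u : ℂˣ => (u : ℂ)) h
  norm_num at this

open Classical in
/-- The restriction map `r : A → ℤ/2`: `b(a, f) = (-1)^{r(a)}`. -/
def restr : B.A →+ ZMod 2 where
  toFun a := if B.Ω.b a B.f = 1 then 0 else 1
  map_zero' := if_pos (B.Ω.b_zero _)
  map_add' x y := by
    rw [B.Ω.b_add]
    have : (1 + 1 : ZMod 2) = 0 := rfl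
    rcases B.b_f x with hx | hx <;> rcases B.b_f y with hy | hy <;>
      simp [hx, hy, this]

theorem restr_eq_zero_iff (a : B.A) : B.restr a = 0 ↔ B.Ω.b a B.f = 1 := by
  simp [restr]

theorem restr_f : B.restr B.f = 0 := by
  rw [restr_eq_zero_iff, AbelianCocycle.b, B.c_f_f]
  simp

theorem zmod_two (x : ZMod 2) : x = 0 ∨ x = 1 := by
  revert x; decide

theorem exists_restr : ∃ a, B.restr a = 1 := by
  by_contra h
  push Not at h
  refine B.f_ne_zero (B.nondegenerate _ fun a => ?_)
  have := (B.restr_eq_zero_iff a).mp ((zmod_two _).resolve_right (h a))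
  rwa [B.Ω.b_comm] at this

theorem restr_eq_zero {a : B.A} (h : B.restr a = 0) : a = 0 ∨ a = B.f := by
  classical
  by_contra hcon
  push Not at hcon
  obtain ⟨b, hb⟩ := B.exists_restr
  have hs : ∀ x, B.restr x = 0 → x ≠ b := by
    rintro x hx rfl
    rw [hx] at hb
    exact absurd hb (by decide)
  have hs' : ∀ x, B.restr x = 0 → x ≠ b + B.f := by
    rintro x hx rfl
    rw [map_add, restr_f, add_zero] at hx
    rw [hx] at hb
    exact absurd hb (by decide)
  have h5 : ({0, B.f, a, b, b + B.f} : Finset B.A).card = 5 := by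
    rw [Finset.card_insert_of_notMem, Finset.card_insert_of_notMem,
      Finset.card_insert_of_notMem, Finset.card_insert_of_notMem, Finset.card_singleton]
    · simp [B.f_ne_zero]
    · simp [hs a h, hs' a h]
    · simp [hcon.2.symm, hs _ B.restr_f, hs' _ B.restr_f]
    · simp [B.f_ne_zero.symm, hcon.1.symm, hs 0 (map_zero _), hs' 0 (map_zero _)]
  have := Finset.card_le_univ ({0, B.f, a, b, b + B.f} : Finset B.A)
  rw [h5, B.card_eq] at this
  omega

/-- The inclusion `ℤ/2 → A`, `1 ↦ f`. -/
def incl : ZMod 2 →+ B.A :=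
  ZMod.lift 2 ⟨zmultiplesHom B.A B.f, by
    change (2 : ℤ) • B.f = 0
    rw [two_smul, B.f_add_f]⟩

theorem incl_one : B.incl 1 = B.f := by
  have := ZMod.lift_coe 2 ⟨zmultiplesHom B.A B.f, by
    change (2 : ℤ) • B.f = 0
    rw [two_smul, B.f_add_f]⟩ 1
  simpa [incl] using this

theorem restr_permRep (x : AutGroup B) (a : B.A) : B.restr (permRep B x a) = B.restr a := by
  have key : ∀ d, B.restr (permRep B x d) = 0 ↔ B.restr d = 0 := by
    intro d
    have hinj : Function.Injective (permRep B x) := x.out.perm.injective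
    constructor
    · intro h
      rcases B.restr_eq_zero h with h | h
      · rw [hinj (h.trans (map_zero (permRep B x)).symm), map_zero]
      · rw [hinj (h.trans (permRep_fermion B x).symm), restr_f]
    · intro h
      rcases B.restr_eq_zero h with rfl | rfl
      · rw [map_zero, map_zero]
      · rw [permRep_fermion, restr_f]
  rcases zmod_two (B.restr a) with h | h
  · rw [h, key, h]
  · rw [h]
    exact (zmod_two _).resolve_left fun h' => by
      rw [key, h] at h'
      exact absurd h' (by decide)

end SpinDatum

theorem rep_exact {k G : Type} [CommRing k] [Group G] (S : ShortComplex (Rep.{0} k G))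
    (h : ∀ x : S.X₂, S.g x = 0 → ∃ y : S.X₁, S.f y = x) : S.Exact :=
  (forget₂ (Rep.{0} k G) (ModuleCat k)).reflects_exact_of_faithful _ <|
    (ShortComplex.moduleCat_exact_iff _).2 h

section Cohomology

variable {B : SpinDatum} {G : Type} [Group G] (ρ : G →* AutGroup B)

/-- The trivial `G`-module `ℤ/2`. -/
abbrev zmodTwo (G : Type) [Group G] : Rep.{0} ℤ G := Rep.trivial ℤ G (ZMod 2)

/-- `A` as a `G`-module, through `ρ`. -/
abbrev moduleA : Rep.{0} ℤ G := Rep.of ((permRep B).comp ρ)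

/-- The `G`-module map `ℤ/2 → A`, `1 ↦ f`. -/
def inclRep : zmodTwo G ⟶ moduleA ρ :=
  Rep.ofHom ⟨B.incl.toIntLinearMap, fun g => LinearMap.ext fun v => by
    change B.incl v = permRep B (ρ g) (B.incl v)
    rcases SpinDatum.zmod_two v with rfl | rfl
    · simp
    · rw [B.incl_one, permRep_fermion]⟩

/-- The `G`-module map `r : A → ℤ/2`. -/
def restrRep : moduleA ρ ⟶ zmodTwo G :=
  Rep.ofHom ⟨B.restr.toIntLinearMap, fun g => LinearMap.ext fun v =>
    B.restr_permRep (ρ g) v⟩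

/-- The sequence of `G`-modules `0 → ℤ/2 → A → ℤ/2 → 0`. -/
def fermionSeq : ShortComplex (Rep.{0} ℤ G) where
  X₁ := zmodTwo G
  X₂ := moduleA ρ
  X₃ := zmodTwo G
  f := inclRep ρ
  g := restrRep ρ
  zero := by
    ext v
    change B.restr (B.incl v) = 0
    rcases SpinDatum.zmod_two v with rfl | rfl
    · simp
    · rw [B.incl_one, B.restr_f]

theorem fermionSeq_shortExact : (fermionSeq ρ).ShortExact where
  exact := rep_exact _ fun (x : B.A) (hx : B.restr x = 0) => by
      rcases B.restr_eq_zero hx with rfl | rfl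
      · exact ⟨(0 : ZMod 2), map_zero B.incl⟩
      · exact ⟨(1 : ZMod 2), B.incl_one⟩
  mono_f := (Rep.mono_iff_injective _).2 fun (x y : ZMod 2) (h : B.incl x = B.incl y) => by
    rcases SpinDatum.zmod_two x with rfl | rfl <;> rcases SpinDatum.zmod_two y with rfl | rfl
    · rfl
    · rw [B.incl_one, map_zero] at h
      exact absurd h.symm B.f_ne_zero
    · rw [B.incl_one, map_zero] at h
      exact absurd h B.f_ne_zero
    · rfl
  epi_g := (Rep.epi_iff_surjective _).2 fun (x : ZMod 2) => by
    rcases SpinDatum.zmod_two x with rfl | rfl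
    · exact ⟨(0 : B.A), map_zero B.restr⟩
    · exact B.exists_restr

/-- The connecting homomorphism `d₂ : H²(G, ℤ/2) → H³(G, ℤ/2)`. -/
def d₂ : groupCohomology (zmodTwo G) 2 ⟶ groupCohomology (zmodTwo G) 3 :=
  groupCohomology.δ (fermionSeq_shortExact ρ) 2 3 rfl

/-- The map `r_* : H²(G, A) → H²(G, ℤ/2)`. -/
def rStar : groupCohomology (moduleA ρ) 2 ⟶ groupCohomology (zmodTwo G) 2 :=
  groupCohomology.map (MonoidHom.id G) (restrRep ρ) 2

end Cohomology

/-! Bosonic and fermionic actions. -/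

namespace GrVec

variable {A : Type} [AddCommGroup A] {Ω : AbelianCocycle A} [Fintype A]

/-- The endomorphism of `X` acting on the degree-`a` component as the scalar `s a`. -/
def diag (s : A → ℂ) (X : GrVec Ω) : X ⟶ X :=
  (⟨∑ a, s a • X.proj a, comm_of_homog _ fun d v hv => by
    classical
    have h : (∑ a, s a • X.proj a) v = s d • v := by
      simp [LinearMap.sum_apply, hv.proj_eq]
    rw [h]
    exact hv.smul _⟩ : Hom X X)

end GrVec

namespace SpinDatum

variable (B : SpinDatum)

/-- The automorphism `Ξ(a)` of the identity functor given by the character `b(a, -)` of `A`: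
it acts on the component of degree `x` of `X` as the double braiding `b(a, x)`. -/
def Xi (a : B.A) (X : B.Cat) : X ⟶ X := GrVec.diag (fun x => (B.Ω.b a x : ℂ)) X

/-- The fusion subcategory `⟨f⟩` generated by `f`: objects with components in degrees `0`, `f`. -/
def fermionProp : ObjectProperty B.Cat := fun X => ∀ a, a ≠ 0 → a ≠ B.f → X.proj a = 0

instance : B.fermionProp.IsMonoidal where
  prop_unit a ha _ := if_neg ha
  prop_tensor X Y hX hY a ha hf := by
    refine Finset.sum_eq_zero fun x _ => ?_
    by_cases h0 : x = 0
    · subst h0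
      rw [hY (a - 0) (by simpa using ha) (by simpa using hf), TensorProduct.map_zero_right]
    · by_cases h1 : x = B.f
      · subst h1
        rw [hY (a - B.f) (sub_ne_zero.mpr hf) (fun h => ha (by
          rw [sub_eq_iff_eq_add, B.f_add_f] at h; exact h)), TensorProduct.map_zero_right]
      · rw [hX x h0 h1, TensorProduct.map_zero_left]

/-- The inclusion functor of `⟨f⟩`. -/
abbrev fermionInc : B.fermionProp.FullSubcategory ⥤ B.Cat := B.fermionProp.ι

open Classical in
/-- The automorphism of `X` acting as `(-1)^s` in degree `f` and trivially in the other degrees;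
for `X` in `⟨f⟩` this is the action of the element `s` of the character group `ℤ/2` of `⟨f⟩`. -/
def sign (s : ZMod 2) (X : B.Cat) : X ⟶ X :=
  GrVec.diag (fun x => if x = B.f then (-1) ^ s.val else 1) X

end SpinDatum

section Actions

variable {B : SpinDatum} {G : Type} [Group G]

/-- A lifting of `ρ`, i.e. a bosonic action of `G` which realizes `ρ`: a monoidal functor from the
discrete monoidal category `G` to the monoidal category of braided tensor autoequivalences whose
value at `g` has isomorphism class `ρ g`. -/
structure Lifting (ρ : G →* AutGroup B) where
  toFunctor : Discrete G ⥤ BrAut B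
  [monoidal : toFunctor.Monoidal]
  lifts : ∀ g : G, toSkeleton (toFunctor.obj ⟨g⟩) = ρ g

namespace Lifting

variable {ρ : G →* AutGroup B}

attribute [instance] monoidal

/-- The autoequivalence `g_*`. -/
def aut (L : Lifting ρ) (g : G) : BrAut B := L.toFunctor.obj ⟨g⟩

/-- The tensor natural isomorphism `g_* ∘ h_* → (gh)_*`. -/
def mul (L : Lifting ρ) (g h : G) : L.aut g ⊗ L.aut h ⟶ L.aut (g * h) :=
  Functor.LaxMonoidal.μ L.toFunctor ⟨g⟩ ⟨h⟩

/-- The component `g_* (h_* X) → (gh)_* X`. -/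
def mulApp (L : Lifting ρ) (g h : G) (X : B.Cat) :
    (L.aut g).F.obj ((L.aut h).F.obj X) ⟶ (L.aut (g * h)).F.obj X :=
  (L.mul g h).iso.hom.app X

/-- Two liftings are equivalent if they are isomorphic as monoidal functors. -/
def Equivalent (L L' : Lifting ρ) : Prop :=
  ∃ τ : L.toFunctor ≅ L'.toFunctor, NatTrans.IsMonoidal τ.hom

theorem equivalent_equivalence : Equivalence (Equivalent (ρ := ρ)) where
  refl L := ⟨Iso.refl _, inferInstanceAs (NatTrans.IsMonoidal (𝟙 L.toFunctor))⟩
  symm := fun ⟨τ, _⟩ => ⟨τ.symm, inferInstanceAs (NatTrans.IsMonoidal τ.inv)⟩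
  trans := fun ⟨τ, _⟩ ⟨σ, _⟩ =>
    ⟨τ ≪≫ σ, inferInstanceAs (NatTrans.IsMonoidal (τ.hom ≫ σ.hom))⟩

/-- `L'` is equivalent to the twist of `L` by `z : G × G → A`, the action with the same
functors `g_*` and with the isomorphisms `g_* ∘ h_* → (gh)_*` multiplied by `Ξ(z(g, h))`. -/
def IsTwist (z : G × G → B.A) (L L' : Lifting ρ) : Prop :=
  ∃ η : ∀ g, L.aut g ⟶ L'.aut g, ∀ g h X,
    (L.mulApp g h X ≫ B.Xi (z (g, h)) ((L.aut (g * h)).F.obj X)) ≫ (η (g * h)).iso.hom.app X =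
      (η g ⊗ₘ η h).iso.hom.app X ≫ L'.mulApp g h X

/-- The restriction of the action `L` to `⟨f⟩` is isomorphic, as a monoidal functor, to the action
of `G` on `⟨f⟩` with `g_* = id` and with the isomorphisms `g_* ∘ h_* → (gh)_*` given by the
characters `z(g, h)` of `⟨f⟩`. -/
def RestrictsTo (L : Lifting ρ) (z : G × G → ZMod 2) : Prop :=
  ∃ η : ∀ g, B.fermionInc ⋙ (L.aut g).F ≅ B.fermionInc,
    (∀ g, NatTrans.IsMonoidal (η g).hom) ∧
    ∀ (g h : G) (X : B.fermionProp.FullSubcategory),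
      L.mulApp g h X.obj ≫ (η (g * h)).hom.app X =
        (L.aut g).F.map ((η h).hom.app X) ≫ (η g).hom.app X ≫ B.sign (z (g, h)) X.obj

/-- `L` is a fermionic action of the super-group `(G, α)`: its restriction to `⟨f⟩` corresponds to
the cohomology class `α`. -/
def IsFermionic (L : Lifting ρ) (α : groupCohomology (zmodTwo G) 2) : Prop :=
  ∃ z : groupCohomology.cocycles₂ (zmodTwo G),
    groupCohomology.H2π (zmodTwo G) z = α ∧ L.RestrictsTo z

end Lifting

/-- The equivalence of fermionic actions of `(G, α)` which realize `ρ`. -/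
def fermionicSetoid (ρ : G →* AutGroup B) (α : groupCohomology (zmodTwo G) 2) :
    Setoid {L : Lifting ρ // L.IsFermionic α} where
  r L L' := L.1.Equivalent L'.1
  iseqv := ⟨fun L => Lifting.equivalent_equivalence.refl L.1,
    Lifting.equivalent_equivalence.symm, Lifting.equivalent_equivalence.trans⟩

/-- Equivalence classes of fermionic actions of `(G, α)` which realize `ρ`. -/
abbrev FermionicClass (ρ : G →* AutGroup B) (α : groupCohomology (zmodTwo G) 2) : Type 1 :=
  Quotient (fermionicSetoid ρ α)

/-- The class of a fermionic action. -/
def fermionicClass {ρ : G →* AutGroup B} {α : groupCohomology (zmodTwo G) 2} (L : Lifting ρ)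
    (hL : L.IsFermionic α) : FermionicClass ρ α :=
  Quotient.mk _ ⟨L, hL⟩

/-- The kernel of `r_* : H²(G, A) → H²(G, ℤ/2)`. -/
abbrev kerRStar (ρ : G →* AutGroup B) : Submodule ℤ (groupCohomology (moduleA ρ) 2) :=
  LinearMap.ker (rStar ρ).hom

end Actions

/-! The explicit families `(ω_k, c_k)`, in multiplicative notation with `κ = exp(2πik)`. -/

theorem pow_eq_of_mod {x : ℂˣ} {n : ℕ} (hx : x ^ n = 1) {a b : ℕ} (h : a % n = b % n) :
    x ^ a = x ^ b := by
  rw [← Nat.div_add_mod a n, ← Nat.div_add_mod b n, h]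
  simp [pow_add, pow_mul, hx]

theorem abelian_aux₁ (x κ : ℂˣ) (a b c : ℕ) :
    (x ^ a * κ ^ b) * κ ^ c = x ^ a * κ ^ (b + c) := by
  rw [mul_assoc, pow_add]

theorem abelian_aux₂ (x κ : ℂˣ) (a b c d p q : ℕ) :
    κ ^ p * κ ^ q * ((x ^ a * κ ^ b) * (x ^ c * κ ^ d)) =
      x ^ (a + c) * κ ^ (p + q + b + d) := by
  simp only [pow_add]; ac_rfl

theorem abelian_aux₃ (x κ : ℂˣ) (a b p q : ℕ) :
    (x ^ a * κ ^ b) * (κ ^ p * κ ^ q) = x ^ a * κ ^ (b + p + q) := by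
  simp only [pow_add]; ac_rfl

theorem abelian_aux₄ (x κ : ℂˣ) (a b c d p : ℕ) :
    κ ^ p * ((x ^ a * κ ^ b) * (x ^ c * κ ^ d)) = x ^ (a + c) * κ ^ (p + b + d) := by
  simp only [pow_add]; ac_rfl

/-- For `A = ℤ/2 ⊕ ℤ/2` with elements `x = (x_v, x_f)` and `κ⁴ = 1`: `ω(x, y, z) = κ^{2 x_v}` if
`y_v + z_v ≥ 2` and `1` otherwise, `c(x, y) = (-1)^{(x_v + x_f) y_f} κ^{x_v y_v}`. -/
def kleinCocycle (κ : ℂˣ) (hκ : κ ^ 4 = 1) : AbelianCocycle (ZMod 2 × ZMod 2) where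
  ω x y z := if 2 ≤ y.1.val + z.1.val then κ ^ (2 * x.1.val) else 1
  c x y := (-1) ^ ((x.1.val + x.2.val) * y.2.val) * κ ^ (x.1.val * y.1.val)
  ω_zero x z := by
    have : ¬ 2 ≤ (0 : ZMod 2 × ZMod 2).1.val + z.1.val := by
      have := ZMod.val_lt z.1
      simp; omega
    exact if_neg this
  pentagon g h k l := by
    have h2 : (κ ^ 2) ^ 2 = 1 := by rw [← pow_mul]; exact hκ
    have hω : ∀ x y z : ZMod 2 × ZMod 2, (if 2 ≤ y.1.val + z.1.val then κ ^ (2 * x.1.val) else 1) =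
        (κ ^ 2) ^ (if 2 ≤ y.1.val + z.1.val then x.1.val else 0) := by
      intro x y z; split_ifs <;> simp [pow_mul]
    simp only [hω, ← pow_add]
    refine pow_eq_of_mod h2 ?_
    obtain ⟨g, g'⟩ := g; obtain ⟨h, h'⟩ := h; obtain ⟨k, k'⟩ := k; obtain ⟨l, l'⟩ := l
    simp only [Prod.mk_add_mk]
    clear g' h' k' l'
    revert g h k l; decide
  hexagon_left g h k := by
    have hω : ∀ x y z : ZMod 2 × ZMod 2, (if 2 ≤ y.1.val + z.1.val then κ ^ (2 * x.1.val) else 1) =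
        κ ^ (if 2 ≤ y.1.val + z.1.val then 2 * x.1.val else 0) := by
      intro x y z; split_ifs <;> simp
    rw [div_eq_div_iff_mul_eq_mul]
    simp only [hω]
    rw [abelian_aux₁, abelian_aux₂, pow_eq_of_mod (n := 2) (x := -1) (by simp)
      (b := (g.1.val + g.2.val) * h.2.val + (g.1.val + g.2.val) * k.2.val), pow_eq_of_mod hκ]
    · revert g h k; decide
    · revert g h k; decide
  hexagon_right g h k := by
    have hω : ∀ x y z : ZMod 2 × ZMod 2, (if 2 ≤ y.1.val + z.1.val then κ ^ (2 * x.1.val) else 1) =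
        κ ^ (if 2 ≤ y.1.val + z.1.val then 2 * x.1.val else 0) := by
      intro x y z; split_ifs <;> simp
    rw [div_eq_div_iff_mul_eq_mul]
    simp only [hω]
    rw [abelian_aux₃, abelian_aux₄, pow_eq_of_mod (n := 2) (x := -1) (by simp)
      (b := (g.1.val + g.2.val) * k.2.val + (h.1.val + h.2.val) * k.2.val), pow_eq_of_mod hκ]
    · revert g h k; decide
    · revert g h k; decide

/-- For `A = ℤ/4` and `κ⁴ = -1`: `ω(x, y, z) = (-1)^x` if `y + z ≥ 4` and `1` otherwise,
`c(x, y) = κ^{x y}`, for representatives `0 ≤ x, y, z < 4`. -/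
def cyclicCocycle (κ : ℂˣ) (hκ : κ ^ 4 = -1) : AbelianCocycle (ZMod 4) where
  ω x y z := if 4 ≤ y.val + z.val then (-1) ^ x.val else 1
  c x y := κ ^ (x.val * y.val)
  ω_zero x z := by
    have : ¬ 4 ≤ (0 : ZMod 4).val + z.val := by
      have := ZMod.val_lt z
      rw [ZMod.val_zero]; omega
    exact if_neg this
  pentagon g h k l := by
    have hω : ∀ x y z : ZMod 4, (if 4 ≤ y.val + z.val then (-1 : ℂˣ) ^ x.val else 1) =
        (-1) ^ (if 4 ≤ y.val + z.val then x.val else 0) := by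
      intro x y z; split_ifs <;> simp
    simp only [hω, ← pow_add]
    refine pow_eq_of_mod (n := 2) (by simp) ?_
    revert g h k l; decide
  hexagon_left g h k := by
    have h8 : κ ^ 8 = 1 := by
      rw [show 8 = 4 * 2 from rfl, pow_mul, hκ]; simp
    have hω : ∀ x y z : ZMod 4, (if 4 ≤ y.val + z.val then (-1 : ℂˣ) ^ x.val else 1) =
        κ ^ (if 4 ≤ y.val + z.val then 4 * x.val else 0) := by
      intro x y z; split_ifs <;> simp [pow_mul, hκ]
    rw [div_eq_div_iff_mul_eq_mul]
    simp only [hω, ← pow_add]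
    refine pow_eq_of_mod h8 ?_
    revert g h k; decide
  hexagon_right g h k := by
    have h8 : κ ^ 8 = 1 := by
      rw [show 8 = 4 * 2 from rfl, pow_mul, hκ]; simp
    have hω : ∀ x y z : ZMod 4, (if 4 ≤ y.val + z.val then (-1 : ℂˣ) ^ x.val else 1) =
        κ ^ (if 4 ≤ y.val + z.val then 4 * x.val else 0) := by
      intro x y z; split_ifs <;> simp [pow_mul, hκ]
    rw [div_eq_div_iff_mul_eq_mul]
    simp only [hω, ← pow_add]
    refine pow_eq_of_mod h8 ?_
    revert g h k; decide

theorem neg_one_pow_ne {n : ℕ} (h : n % 2 = 1) : (-1 : ℂˣ) ^ n ≠ 1 := by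
  rw [pow_eq_of_mod (n := 2) (x := -1) (by simp) (b := 1) h, pow_one]
  exact SpinDatum.neg_one_ne

/-- `Vec_A^{(ω_k,c_k)}` for `A = ℤ/2 ⊕ ℤ/2` and `f = (0, 1)`. -/
def kleinDatum (κ : ℂˣ) (hκ : κ ^ 4 = 1) : SpinDatum where
  A := ZMod 2 × ZMod 2
  Ω := kleinCocycle κ hκ
  f := (0, 1)
  f_add_f := by decide
  c_f_f := by
    change (-1 : ℂˣ) ^ ((0 + 1) * 1) * κ ^ (0 * 0) = -1
    simp
  nondegenerate := by
    rintro ⟨x, y⟩ h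
    have h1 := h (0, 1)
    have h2 := h (1, 0)
    rcases SpinDatum.zmod_two x with rfl | rfl
    · rcases SpinDatum.zmod_two y with rfl | rfl
      · rfl
      · change ((-1 : ℂˣ) ^ ((0 + 1) * 0) * κ ^ (0 * 1)) *
          ((-1 : ℂˣ) ^ ((1 + 0) * 1) * κ ^ (1 * 0)) = 1 at h2
        simp at h2
    · rcases SpinDatum.zmod_two y with rfl | rfl
      · change ((-1 : ℂˣ) ^ ((1 + 0) * 1) * κ ^ (1 * 0)) *
          ((-1 : ℂˣ) ^ ((0 + 1) * 0) * κ ^ (0 * 1)) = 1 at h1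
        simp at h1
      · change ((-1 : ℂˣ) ^ ((1 + 1) * 1) * κ ^ (1 * 0)) *
          ((-1 : ℂˣ) ^ ((0 + 1) * 1) * κ ^ (0 * 1)) = 1 at h1
        simp at h1
  card_eq := by decide

/-- `Vec_A^{(ω_k,c_k)}` for `A = ℤ/4` and `f = 2`. -/
def cyclicDatum (κ : ℂˣ) (hκ : κ ^ 4 = -1) : SpinDatum where
  A := ZMod 4
  Ω := cyclicCocycle κ hκ
  f := 2
  f_add_f := by decide
  c_f_f := hκ
  nondegenerate := by
    intro x h
    have h1 := h 1
    change κ ^ (x.val * 1) * κ ^ (1 * x.val) = 1 at h1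
    have h2 : (κ ^ 4) ^ x.val = 1 := by
      rw [← pow_add] at h1
      calc (κ ^ 4) ^ x.val = (κ ^ (x.val * 1 + 1 * x.val)) ^ 2 := by
            rw [← pow_mul, ← pow_mul]; congr 1; ring
        _ = 1 := by rw [h1, one_pow]
    rw [hκ] at h2
    by_contra hx
    have key : ∀ y : ZMod 4, y ≠ 0 → y.val % 2 = 1 ∨ y.val = 2 := by decide
    rcases key x hx with hx' | hx'
    · exact neg_one_pow_ne hx' h2
    · rw [hx', ← pow_add] at h1
      change κ ^ 4 = 1 at h1
      rw [hκ] at h1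
      exact SpinDatum.neg_one_ne h1
  card_eq := by decide

/-- The parameters of the pointed spin-modular categories of rank four. -/
inductive RankFour where
  | klein (κ : ℂˣ) (hκ : κ ^ 4 = 1)
  | cyclic (κ : ℂˣ) (hκ : κ ^ 4 = -1)

/-- The pointed spin-modular category `Vec_A^{(ω_k,c_k)}`. -/
def RankFour.datum : RankFour → SpinDatum
  | klein κ hκ => kleinDatum κ hκ
  | cyclic κ hκ => cyclicDatum κ hκ

end

/-!
An autoequivalence `S` of `Vec_A^{(ω,c)}` is reduced to scalars. Since every object is a sum of
lines `ℂ_a`, a choice of generators of the lines `S(ℂ_a)` gives linear isomorphisms `X ≅ S(X)`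
which are natural in `X` and move degree `a` to degree `S(a)` (`BrAut.frame`). In these frames the
tensor structure of `S` is multiplication by a 2-cochain `m(a, b)` (`BrAut.cochain`), a tensor
isomorphism is a function `A → ℂˣ` (`BrAut.coeff`), and the axioms become the equations
`BrAut.cochain_assoc`, `BrAut.cochain_braid` and `BrAut.coeff_mul`. Two facts follow.

* If `S` and `T` act in the same way on `A`, then the quotient of their cochains is a symmetric
  2-cocycle with values in the divisible group `ℂˣ`. It defines an abelian extension of `A`, which
  splits, so the quotient is a coboundary and `S ≅ T` (`BrAut.nonempty_hom_of_perm_eq`).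
* Two tensor isomorphisms `S ⟶ T` differ by a character of `A`, that is, by `Ξ(a) = b(a, -)` for a
  unique `a`, because `b` is non-degenerate (`BrAut.existsUnique_comp_xi`). As `S` preserves `b`,
  composition with `S` turns `Ξ(a)` into `Ξ(S(a))` (`BrAut.map_Xi`).

Hence the group of isomorphism classes acts faithfully on `A`. It fixes `0` and `f` and preserves
the coset `A ∖ {0, f}`, so it has at most two elements. The non-trivial one is given by an explicit
cochain (`CochainAut.cyclic`, `CochainAut.klein`), chosen such that the square of the
autoequivalence is the identity as a tensor functor and such that its restriction to `⟨f⟩` is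
trivial (`CochainAut.IsSwap`). Its powers form a strict action, and composing with `ρ` gives a
lifting of `ρ` with trivial restriction to `⟨f⟩` (`CochainAut.IsSwap.strictLifting`).

By the two facts, liftings of a fixed `ρ` up to equivalence form a torsor over `H²(G, A)`: the
failure of a family of isomorphisms `g_* ≅ g_*'` to be monoidal is a 2-cocycle
(`Lifting.exists_isTwist`), whose class is independent of the family (`Lifting.IsTwist.H2π_eq`) and
vanishes if and only if the liftings are equivalent (`Lifting.isTwist_zero_iff`). On `⟨f⟩` the
character `b(a, -)` is the sign character `r(a)`, so twisting by `z` changes the class of the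
restriction to `⟨f⟩` by `r_*[z]` (`Lifting.IsFermionic.twist`). Starting from the strict lifting,
the classes `α` which occur are those in the image of `r_*`, which is the kernel of `d₂` by the
long exact sequence, and the liftings with a given `α` form a torsor over the kernel of `r_*`.
-/

noncomputable section

/-! ### Morphisms from and to simple objects -/

namespace GrVec

variable {A : Type} [AddCommGroup A] {Ω : AbelianCocycle A} [Fintype A]

theorem sum_lin {X Y : GrVec Ω} {ι : Type} (s : Finset ι) (f : ι → (X ⟶ Y)) :
    (∑ i ∈ s, f i : X ⟶ Y).lin = ∑ i ∈ s, Hom.lin (f i) :=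
  map_sum (AddMonoidHom.mk' (fun g : X ⟶ Y => Hom.lin g) fun _ _ => rfl) f s

/-- The morphism `ℂ_a ⟶ X` which maps `1` to the degree-`a` component of `v`. -/
def lineTo (X : GrVec Ω) (a : A) (v : X.carrier) : line Ω a ⟶ X :=
  (⟨LinearMap.toSpanSingleton ℂ X.carrier (X.proj a v), comm_of_homog (X := line Ω a) _
    fun d z hz => by
      rcases eq_zero_of_line hz with rfl | rfl
      · exact (X.homog_proj d v).smul z
      · rw [map_zero]; exact X.homog_zero d⟩ : Hom _ _)

theorem lineTo_apply (X : GrVec Ω) (a : A) (v : X.carrier) (z : ℂ) :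
    (lineTo X a v).lin z = z • X.proj a v := rfl

theorem lineTo_comp {X Y : GrVec Ω} (a : A) (v : X.carrier) (f : X ⟶ Y) :
    lineTo X a v ≫ f = lineTo Y a (f.lin v) :=
  hom_ext (LinearMap.ext fun z => by
    rw [comp_lin, LinearMap.comp_apply, lineTo_apply, map_smul, f.comm, lineTo_apply])

theorem lineTo_add (X : GrVec Ω) (a : A) (v w : X.carrier) :
    lineTo X a (v + w) = lineTo X a v + lineTo X a w :=
  hom_ext (LinearMap.ext fun z => by
    rw [add_lin, LinearMap.add_apply, lineTo_apply, map_add, smul_add, lineTo_apply, lineTo_apply])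

theorem lineTo_smul (X : GrVec Ω) (a : A) (r : ℂ) (v : X.carrier) :
    lineTo X a (r • v) = r • lineTo X a v :=
  hom_ext (LinearMap.ext fun z => by
    rw [smul_lin, LinearMap.smul_apply, lineTo_apply, map_smul, smul_comm, lineTo_apply])

theorem lineTo_proj (X : GrVec Ω) (a : A) (v : X.carrier) :
    lineTo X a (X.proj a v) = lineTo X a v :=
  hom_ext (LinearMap.ext fun z => by rw [lineTo_apply, lineTo_apply, proj_proj])

theorem lineTo_one (a : A) : lineTo (line Ω a) a (1 : ℂ) = 𝟙 _ :=
  hom_ext (LinearMap.ext fun z => by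
    have h : (line Ω a).proj a (1 : ℂ) = (1 : ℂ) := line_homog a 1
    rw [lineTo_apply, h]
    exact mul_one z)

theorem lineTo_of_ne {X : GrVec Ω} {a b : A} (h : b ≠ a) {v : X.carrier} (hv : X.Homog a v) :
    lineTo X b v = 0 := by
  classical
  refine hom_ext (LinearMap.ext fun z => ?_)
  rw [lineTo_apply, hv.proj_eq, if_neg h, smul_zero]
  rfl

/-- The morphism `X ⟶ ℂ_a` given by a linear form on the degree-`a` component. -/
def toLine (X : GrVec Ω) (a : A) (l : X.carrier →ₗ[ℂ] ℂ) : X ⟶ line Ω a :=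
  (⟨l ∘ₗ X.proj a, comm_of_homog (Y := line Ω a) _ fun d v hv => by
      classical
      rw [LinearMap.comp_apply, hv.proj_eq]
      split_ifs with h
      · subst h; exact line_homog _ _
      · rw [map_zero]; exact homog_zero _ _⟩ : Hom _ _)

theorem toLine_apply (X : GrVec Ω) (a : A) (l : X.carrier →ₗ[ℂ] ℂ) (v : X.carrier) :
    (toLine X a l).lin v = l (X.proj a v) := rfl

/-- Every object is a direct sum of simple ones: the identity factors through the lines spanned by
the homogeneous components of a basis. -/
theorem sum_toLine_lineTo (X : GrVec Ω) :
    ∑ a, ∑ i, toLine X a ((Module.finBasis ℂ X.carrier).coord i) ≫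
      lineTo X a (Module.finBasis ℂ X.carrier i) = 𝟙 X := by
  refine hom_ext (LinearMap.ext fun v => ?_)
  rw [sum_lin, LinearMap.sum_apply]
  refine (Finset.sum_congr rfl fun a _ => ?_).trans (X.sum_proj v)
  rw [sum_lin, LinearMap.sum_apply]
  conv_rhs => rw [← X.proj_proj, ← (Module.finBasis ℂ X.carrier).sum_repr (X.proj a v), map_sum]
  exact Finset.sum_congr rfl fun i _ => (map_smul _ _ _).symm

theorem diag_apply (s : A → ℂ) {X : GrVec Ω} {a : A} {v : X.carrier} (hv : X.Homog a v) :
    (diag s X).lin v = s a • v := by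
  classical
  change (∑ a, s a • X.proj a) v = s a • v
  simp [LinearMap.sum_apply, hv.proj_eq]

theorem diag_natural (s : A → ℂ) {X Y : GrVec Ω} (f : X ⟶ Y) : diag s X ≫ f = f ≫ diag s Y :=
  hom_ext (ext₁ fun a v hv => by
    rw [comp_lin, comp_lin, LinearMap.comp_apply, LinearMap.comp_apply, diag_apply s hv,
      diag_apply s (hv.map f), map_smul])

theorem diag_comp (s t : A → ℂ) (X : GrVec Ω) : diag s X ≫ diag t X = diag (fun a => s a * t a) X :=
  hom_ext (ext₁ fun a v hv => by
    rw [comp_lin, LinearMap.comp_apply, diag_apply s hv, map_smul, diag_apply t hv,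
      diag_apply _ hv, smul_smul])

theorem diag_one (X : GrVec Ω) : diag (fun _ => 1) X = 𝟙 X :=
  hom_ext (ext₁ fun a v hv => by rw [diag_apply _ hv, one_smul]; rfl)

end GrVec

/-! ### Trivialization of autoequivalences on underlying vector spaces -/

namespace BrAut

open Functor.LaxMonoidal GrVec

variable {B : SpinDatum} (S T : BrAut B)

/-- A generator of the one-dimensional space underlying `S(ℂ_a)`. -/
def gen (a : B.A) : (S.F.obj (B.simpleObj a)).carrier := (S.permIso a).inv.lin (1 : ℂ)

theorem gen_ne_zero (a : B.A) : S.gen a ≠ 0 := fun h =>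
  one_ne_zero ((equivOfIso (S.permIso a).symm).injective (h.trans (map_zero _).symm))

theorem homog_gen (a : B.A) : (S.F.obj (B.simpleObj a)).Homog (S.perm a) (S.gen a) :=
  (line_homog (Ω := B.Ω) (S.perm a) 1).map (S.permIso a).inv

theorem exists_smul_gen (a : B.A) (w : (S.F.obj (B.simpleObj a)).carrier) :
    ∃ c : ℂ, w = c • S.gen a := by
  obtain ⟨c, hc⟩ := (finrank_eq_one_iff_of_nonzero' _ (S.gen_ne_zero a)).mp (S.finrank_map a) w
  exact ⟨c, hc.symm⟩

/-- The linear map underlying `BrAut.frame`. -/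
def frameLin (X : B.Cat) : X.carrier →ₗ[ℂ] (S.F.obj X).carrier where
  toFun v := ∑ a, (S.F.map (lineTo X a v)).lin (S.gen a)
  map_add' v w := by
    simp only [lineTo_add, Functor.map_add, add_lin, LinearMap.add_apply, Finset.sum_add_distrib]
  map_smul' r v := by
    simp only [lineTo_smul, Functor.map_smul, smul_lin, LinearMap.smul_apply, Finset.smul_sum,
      RingHom.id_apply]

theorem frameLin_of_homog {X : B.Cat} {a : B.A} {v : X.carrier} (hv : X.Homog a v) :
    S.frameLin X v = (S.F.map (lineTo X a v)).lin (S.gen a) := by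
  refine Finset.sum_eq_single a (fun b _ hb => ?_) (by simp)
  rw [lineTo_of_ne hb hv, Functor.map_zero]
  rfl

theorem frameLin_natural {X Y : B.Cat} (f : X ⟶ Y) (v : X.carrier) :
    (S.F.map f).lin (S.frameLin X v) = S.frameLin Y (f.lin v) := by
  change (S.F.map f).lin (∑ a, _) = ∑ a, _
  rw [map_sum]
  refine Finset.sum_congr rfl fun a _ => ?_
  rw [← lineTo_comp, Functor.map_comp, comp_lin, LinearMap.comp_apply]

theorem frameLin_line (a : B.A) (z : ℂ) : S.frameLin (B.simpleObj a) z = z • S.gen a := by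
  have h1 : S.frameLin (B.simpleObj a) (1 : ℂ) = S.gen a := by
    rw [S.frameLin_of_homog (line_homog a 1), lineTo_one, CategoryTheory.Functor.map_id]
    rfl
  have h2 : z = z • (1 : ℂ) := (mul_one z).symm
  conv_lhs => rw [h2]
  exact (map_smul (S.frameLin (B.simpleObj a)) z (1 : ℂ)).trans (by rw [h1])

theorem frameLin_bijective (X : B.Cat) : Function.Bijective (S.frameLin X) := by
  constructor
  · refine (injective_iff_map_eq_zero _).mpr fun v hv => ?_
    rw [← X.sum_proj v]
    refine Finset.sum_eq_zero fun a _ => ?_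
    refine (Module.finBasis ℂ X.carrier).ext_elem fun i => ?_
    have h := S.frameLin_natural (toLine X a ((Module.finBasis ℂ X.carrier).coord i)) v
    rw [hv, map_zero, toLine_apply, frameLin_line] at h
    rw [map_zero]
    exact (smul_eq_zero.mp h.symm).resolve_right (S.gen_ne_zero a)
  · intro w
    have h : (S.F.map (𝟙 X)).lin w = w := by rw [CategoryTheory.Functor.map_id]; rfl
    rw [← h, ← sum_toLine_lineTo X, Functor.map_sum, sum_lin, LinearMap.sum_apply]
    refine Submodule.sum_mem (S.frameLin X).range fun a _ => ?_
    rw [Functor.map_sum, sum_lin, LinearMap.sum_apply]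
    refine Submodule.sum_mem (S.frameLin X).range fun i _ => ?_
    rw [Functor.map_comp, comp_lin, LinearMap.comp_apply]
    obtain ⟨c, hc⟩ := S.exists_smul_gen a
      ((S.F.map (toLine X a ((Module.finBasis ℂ X.carrier).coord i))).lin w)
    rw [hc]
    refine ⟨c • X.proj a (Module.finBasis ℂ X.carrier i), ?_⟩
    rw [map_smul, map_smul, S.frameLin_of_homog (X.homog_proj a _)]
    rw [lineTo_proj]

/-- A trivialization of `S` on underlying vector spaces, natural in `X`. It moves degree `a` to
degree `S.perm a`, and reduces statements about `S` to statements about scalars. -/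
def frame (X : B.Cat) : X.carrier ≃ₗ[ℂ] (S.F.obj X).carrier :=
  LinearEquiv.ofBijective (S.frameLin X) (S.frameLin_bijective X)

theorem frame_natural {X Y : B.Cat} (f : X ⟶ Y) (v : X.carrier) :
    (S.F.map f).lin (S.frame X v) = S.frame Y (f.lin v) := S.frameLin_natural f v

theorem frame_homog {X : B.Cat} {a : B.A} {v : X.carrier} (hv : X.Homog a v) :
    (S.F.obj X).Homog (S.perm a) (S.frame X v) := by
  change (S.F.obj X).Homog (S.perm a) (S.frameLin X v)
  rw [S.frameLin_of_homog hv]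
  exact (S.homog_gen a).map _

theorem frame_lineTo {X : B.Cat} {a : B.A} {v : X.carrier} (hv : X.Homog a v) :
    S.frame X v = (S.F.map (lineTo X a v)).lin (S.frame (B.simpleObj a) (1 : ℂ)) := by
  rw [frame_natural, lineTo_apply, one_smul, hv]

theorem exists_smul_frame (a : B.A) (w : (S.F.obj (B.simpleObj a)).carrier) :
    ∃ c : ℂ, w = c • S.frame (B.simpleObj a) (1 : ℂ) := by
  obtain ⟨c, hc⟩ := S.exists_smul_gen a w
  exact ⟨c, hc.trans (by rw [← one_smul ℂ (S.gen a), ← S.frameLin_line a 1]; rfl)⟩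

/-- Linear maps out of `S(X)` are determined by their values on the frame of homogeneous vectors. -/
theorem frame_ext {X : B.Cat} {M : Type} [AddCommGroup M] [Module ℂ M]
    {f g : (S.F.obj X).carrier →ₗ[ℂ] M}
    (h : ∀ a v, X.Homog a v → f (S.frame X v) = g (S.frame X v)) : f = g := by
  have : f ∘ₗ (S.frame X).toLinearMap = g ∘ₗ (S.frame X).toLinearMap := ext₁ h
  refine LinearMap.ext fun w => ?_
  obtain ⟨v, rfl⟩ := (S.frame X).surjective w
  exact LinearMap.congr_fun this v

/-- The tensor structure of `S` on underlying vector spaces. -/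
def muLin (X Y : B.Cat) : (S.F.obj X).carrier ⊗[ℂ] (S.F.obj Y).carrier →ₗ[ℂ]
    (S.F.obj (tensor X Y)).carrier := (μ S.F X Y).lin

theorem muLin_injective (X Y : B.Cat) : Function.Injective (S.muLin X Y) :=
  (equivOfIso (Functor.Monoidal.μIso S.F X Y)).injective

theorem muLin_natural {X Y X' Y' : B.Cat} (f : X ⟶ X') (g : Y ⟶ Y') (v : (S.F.obj X).carrier)
    (w : (S.F.obj Y).carrier) :
    (S.F.map (tmap f g)).lin (S.muLin X Y (v ⊗ₜ w)) =
      S.muLin X' Y' ((S.F.map f).lin v ⊗ₜ (S.F.map g).lin w) :=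
  (LinearMap.congr_fun (congrArg GrVec.Hom.lin (Functor.LaxMonoidal.μ_natural S.F f g))
    (v ⊗ₜ[ℂ] w)).symm

theorem one_tmul_one_ne_zero : (1 : ℂ) ⊗ₜ[ℂ] (1 : ℂ) ≠ 0 := fun h => by
  have h3 := congrArg (TensorProduct.lid ℂ ℂ) h
  rw [TensorProduct.lid_tmul, map_zero, one_smul] at h3
  exact one_ne_zero h3

theorem exists_cochain (a b : B.A) : ∃ m : ℂˣ,
    S.muLin _ _ (S.frame (B.simpleObj a) (1 : ℂ) ⊗ₜ S.frame (B.simpleObj b) (1 : ℂ)) =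
      (m : ℂ) • S.frame (tensor (B.simpleObj a) (B.simpleObj b)) ((1 : ℂ) ⊗ₜ (1 : ℂ)) := by
  set x := S.muLin _ _ (S.frame (B.simpleObj a) (1 : ℂ) ⊗ₜ S.frame (B.simpleObj b) (1 : ℂ)) with hx
  obtain ⟨c, hc⟩ := S.exists_smul_frame (a + b)
    ((S.F.map (lineTensor (Ω := B.Ω) a b).hom).lin x)
  have hx' : x = c • S.frame (tensor (B.simpleObj a) (B.simpleObj b)) ((1 : ℂ) ⊗ₜ (1 : ℂ)) := by
    refine (equivOfIso (S.F.mapIso (lineTensor (Ω := B.Ω) a b))).injective ?_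
    refine hc.trans ((map_smul _ _ _).trans ?_).symm
    congr 1
    refine (S.frame_natural (lineTensor (Ω := B.Ω) a b).hom _).trans (congrArg _ ?_)
    exact one_smul ℂ (1 : ℂ)
  have hx0 : x ≠ 0 := by
    intro h
    have h1 := S.muLin_injective _ _ (h.trans (map_zero _).symm)
    have h2 := (TensorProduct.congr (S.frame (B.simpleObj a)) (S.frame (B.simpleObj b))).injective
      ((TensorProduct.congr_tmul _ _ (1 : ℂ) (1 : ℂ)).trans (h1.trans (map_zero _).symm))
    exact one_tmul_one_ne_zero h2
  have hc0 : c ≠ 0 := by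
    rintro rfl
    exact hx0 (hx'.trans (zero_smul _ _))
  exact ⟨Units.mk0 c hc0, hx'⟩

/-- The scalars `m(a, b)` by which the tensor structure of `S` acts on frames. -/
def cochain (a b : B.A) : ℂˣ := (S.exists_cochain a b).choose

theorem muLin_frame {X Y : B.Cat} {a b : B.A} {v : X.carrier} {w : Y.carrier}
    (hv : X.Homog a v) (hw : Y.Homog b w) :
    S.muLin X Y (S.frame X v ⊗ₜ S.frame Y w) =
      (S.cochain a b : ℂ) • S.frame (tensor X Y) (v ⊗ₜ w) := by
  have hvw : (tmap (lineTo X a v) (lineTo Y b w)).lin ((1 : ℂ) ⊗ₜ[ℂ] (1 : ℂ)) = v ⊗ₜ[ℂ] w := by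
    change ((1 : ℂ) • X.proj a v) ⊗ₜ[ℂ] ((1 : ℂ) • Y.proj b w) = _
    rw [one_smul, one_smul]
    exact congrArg₂ _ hv hw
  rw [S.frame_lineTo hv, S.frame_lineTo hw, ← muLin_natural, (S.exists_cochain a b).choose_spec,
    map_smul, frame_natural, hvw]
  rfl

end BrAut

/-! ### Coherence of the scalars of an autoequivalence -/

namespace BrAut

open Functor.LaxMonoidal GrVec

variable {B : SpinDatum} (S T : BrAut B)

theorem smul_frame_cancel {X : B.Cat} {v : X.carrier} (hv : v ≠ 0) {r s : ℂ}
    (h : r • S.frame X v = s • S.frame X v) : r = s :=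
  smul_left_injective ℂ (fun h0 => hv ((S.frame X).map_eq_zero_iff.mp h0)) h

theorem one_tmul_one_tmul_one_ne_zero : (1 : ℂ) ⊗ₜ[ℂ] ((1 : ℂ) ⊗ₜ[ℂ] (1 : ℂ)) ≠ 0 := fun h => by
  have h3 := congrArg (TensorProduct.lid ℂ (ℂ ⊗[ℂ] ℂ)) h
  rw [TensorProduct.lid_tmul, map_zero, one_smul] at h3
  exact one_tmul_one_ne_zero h3

theorem exists_unitScalar : ∃ e : ℂ, (ε S.F).lin (1 : ℂ) = e • S.frame (B.simpleObj 0) (1 : ℂ) :=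
  S.exists_smul_frame 0 _

/-- The scalar by which the unit isomorphism of `S` acts on frames. -/
def unitScalar : ℂ := S.exists_unitScalar.choose

theorem unit_apply : (ε S.F).lin (1 : ℂ) = S.unitScalar • S.frame (B.simpleObj 0) (1 : ℂ) :=
  S.exists_unitScalar.choose_spec

theorem unitScalar_mul_cochain (a : B.A) : S.unitScalar * S.cochain 0 a = 1 := by
  have h := LinearMap.congr_fun (congrArg GrVec.Hom.lin
    (Functor.LaxMonoidal.left_unitality S.F (B.simpleObj a)))
    ((1 : ℂ) ⊗ₜ[ℂ] S.frame (B.simpleObj a) (1 : ℂ))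
  have h1 : (1 : ℂ) • S.frame (B.simpleObj a) (1 : ℂ) =
      (S.F.map (leftIso (B.simpleObj a)).hom).lin
        (S.muLin (B.simpleObj 0) (B.simpleObj a)
          ((ε S.F).lin (1 : ℂ) ⊗ₜ S.frame (B.simpleObj a) (1 : ℂ))) := h
  rw [unit_apply, ← TensorProduct.smul_tmul', map_smul,
    S.muLin_frame (line_homog 0 1) (line_homog a 1), smul_smul, map_smul, frame_natural] at h1
  have h2 : (leftIso (B.simpleObj a)).hom.lin ((1 : ℂ) ⊗ₜ[ℂ] (1 : ℂ)) = (1 : ℂ) :=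
    one_smul ℂ (1 : ℂ)
  rw [h2] at h1
  exact (S.smul_frame_cancel one_ne_zero h1).symm

/-- The compatibility of `S` with the braiding, read off on frames. -/
theorem cochain_braid (a b : B.A) :
    S.cochain a b * B.Ω.c a b = B.Ω.c (S.perm a) (S.perm b) * S.cochain b a := by
  have h := LinearMap.congr_fun (congrArg GrVec.Hom.lin
    (Functor.LaxBraided.braided (F := S.F) (B.simpleObj a) (B.simpleObj b)))
    (S.frame (B.simpleObj a) (1 : ℂ) ⊗ₜ[ℂ] S.frame (B.simpleObj b) (1 : ℂ))
  have h1 : (S.F.map (braidIso (B.simpleObj a) (B.simpleObj b)).hom).lin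
        (S.muLin _ _ (S.frame (B.simpleObj a) (1 : ℂ) ⊗ₜ S.frame (B.simpleObj b) (1 : ℂ))) =
      S.muLin _ _ (braidLin _ _
        (S.frame (B.simpleObj a) (1 : ℂ) ⊗ₜ S.frame (B.simpleObj b) (1 : ℂ))) := h
  have ha : (B.simpleObj a).Homog a (1 : ℂ) := line_homog a 1
  have hb : (B.simpleObj b).Homog b (1 : ℂ) := line_homog b 1
  have h2 : (braidIso (B.simpleObj a) (B.simpleObj b)).hom.lin ((1 : ℂ) ⊗ₜ[ℂ] (1 : ℂ)) =
    (B.Ω.c a b : ℂ) • (1 : ℂ) ⊗ₜ[ℂ] (1 : ℂ) := braidLin_tmul ha hb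
  rw [braidLin_tmul (S.frame_homog ha) (S.frame_homog hb), map_smul, S.muLin_frame ha hb,
    S.muLin_frame hb ha, map_smul, frame_natural, h2, map_smul, smul_smul, smul_smul] at h1
  exact Units.ext (S.smul_frame_cancel one_tmul_one_ne_zero h1)

/-- The compatibility of `S` with the associativity constraint, read off on frames. -/
theorem cochain_assoc (a b d : B.A) :
    S.cochain a b * S.cochain (a + b) d * (B.Ω.ω a b d)⁻¹ =
      (B.Ω.ω (S.perm a) (S.perm b) (S.perm d))⁻¹ * S.cochain b d * S.cochain a (b + d) := by
  have h := LinearMap.congr_fun (congrArg GrVec.Hom.lin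
    (Functor.LaxMonoidal.associativity S.F (B.simpleObj a) (B.simpleObj b) (B.simpleObj d)))
    ((S.frame (B.simpleObj a) (1 : ℂ) ⊗ₜ[ℂ] S.frame (B.simpleObj b) (1 : ℂ)) ⊗ₜ[ℂ]
      S.frame (B.simpleObj d) (1 : ℂ))
  have h1 : (S.F.map (assocIso (B.simpleObj a) (B.simpleObj b) (B.simpleObj d)).hom).lin
        (S.muLin (tensor (B.simpleObj a) (B.simpleObj b)) _ (S.muLin _ _
          (S.frame (B.simpleObj a) (1 : ℂ) ⊗ₜ S.frame (B.simpleObj b) (1 : ℂ)) ⊗ₜ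
            S.frame (B.simpleObj d) (1 : ℂ))) =
      S.muLin _ (tensor (B.simpleObj b) (B.simpleObj d))
        ((LinearMap.lTensor _ (S.muLin (B.simpleObj b) (B.simpleObj d))) (assocLin _ _ _
        ((S.frame (B.simpleObj a) (1 : ℂ) ⊗ₜ S.frame (B.simpleObj b) (1 : ℂ)) ⊗ₜ
          S.frame (B.simpleObj d) (1 : ℂ)))) := h
  have ha : (B.simpleObj a).Homog a (1 : ℂ) := line_homog a 1
  have hb : (B.simpleObj b).Homog b (1 : ℂ) := line_homog b 1
  have hd : (B.simpleObj d).Homog d (1 : ℂ) := line_homog d 1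
  have h2 : (assocIso (B.simpleObj a) (B.simpleObj b) (B.simpleObj d)).hom.lin
      (((1 : ℂ) ⊗ₜ[ℂ] (1 : ℂ)) ⊗ₜ[ℂ] (1 : ℂ)) =
    (((B.Ω.ω a b d)⁻¹ : ℂˣ) : ℂ) • (1 : ℂ) ⊗ₜ[ℂ] ((1 : ℂ) ⊗ₜ[ℂ] (1 : ℂ)) :=
    assocLin_tmul ha hb hd
  rw [assocLin_tmul (S.frame_homog ha) (S.frame_homog hb) (S.frame_homog hd), map_smul, map_smul,
    LinearMap.lTensor_tmul, S.muLin_frame ha hb, S.muLin_frame hb hd, TensorProduct.tmul_smul,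
    map_smul, S.muLin_frame ha (hb.tmul hd), ← TensorProduct.smul_tmul', map_smul,
    S.muLin_frame (ha.tmul hb) hd, map_smul, map_smul, frame_natural, h2, map_smul, smul_smul,
    smul_smul, smul_smul, smul_smul] at h1
  exact Units.ext (S.smul_frame_cancel one_tmul_one_tmul_one_ne_zero h1)

/-- Braided autoequivalences preserve the double braiding. -/
theorem b_perm (a b : B.A) : B.Ω.b (S.perm a) (S.perm b) = B.Ω.b a b := by
  have h1 := S.cochain_braid a b
  have h2 := S.cochain_braid b a
  refine mul_left_cancel (a := S.cochain a b * S.cochain b a) ?_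
  calc _ = (B.Ω.c (S.perm a) (S.perm b) * S.cochain b a) *
        (B.Ω.c (S.perm b) (S.perm a) * S.cochain a b) := by
        rw [AbelianCocycle.b]; ac_rfl
    _ = _ := by rw [← h1, ← h2, AbelianCocycle.b]; ac_rfl

/-! ### Tensor natural isomorphisms as scalars -/

variable {S T}

theorem exists_coeff (η : S ⟶ T) (a : B.A) : ∃ h : ℂˣ,
    (η.iso.hom.app (B.simpleObj a)).lin (S.frame _ (1 : ℂ)) =
      (h : ℂ) • T.frame (B.simpleObj a) (1 : ℂ) := by
  obtain ⟨c, hc⟩ := T.exists_smul_frame a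
    ((η.iso.hom.app (B.simpleObj a)).lin (S.frame _ (1 : ℂ)))
  have hc0 : c ≠ 0 := by
    rintro rfl
    rw [zero_smul] at hc
    have h1 := (equivOfIso (η.iso.app (B.simpleObj a))).injective (hc.trans (map_zero _).symm)
    exact one_ne_zero ((S.frame (B.simpleObj a)).map_eq_zero_iff.mp h1)
  exact ⟨Units.mk0 c hc0, hc⟩

/-- The scalars by which a tensor natural isomorphism acts on frames. -/
def coeff (η : S ⟶ T) (a : B.A) : ℂˣ := (exists_coeff η a).choose

theorem app_frame (η : S ⟶ T) {X : B.Cat} {a : B.A} {v : X.carrier} (hv : X.Homog a v) :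
    (η.iso.hom.app X).lin (S.frame X v) = (coeff η a : ℂ) • T.frame X v := by
  have h := LinearMap.congr_fun (congrArg GrVec.Hom.lin (η.iso.hom.naturality (lineTo X a v)))
    (S.frame _ (1 : ℂ))
  rw [comp_lin, comp_lin, LinearMap.comp_apply, LinearMap.comp_apply, ← S.frame_lineTo hv,
    (exists_coeff η a).choose_spec, map_smul, ← T.frame_lineTo hv] at h
  exact h

theorem coeff_mul (η : S ⟶ T) (a b : B.A) :
    coeff η (a + b) * S.cochain a b = T.cochain a b * (coeff η a * coeff η b) := by
  have h := LinearMap.congr_fun (congrArg GrVec.Hom.lin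
    (NatTrans.IsMonoidal.tensor (τ := η.iso.hom) (B.simpleObj a) (B.simpleObj b)))
    (S.frame (B.simpleObj a) (1 : ℂ) ⊗ₜ[ℂ] S.frame (B.simpleObj b) (1 : ℂ))
  have h1 : (η.iso.hom.app (tensor (B.simpleObj a) (B.simpleObj b))).lin
        (S.muLin _ _ (S.frame (B.simpleObj a) (1 : ℂ) ⊗ₜ S.frame (B.simpleObj b) (1 : ℂ))) =
      T.muLin _ _ ((η.iso.hom.app (B.simpleObj a)).lin (S.frame (B.simpleObj a) (1 : ℂ)) ⊗ₜ
        (η.iso.hom.app (B.simpleObj b)).lin (S.frame (B.simpleObj b) (1 : ℂ))) := h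
  have ha : (B.simpleObj a).Homog a (1 : ℂ) := line_homog a 1
  have hb : (B.simpleObj b).Homog b (1 : ℂ) := line_homog b 1
  rw [S.muLin_frame ha hb, map_smul, app_frame η (ha.tmul hb), app_frame η ha, app_frame η hb,
    ← TensorProduct.smul_tmul', TensorProduct.tmul_smul, map_smul, map_smul,
    T.muLin_frame ha hb, smul_smul, smul_smul, smul_smul] at h1
  refine Units.ext ((mul_comm _ _).trans
    ((T.smul_frame_cancel one_tmul_one_ne_zero h1).trans ?_))
  push_cast
  ring

theorem hom_ext_coeff {η θ : S ⟶ T} (h : ∀ a, coeff η a = coeff θ a) : η = θ :=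
  hom_ext fun X => GrVec.hom_ext (S.frame_ext fun a v hv => by
    rw [app_frame η hv, app_frame θ hv, h])

theorem coeff_eq (η : S ⟶ T) (a : B.A) {r : ℂˣ}
    (h : (η.iso.hom.app (B.simpleObj a)).lin (S.frame _ (1 : ℂ)) =
      (r : ℂ) • T.frame (B.simpleObj a) (1 : ℂ)) : coeff η a = r :=
  Units.ext (T.smul_frame_cancel one_ne_zero ((app_frame η (line_homog a 1)).symm.trans h))

end BrAut

/-! ### Symmetric 2-cocycles with divisible coefficients -/

section SymmetricCocycle

variable {A M : Type}

/-- The abelian extension of `A` by `M` defined by a symmetric 2-cocycle `ψ`: the set `A × M` with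
addition twisted by `ψ`. -/
structure CocycleExt (ψ : A → A → M) where
  base : A
  fiber : M

namespace CocycleExt

variable {ψ : A → A → M}

@[ext]
theorem ext' {x y : CocycleExt ψ} (h : x.base = y.base) (h' : x.fiber = y.fiber) : x = y := by
  cases x; cases y; simp_all

variable [AddCommGroup A] [AddCommGroup M]

/-- The group structure of the extension; the neutral element is `(0, -ψ(0, 0))`. -/
abbrev addCommGroup (hs : ∀ a b, ψ a b = ψ b a)
    (hc : ∀ a b d, ψ a b + ψ (a + b) d = ψ b d + ψ a (b + d)) : AddCommGroup (CocycleExt ψ) :=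
  have h0 : ∀ a, ψ 0 a = ψ 0 0 := fun a => by
    have := hc 0 0 a
    rw [add_zero, zero_add] at this
    exact (add_right_cancel (this.trans (add_comm _ _))).symm
  letI : Add (CocycleExt ψ) := ⟨fun x y => ⟨x.base + y.base, x.fiber + y.fiber + ψ x.base y.base⟩⟩
  letI : Zero (CocycleExt ψ) := ⟨⟨0, -ψ 0 0⟩⟩
  letI : Neg (CocycleExt ψ) := ⟨fun x => ⟨-x.base, -x.fiber - ψ (-x.base) x.base - ψ 0 0⟩⟩
  { AddGroup.ofLeftAxioms
      (fun x y z => ext' (add_assoc _ _ _) (by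
        change x.fiber + y.fiber + ψ x.base y.base + z.fiber + ψ (x.base + y.base) z.base =
          x.fiber + (y.fiber + z.fiber + ψ y.base z.base) + ψ x.base (y.base + z.base)
        have := hc x.base y.base z.base
        calc _ = x.fiber + y.fiber + z.fiber + (ψ x.base y.base + ψ (x.base + y.base) z.base) := by
              abel
          _ = _ := by rw [this]; abel))
      (fun x => ext' (zero_add _) (by
        change -ψ 0 0 + x.fiber + ψ 0 x.base = x.fiber
        rw [h0 x.base]; abel))
      (fun x => ext' (neg_add_cancel _) (by
        change -x.fiber - ψ (-x.base) x.base - ψ 0 0 + x.fiber + ψ (-x.base) x.base = -ψ 0 0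
        abel)) with
    add_comm := fun x y => ext' (add_comm _ _) (by
      change x.fiber + y.fiber + ψ x.base y.base = y.fiber + x.fiber + ψ y.base x.base
      rw [hs x.base, add_comm x.fiber]) }

end CocycleExt

variable [AddCommGroup A] [AddCommGroup M]

/-- A symmetric 2-cocycle with values in a divisible group is a coboundary: the extension which it
defines is abelian, hence split. -/
theorem exists_coboundary_of_symmetric [DivisibleBy M ℤ] (ψ : A → A → M)
    (hs : ∀ a b, ψ a b = ψ b a)
    (hc : ∀ a b d, ψ a b + ψ (a + b) d = ψ b d + ψ a (b + d)) :
    ∃ h : A → M, ∀ a b, h (a + b) = ψ a b + (h a + h b) := by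
  let _ := CocycleExt.addCommGroup hs hc
  have hadd : ∀ x y : CocycleExt ψ,
      x + y = ⟨x.base + y.base, x.fiber + y.fiber + ψ x.base y.base⟩ := fun _ _ => rfl
  have h0 : ∀ a, ψ a 0 = ψ 0 0 := fun a => by
    have := hc a 0 0
    rw [add_zero, add_zero] at this
    exact add_right_cancel this
  let i : M →+ CocycleExt ψ := AddMonoidHom.mk' (fun x => ⟨0, x - ψ 0 0⟩) fun x y => by
    rw [hadd]
    exact CocycleExt.ext' (add_zero _).symm (by dsimp only; abel)
  have hi : Function.Injective i.toIntLinearMap := fun x y h =>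
    sub_left_injective (congrArg CocycleExt.fiber h)
  obtain ⟨r, hr⟩ := (Module.Baer.of_divisible M).extension_property i.toIntLinearMap hi
    LinearMap.id
  have hr' : ∀ x, r ⟨0, x - ψ 0 0⟩ = x := fun x => LinearMap.congr_fun hr x
  refine ⟨fun a => -r ⟨a, 0⟩, fun a b => ?_⟩
  have h1 : (⟨a, 0⟩ + ⟨b, 0⟩ : CocycleExt ψ) = ⟨a + b, 0⟩ + ⟨0, ψ a b - ψ 0 0⟩ := by
    rw [hadd, hadd]
    refine CocycleExt.ext' (add_zero _).symm ?_
    change 0 + 0 + ψ a b = 0 + (ψ a b - ψ 0 0) + ψ (a + b) 0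
    rw [h0 (a + b)]; abel
  have h2 := congrArg r h1
  rw [map_add, map_add, hr'] at h2
  change -r ⟨a + b, 0⟩ = ψ a b + (-r ⟨a, 0⟩ + -r ⟨b, 0⟩)
  rw [eq_sub_of_add_eq h2.symm]
  abel

/-- The multiplicative group `ℂˣ` is divisible. -/
instance : DivisibleBy (Additive ℂˣ) ℤ :=
  have : DivisibleBy (Additive ℂˣ) ℕ := divisibleByOfSMulRightSurj _ _ fun {n} hn x => by
    obtain ⟨z, hz⟩ := IsAlgClosed.exists_pow_nat_eq ((Additive.toMul x : ℂˣ) : ℂ)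
      (Nat.pos_of_ne_zero hn)
    have hz0 : z ≠ 0 := by
      rintro rfl
      rw [zero_pow hn] at hz
      exact (Additive.toMul x).ne_zero hz.symm
    exact ⟨Additive.ofMul (Units.mk0 z hz0), congrArg Additive.ofMul (Units.ext hz)⟩
  AddGroup.divisibleByIntOfDivisibleByNat _

end SymmetricCocycle

/-! ### The automorphisms given by characters -/

namespace SpinDatum

open GrVec

variable (B : SpinDatum)

theorem Xi_apply (a : B.A) {X : B.Cat} {x : B.A} {v : X.carrier} (hv : X.Homog x v) :
    (B.Xi a X).lin v = (B.Ω.b a x : ℂ) • v := diag_apply _ hv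

theorem Xi_natural (a : B.A) {X Y : B.Cat} (f : X ⟶ Y) : B.Xi a X ≫ f = f ≫ B.Xi a Y :=
  diag_natural _ f

theorem Xi_comp (a a' : B.A) (X : B.Cat) : B.Xi a X ≫ B.Xi a' X = B.Xi (a + a') X := by
  refine (diag_comp _ _ X).trans (congrArg (fun s => diag s X) (funext fun x => ?_))
  rw [B.Ω.b_add, Units.val_mul]

theorem Xi_zero (X : B.Cat) : B.Xi 0 X = 𝟙 X := by
  refine (congrArg (fun s => diag s X) (funext fun x => ?_)).trans (diag_one X)
  rw [B.Ω.b_zero, Units.val_one]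

theorem Xi_tensor (a : B.A) (X Y : B.Cat) : B.Xi a (X ⊗ Y) = B.Xi a X ⊗ₘ B.Xi a Y := by
  refine GrVec.hom_ext (ext₂ fun x y v w hv hw => ?_)
  refine (B.Xi_apply a (hv.tmul hw)).trans ?_
  change _ = (B.Xi a X).lin v ⊗ₜ[ℂ] (B.Xi a Y).lin w
  rw [B.Xi_apply a hv, B.Xi_apply a hw, ← TensorProduct.smul_tmul', TensorProduct.tmul_smul,
    smul_smul, B.Ω.b_comm, B.Ω.b_add, Units.val_mul, B.Ω.b_comm x, B.Ω.b_comm y]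

theorem Xi_unit (a : B.A) : B.Xi a (𝟙_ B.Cat) = 𝟙 _ := by
  refine GrVec.hom_ext (LinearMap.ext fun z => ?_)
  refine (B.Xi_apply a (line_homog 0 z)).trans ?_
  rw [B.Ω.b_comm, B.Ω.b_zero, Units.val_one, one_smul]
  rfl

/-- By non-degeneracy, every character of `A` is of the form `b(a, -)` for a unique `a`. -/
theorem existsUnique_b_eq (χ : B.A → ℂˣ) (hχ : ∀ x y, χ (x + y) = χ x * χ y) :
    ∃! a, ∀ x, B.Ω.b a x = χ x := by
  have hb : ∀ a x y, B.Ω.b a (x + y) = B.Ω.b a x * B.Ω.b a y := fun a x y => by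
    rw [B.Ω.b_comm, B.Ω.b_add, B.Ω.b_comm x, B.Ω.b_comm y]
  have hinj : ∀ a a', (∀ x, B.Ω.b a x = B.Ω.b a' x) → a = a' := fun a a' h => by
    refine sub_eq_zero.mp (B.nondegenerate _ fun x => ?_)
    change B.Ω.b (a - a') x = 1
    have h1 := B.Ω.b_add (a - a') a' x
    rw [sub_add_cancel, h x] at h1
    exact right_eq_mul.mp h1
  let toChar : (χ : B.A → ℂˣ) → (∀ x y, χ (x + y) = χ x * χ y) → AddChar B.A ℂ := fun χ hχ =>
    { toFun := fun x => χ x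
      map_zero_eq_one' := by
        have := hχ 0 0
        rw [add_zero] at this
        rw [left_eq_mul.mp this, Units.val_one]
      map_add_eq_mul' := fun x y => by rw [hχ, Units.val_mul] }
  have hbij : Function.Bijective fun a => toChar (B.Ω.b a) (hb a) :=
    (Fintype.bijective_iff_injective_and_card _).mpr
      ⟨fun a a' h => hinj a a' fun x => Units.ext (DFunLike.congr_fun h x),
        AddChar.card_eq.symm⟩
  obtain ⟨a, ha⟩ := hbij.surjective (toChar χ hχ)
  have ha' : ∀ x, B.Ω.b a x = χ x := fun x => Units.ext (DFunLike.congr_fun ha x)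
  exact ⟨a, ha', fun a' h' => hinj _ _ fun x => (h' x).trans (ha' x).symm⟩

end SpinDatum

namespace BrAut

open Functor.LaxMonoidal GrVec

variable {B : SpinDatum} (S T : BrAut B)

/-- The tensor automorphism of `S` given by the character `b(a, -)` of `A`. -/
def xi (a : B.A) : S ⟶ S :=
  ({ iso := NatIso.ofComponents (fun X =>
        { hom := B.Xi a (S.F.obj X)
          inv := B.Xi (-a) (S.F.obj X)
          hom_inv_id := by rw [B.Xi_comp, add_neg_cancel, B.Xi_zero]
          inv_hom_id := by rw [B.Xi_comp, neg_add_cancel, B.Xi_zero] })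
        fun f => (B.Xi_natural a _).symm
     isMonoidal :=
      { unit := by
          change ε S.F ≫ B.Xi a (S.F.obj (𝟙_ B.Cat)) = ε S.F
          rw [← B.Xi_natural, B.Xi_unit, Category.id_comp]
        tensor := fun X Y => by
          change μ S.F X Y ≫ B.Xi a (S.F.obj (X ⊗ Y)) =
            (B.Xi a (S.F.obj X) ⊗ₘ B.Xi a (S.F.obj Y)) ≫ μ S.F X Y
          rw [← B.Xi_natural, B.Xi_tensor] } } : Hom S S)

theorem xi_app (a : B.A) (X : B.Cat) : (S.xi a).iso.hom.app X = B.Xi a (S.F.obj X) := rfl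

theorem xi_zero : S.xi 0 = 𝟙 S := hom_ext fun _ => B.Xi_zero _

theorem xi_comp_xi (a a' : B.A) : S.xi a ≫ S.xi a' = S.xi (a + a') :=
  hom_ext fun _ => B.Xi_comp _ _ _

variable {S T} in
theorem xi_naturality (a : B.A) (η : S ⟶ T) : S.xi a ≫ η = η ≫ T.xi a :=
  hom_ext fun X => B.Xi_natural a (η.iso.hom.app X)

theorem xi_whiskerRight (a : B.A) : S.xi a ▷ T = (S ⊗ T).xi a := hom_ext fun X => by
  change B.Xi a (S.F.obj (T.F.obj X)) ≫ S.F.map (𝟙 (T.F.obj X)) = B.Xi a (S.F.obj (T.F.obj X))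
  rw [CategoryTheory.Functor.map_id, Category.comp_id]

/-- Since `S` preserves the double braiding, it maps `Ξ(a)` to `Ξ(S(a))`. -/
theorem map_Xi (a : B.A) (X : B.Cat) : S.F.map (B.Xi a X) = B.Xi (S.perm a) (S.F.obj X) :=
  GrVec.hom_ext (S.frame_ext fun x v hv => by
    rw [frame_natural, B.Xi_apply a hv, map_smul, B.Xi_apply _ (S.frame_homog hv), b_perm])

theorem whiskerLeft_xi (a : B.A) : S ◁ T.xi a = (S ⊗ T).xi (S.perm a) := hom_ext fun X => by
  change 𝟙 (S.F.obj (T.F.obj X)) ≫ S.F.map (B.Xi a (T.F.obj X)) =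
    B.Xi (S.perm a) (S.F.obj (T.F.obj X))
  rw [map_Xi, Category.id_comp]

variable {S T}

theorem coeff_comp_xi (η : S ⟶ T) (a x : B.A) :
    coeff (η ≫ T.xi a) x = B.Ω.b a (T.perm x) * coeff η x := by
  refine coeff_eq _ _ ?_
  rw [comp_app, comp_lin, LinearMap.comp_apply, app_frame η (line_homog x 1), map_smul, xi_app,
    B.Xi_apply a (T.frame_homog (line_homog x 1)), smul_smul, Units.val_mul, mul_comm]

/-- The tensor isomorphisms between two autoequivalences form a torsor over `A`. -/
theorem existsUnique_comp_xi (η θ : S ⟶ T) : ∃! a, θ = η ≫ T.xi a := by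
  have key : ∀ a, θ = η ≫ T.xi a ↔
      ∀ x, B.Ω.b a x = coeff θ (T.perm.symm x) / coeff η (T.perm.symm x) := fun a => by
    constructor
    · rintro rfl x
      rw [coeff_comp_xi, AddEquiv.apply_symm_apply, mul_div_cancel_right]
    · intro h
      refine hom_ext_coeff fun x => ?_
      rw [coeff_comp_xi, h, AddEquiv.symm_apply_apply, div_mul_cancel]
  simp only [key]
  refine B.existsUnique_b_eq _ fun x y => ?_
  have h1 := coeff_mul η (T.perm.symm x) (T.perm.symm y)
  have h2 := coeff_mul θ (T.perm.symm x) (T.perm.symm y)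
  rw [map_add, div_mul_div_comm, div_eq_div_iff_mul_eq_mul]
  refine mul_right_cancel (b := S.cochain (T.perm.symm x) (T.perm.symm y) *
    T.cochain (T.perm.symm x) (T.perm.symm y)) ?_
  set x' := T.perm.symm x
  set y' := T.perm.symm y
  calc _ = (coeff θ (x' + y') * S.cochain x' y') *
        (T.cochain x' y' * (coeff η x' * coeff η y')) := by ac_rfl
    _ = _ := by rw [h2, ← h1]; ac_rfl

end BrAut

/-! ### Classification of autoequivalences by their action on `A` -/

namespace GrVec

variable {A : Type} [AddCommGroup A] {Ω : AbelianCocycle A} [Fintype A]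

/-- The diagonal automorphism with invertible entries `s`. -/
def diagIso (s : A → ℂˣ) (X : GrVec Ω) : X ≅ X where
  hom := diag (fun a => (s a : ℂ)) X
  inv := diag (fun a => ((s a)⁻¹ : ℂˣ)) X
  hom_inv_id := by rw [diag_comp]; simp [diag_one]
  inv_hom_id := by rw [diag_comp]; simp [diag_one]

end GrVec

namespace BrAut

open Functor.LaxMonoidal GrVec

variable {B : SpinDatum} {S T : BrAut B}

theorem proj_frame {X : B.Cat} (a : B.A) (v : X.carrier) :
    (S.F.obj X).proj (S.perm a) (S.frame X v) = S.frame X (X.proj a v) := by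
  classical
  refine X.homog_induction (P := fun v => (S.F.obj X).proj (S.perm a) (S.frame X v) =
    S.frame X (X.proj a v)) (by simp) (fun v w h h' => by simp only [map_add, h, h'])
    (fun b v hv => ?_) v
  rw [hv.proj_eq, (S.frame_homog hv).proj_eq]
  simp only [EmbeddingLike.apply_eq_iff_eq]
  split_ifs <;> simp

theorem homog_frame_symm {X : B.Cat} {a : B.A} {w : (S.F.obj X).carrier}
    (hw : (S.F.obj X).Homog a w) : X.Homog (S.perm.symm a) ((S.frame X).symm w) := by
  refine (S.frame X).injective ?_
  rw [← proj_frame, AddEquiv.apply_symm_apply, LinearEquiv.apply_symm_apply]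
  exact hw

/-- The isomorphism `S(X) ≅ T(X)` which multiplies frame vectors of degree `a` by `h a`. -/
def isoOfCoeff (hp : ∀ a, S.perm a = T.perm a) (h : B.A → ℂˣ) (X : B.Cat) :
    S.F.obj X ≅ T.F.obj X :=
  isoOfEquiv ((S.frame X).symm ≪≫ₗ equivOfIso (diagIso h X) ≪≫ₗ T.frame X) fun a w hw => by
    have := T.frame_homog ((homog_frame_symm hw).map (diagIso h X).hom)
    rwa [← hp, AddEquiv.apply_symm_apply] at this

/-- If `S` and `T` induce the same automorphism of `A`, the quotient of their cochains is a
2-cocycle by compatibility with `ω` and symmetric by compatibility with `c`; hence it is a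
coboundary. -/
theorem exists_coeff_of_perm_eq (hp : ∀ a, S.perm a = T.perm a) : ∃ h : B.A → ℂˣ,
    ∀ a b, h (a + b) * S.cochain a b = T.cochain a b * (h a * h b) := by
  obtain ⟨h, hh⟩ := exists_coboundary_of_symmetric
    (fun a b => Additive.ofMul (T.cochain a b / S.cochain a b))
    (fun a b => congrArg Additive.ofMul (by
      have h1 := S.cochain_braid a b
      have h2 := T.cochain_braid a b
      rw [hp, hp] at h1
      rw [div_eq_div_iff_mul_eq_mul]
      refine mul_right_cancel (b := B.Ω.c a b * B.Ω.c (T.perm a) (T.perm b)) ?_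
      calc _ = (T.cochain a b * B.Ω.c a b) *
            (B.Ω.c (T.perm a) (T.perm b) * S.cochain b a) := by ac_rfl
        _ = _ := by rw [h2, ← h1]; ac_rfl))
    (fun a b d => congrArg Additive.ofMul (show T.cochain a b / S.cochain a b *
        (T.cochain (a + b) d / S.cochain (a + b) d) = T.cochain b d / S.cochain b d *
        (T.cochain a (b + d) / S.cochain a (b + d)) by
      have h1 := S.cochain_assoc a b d
      have h2 := T.cochain_assoc a b d
      rw [hp, hp, hp] at h1
      rw [div_mul_div_comm, div_mul_div_comm, div_eq_div_iff_mul_eq_mul]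
      refine mul_right_cancel (b := (B.Ω.ω a b d)⁻¹ *
        (B.Ω.ω (T.perm a) (T.perm b) (T.perm d))⁻¹) ?_
      calc _ = (T.cochain a b * T.cochain (a + b) d * (B.Ω.ω a b d)⁻¹) *
            ((B.Ω.ω (T.perm a) (T.perm b) (T.perm d))⁻¹ * S.cochain b d *
              S.cochain a (b + d)) := by ac_rfl
        _ = _ := by rw [h2, ← h1]; ac_rfl))
  refine ⟨fun a => (h a).toMul, fun a b => ?_⟩
  have h1 : (h (a + b)).toMul = T.cochain a b / S.cochain a b * ((h a).toMul * (h b).toMul) :=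
    congrArg Additive.toMul (hh a b)
  dsimp only
  rw [h1, mul_right_comm, div_mul_cancel]

theorem isoOfCoeff_frame (hp : ∀ a, S.perm a = T.perm a) (h : B.A → ℂˣ) {X : B.Cat} {a : B.A}
    {v : X.carrier} (hv : X.Homog a v) :
    (isoOfCoeff hp h X).hom.lin (S.frame X v) = (h a : ℂ) • T.frame X v := by
  change T.frame X ((diag _ X).lin ((S.frame X).symm (S.frame X v))) = _
  rw [LinearEquiv.symm_apply_apply, diag_apply _ hv, map_smul]

theorem tensor_frame_ext {X Y : B.Cat} {M : Type} [AddCommGroup M] [Module ℂ M]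
    {f g : (S.F.obj X).carrier ⊗[ℂ] (S.F.obj Y).carrier →ₗ[ℂ] M}
    (h : ∀ a b v w, X.Homog a v → Y.Homog b w →
      f (S.frame X v ⊗ₜ S.frame Y w) = g (S.frame X v ⊗ₜ S.frame Y w)) : f = g :=
  TensorProduct.ext (S.frame_ext fun a v hv => S.frame_ext fun b w hw => h a b v w hv hw)

/-- Autoequivalences which induce the same automorphism of `A` are isomorphic. -/
theorem nonempty_hom_of_perm_eq (hp : ∀ a, S.perm a = T.perm a) : Nonempty (S ⟶ T) := by
  obtain ⟨h, hh⟩ := exists_coeff_of_perm_eq hp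
  refine ⟨({ iso := NatIso.ofComponents (isoOfCoeff hp h) fun {X Y} f => ?_
             isMonoidal := { unit := ?_, tensor := fun X Y => ?_ } } : BrAut.Hom S T)⟩
  · refine GrVec.hom_ext (S.frame_ext fun a v hv => ?_)
    rw [comp_lin, comp_lin, LinearMap.comp_apply, LinearMap.comp_apply, frame_natural,
      isoOfCoeff_frame hp h hv, isoOfCoeff_frame hp h (hv.map f), map_smul, frame_natural]
  · refine GrVec.hom_ext (LinearMap.ext_ring ?_)
    change (isoOfCoeff hp h (B.simpleObj 0)).hom.lin ((ε S.F).lin (1 : ℂ)) = (ε T.F).lin (1 : ℂ)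
    rw [unit_apply, unit_apply, map_smul, isoOfCoeff_frame hp h (line_homog 0 1), smul_smul]
    congr 1
    have h1 := congrArg Units.val (hh 0 0)
    rw [add_zero] at h1
    have h2 := S.unitScalar_mul_cochain 0
    have h3 := T.unitScalar_mul_cochain 0
    push_cast at h1
    refine mul_right_cancel₀ (S.cochain 0 0).ne_zero (mul_right_cancel₀ (h 0).ne_zero ?_)
    linear_combination (h 0 : ℂ) ^ 2 * h2 - T.unitScalar * h1 - (h 0 : ℂ) ^ 2 * h3
  · refine GrVec.hom_ext (tensor_frame_ext fun a b v w hv hw => ?_)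
    change (isoOfCoeff hp h (tensor X Y)).hom.lin (S.muLin X Y (S.frame X v ⊗ₜ S.frame Y w)) =
      T.muLin X Y ((isoOfCoeff hp h X).hom.lin (S.frame X v) ⊗ₜ
        (isoOfCoeff hp h Y).hom.lin (S.frame Y w))
    rw [S.muLin_frame hv hw, map_smul, isoOfCoeff_frame hp h (hv.tmul hw),
      isoOfCoeff_frame hp h hv, isoOfCoeff_frame hp h hw, ← TensorProduct.smul_tmul',
      TensorProduct.tmul_smul, map_smul, map_smul, T.muLin_frame hv hw, smul_smul, smul_smul,
      smul_smul]
    congr 1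
    have h1 := congrArg Units.val (hh a b)
    push_cast at h1
    linear_combination h1

end BrAut

/-! ### The action of `A` on tensor isomorphisms -/

namespace BrAut

open Functor.LaxMonoidal

variable {B : SpinDatum} {S S' T T' U : BrAut B}

/-- The group `A` acts on tensor isomorphisms `S ⟶ T` by composition with `Ξ(a)`. -/
instance : AddAction B.A (S ⟶ T) where
  vadd a η := η ≫ T.xi a
  zero_vadd η := (congrArg (η ≫ ·) T.xi_zero).trans (Category.comp_id η)
  add_vadd a b η := by
    change η ≫ T.xi (a + b) = (η ≫ T.xi b) ≫ T.xi a
    rw [Category.assoc, xi_comp_xi, add_comm]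

theorem vadd_def (a : B.A) (η : S ⟶ T) : a +ᵥ η = η ≫ T.xi a := rfl

@[simp] theorem comp_vadd (a : B.A) (η : S ⟶ T) (θ : T ⟶ U) : η ≫ (a +ᵥ θ) = a +ᵥ (η ≫ θ) :=
  (Category.assoc _ _ _).symm

@[simp] theorem vadd_comp (a : B.A) (η : S ⟶ T) (θ : T ⟶ U) : (a +ᵥ η) ≫ θ = a +ᵥ (η ≫ θ) := by
  rw [vadd_def, vadd_def, Category.assoc, Category.assoc, xi_naturality]

@[simp] theorem vadd_whiskerRight (a : B.A) (η : S ⟶ T) (U : BrAut B) :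
    (a +ᵥ η) ▷ U = a +ᵥ (η ▷ U) := by
  rw [vadd_def, vadd_def, comp_whiskerRight, xi_whiskerRight]

@[simp] theorem whiskerLeft_vadd (a : B.A) (η : S ⟶ T) (U : BrAut B) :
    U ◁ (a +ᵥ η) = U.perm a +ᵥ (U ◁ η) := by
  rw [vadd_def, vadd_def, MonoidalCategory.whiskerLeft_comp, whiskerLeft_xi]

theorem perm_eq_of_hom (η : S ⟶ T) (a : B.A) : S.perm a = T.perm a := perm_eq_of_iso (toIso η) a

@[simp] theorem vadd_tensorHom_vadd (a b : B.A) (η : S ⟶ T) (θ : S' ⟶ T') :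
    (a +ᵥ η) ⊗ₘ (b +ᵥ θ) = (a + S.perm b) +ᵥ (η ⊗ₘ θ) := by
  rw [MonoidalCategory.tensorHom_def, MonoidalCategory.tensorHom_def, vadd_whiskerRight,
    whiskerLeft_vadd, vadd_comp, comp_vadd, vadd_vadd, perm_eq_of_hom η]

theorem existsUnique_vadd (η θ : S ⟶ T) : ∃! a : B.A, θ = a +ᵥ η := existsUnique_comp_xi η θ

theorem vadd_injective {a a' : B.A} (η : S ⟶ T) (h : a +ᵥ η = a' +ᵥ η) : a = a' :=
  (existsUnique_vadd η (a +ᵥ η)).unique rfl h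

end BrAut

/-! ### Twisting liftings by 2-cocycles -/

namespace Lifting

open Functor.LaxMonoidal BrAut

variable {B : SpinDatum} {G : Type} [Group G] {ρ : G →* AutGroup B} (L L' L'' : Lifting ρ)

theorem perm_aut (g : G) (a : B.A) : (L.aut g).perm a = permRep B (ρ g) a := by
  rw [← permRep_toSkeleton]
  exact congrArg (fun x => permRep B x a) (L.lifts g)

/-- The isomorphism `((gh)k)_* → (g(hk))_*`. -/
def assocMap (g h k : G) : L.aut (g * h * k) ⟶ L.aut (g * (h * k)) :=
  L.toFunctor.map (α_ (⟨g⟩ : Discrete G) ⟨h⟩ ⟨k⟩).hom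

theorem mul_mul (g h k : G) :
    L.mul g h ▷ L.aut k ≫ L.mul (g * h) k ≫ L.assocMap g h k =
      (α_ _ _ _).hom ≫ L.aut g ◁ L.mul h k ≫ L.mul g (h * k) :=
  associativity L.toFunctor ⟨g⟩ ⟨h⟩ ⟨k⟩

/-- The unit isomorphism `id → 1_*`. -/
def unit : 𝟙_ (BrAut B) ⟶ L.aut 1 := ε L.toFunctor

/-- The isomorphism `(1g)_* → g_*`. -/
def leftMap (g : G) : L.aut (1 * g) ⟶ L.aut g := L.toFunctor.map (λ_ (⟨g⟩ : Discrete G)).hom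

theorem unit_mul (g : G) :
    (λ_ (L.aut g)).hom = L.unit ▷ L.aut g ≫ L.mul 1 g ≫ L.leftMap g :=
  left_unitality L.toFunctor ⟨g⟩

/-- The isomorphism `(g1)_* → g_*`. -/
def rightMap (g : G) : L.aut (g * 1) ⟶ L.aut g := L.toFunctor.map (ρ_ (⟨g⟩ : Discrete G)).hom

theorem mul_unit (g : G) :
    (ρ_ (L.aut g)).hom = L.aut g ◁ L.unit ≫ L.mul g 1 ≫ L.rightMap g :=
  right_unitality L.toFunctor ⟨g⟩

variable {L L'} in
theorem family_naturality (η : ∀ g, L.aut g ⟶ L'.aut g) {X Y : Discrete G} (f : X ⟶ Y) :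
    L.toFunctor.map f ≫ η Y.as = η X.as ≫ L'.toFunctor.map f := by
  obtain ⟨x⟩ := X
  obtain ⟨y⟩ := Y
  obtain rfl : x = y := Discrete.eq_of_hom f
  obtain rfl : f = 𝟙 _ := Subsingleton.elim _ _
  rw [CategoryTheory.Functor.map_id, CategoryTheory.Functor.map_id]
  exact (Category.id_comp _).trans (Category.comp_id _).symm

variable {L L' L''} in
theorem isTwist_iff {z : G × G → B.A} : IsTwist z L L' ↔ ∃ η : ∀ g, L.aut g ⟶ L'.aut g,
    ∀ g h, z (g, h) +ᵥ (L.mul g h ≫ η (g * h)) = (η g ⊗ₘ η h) ≫ L'.mul g h := by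
  refine exists_congr fun η => forall₂_congr fun g h => ?_
  rw [← vadd_comp]
  exact ⟨fun H => BrAut.hom_ext H, fun H X => congrArg (fun θ => (BrAut.Hom.iso θ).hom.app X) H⟩

/-- The cocycle condition for cochains on `G` with values in `A`. -/
theorem mem_cocycles₂_iff (z : G × G → B.A) : z ∈ groupCohomology.cocycles₂ (moduleA ρ) ↔
    ∀ g h k, z (g * h, k) + z (g, h) = permRep B (ρ g) (z (h, k)) + z (g, h * k) :=
  groupCohomology.mem_cocycles₂_iff (A := moduleA ρ) z

variable {z z' : G × G → B.A}

/-- The twist of `L` by the 2-cocycle `z`: the isomorphisms `g_* ∘ h_* → (gh)_*` are multiplied by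
`Ξ(z(g, h))`, and the unit isomorphism is corrected by `Ξ(-z(1, 1))` accordingly. -/
def twist (hz : z ∈ groupCohomology.cocycles₂ (moduleA ρ)) : Lifting ρ where
  toFunctor := L.toFunctor
  lifts := L.lifts
  monoidal := Functor.CoreMonoidal.toMonoidal
    { εIso := toIso ((-z (1, 1)) +ᵥ L.unit)
      μIso := fun X Y => toIso (z (X.as, Y.as) +ᵥ L.mul X.as Y.as)
      μIso_hom_natural_left := fun {X Y} f Z => by
        obtain ⟨x⟩ := X
        obtain ⟨y⟩ := Y
        obtain rfl : x = y := Discrete.eq_of_hom f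
        change _ ≫ (z (x, Z.as) +ᵥ L.mul x Z.as) = (z (x, Z.as) +ᵥ L.mul x Z.as) ≫ _
        exact (comp_vadd _ (L.toFunctor.map f ▷ L.toFunctor.obj Z) (L.mul x Z.as)).trans
          ((congrArg (z (x, Z.as) +ᵥ ·) (μ_natural_left L.toFunctor f Z)).trans
            (vadd_comp _ (L.mul x Z.as) _).symm)
      μIso_hom_natural_right := fun {X Y} Z f => by
        obtain ⟨x⟩ := X
        obtain ⟨y⟩ := Y
        obtain rfl : x = y := Discrete.eq_of_hom f
        change _ ≫ (z (Z.as, x) +ᵥ L.mul Z.as x) = (z (Z.as, x) +ᵥ L.mul Z.as x) ≫ _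
        exact (comp_vadd _ (L.toFunctor.obj Z ◁ L.toFunctor.map f) (L.mul Z.as x)).trans
          ((congrArg (z (Z.as, x) +ᵥ ·) (μ_natural_right L.toFunctor Z f)).trans
            (vadd_comp _ (L.mul Z.as x) _).symm)
      associativity := fun X Y Z => by
        change (z (X.as, Y.as) +ᵥ L.mul X.as Y.as) ▷ L.aut Z.as ≫
          (z (X.as * Y.as, Z.as) +ᵥ L.mul (X.as * Y.as) Z.as) ≫ L.assocMap X.as Y.as Z.as =
          (α_ _ _ _).hom ≫ L.aut X.as ◁ (z (Y.as, Z.as) +ᵥ L.mul Y.as Z.as) ≫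
            (z (X.as, Y.as * Z.as) +ᵥ L.mul X.as (Y.as * Z.as))
        simp only [vadd_whiskerRight, whiskerLeft_vadd, vadd_comp, comp_vadd, vadd_vadd, mul_mul,
          perm_aut]
        rw [(mem_cocycles₂_iff z).mp hz, add_comm]
      left_unitality := fun X => by
        change _ = ((-z (1, 1)) +ᵥ L.unit) ▷ L.aut X.as ≫ (z (1, X.as) +ᵥ L.mul 1 X.as) ≫
          L.leftMap X.as
        simp only [vadd_whiskerRight, vadd_comp, comp_vadd, vadd_vadd]
        have h := (mem_cocycles₂_iff z).mp hz 1 1 X.as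
        rw [map_one, map_one, one_mul, one_mul, Module.End.one_apply, add_right_inj] at h
        rw [h, add_neg_cancel, zero_vadd]
        exact L.unit_mul X.as
      right_unitality := fun X => by
        change _ = L.aut X.as ◁ ((-z (1, 1)) +ᵥ L.unit) ≫ (z (X.as, 1) +ᵥ L.mul X.as 1) ≫
          L.rightMap X.as
        simp only [whiskerLeft_vadd, vadd_comp, comp_vadd, vadd_vadd]
        have h := (mem_cocycles₂_iff z).mp hz X.as 1 1
        rw [mul_one, mul_one, add_left_inj] at h
        rw [h, perm_aut, map_neg, add_neg_cancel, zero_vadd]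
        exact L.mul_unit X.as }

theorem isTwist_twist (hz : z ∈ groupCohomology.cocycles₂ (moduleA ρ)) :
    IsTwist z L (L.twist hz) :=
  isTwist_iff.mpr ⟨fun g => 𝟙 (L.aut g), fun g h => by
    have h1 : (L.twist hz).mul g h = z (g, h) +ᵥ L.mul g h := rfl
    rw [h1]
    refine (congrArg (z (g, h) +ᵥ ·) (Category.comp_id (L.mul g h))).trans ?_
    refine (Category.id_comp _).symm.trans (congrArg (· ≫ (z (g, h) +ᵥ L.mul g h)) ?_)
    exact (id_tensorHom_id (L.aut g) (L.aut h)).symm⟩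

variable {L L' L''}

theorem IsTwist.trans (H : IsTwist z L L') (H' : IsTwist z' L' L'') :
    IsTwist (z + z') L L'' := by
  obtain ⟨η, hη⟩ := isTwist_iff.mp H
  obtain ⟨θ, hθ⟩ := isTwist_iff.mp H'
  refine isTwist_iff.mpr ⟨fun g => η g ≫ θ g, fun g h => ?_⟩
  rw [← tensorHom_comp_tensorHom, Category.assoc, ← hθ, comp_vadd, ← reassoc_of% hη g h,
    vadd_comp, vadd_vadd, Category.assoc, Pi.add_apply, add_comm]

/-- Changing `η g` by `Ξ(y(g))` changes the twisting cochain by the coboundary of `y`. -/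
theorem twist_change (η : ∀ g, L.aut g ⟶ L'.aut g) (y : G → B.A)
    (hη : ∀ g h, z (g, h) +ᵥ (L.mul g h ≫ η (g * h)) = (η g ⊗ₘ η h) ≫ L'.mul g h) :
    (∀ g h, z' (g, h) +ᵥ (L.mul g h ≫ (y (g * h) +ᵥ η (g * h))) =
      ((y g +ᵥ η g) ⊗ₘ (y h +ᵥ η h)) ≫ L'.mul g h) ↔
    ∀ g h, permRep B (ρ g) (y h) - y (g * h) + y g = z' (g, h) - z (g, h) := by
  refine forall₂_congr fun g h => ?_
  rw [comp_vadd, vadd_vadd, vadd_tensorHom_vadd, vadd_comp, ← hη, vadd_vadd, perm_aut]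
  constructor
  · intro H
    have := vadd_injective _ H
    rw [eq_sub_of_add_eq this]
    abel
  · intro H
    rw [eq_add_of_sub_eq H.symm]
    congr 1
    abel

theorem H2π_eq_iff (z z' : groupCohomology.cocycles₂ (moduleA ρ)) :
    groupCohomology.H2π (moduleA ρ) z' = groupCohomology.H2π (moduleA ρ) z ↔
      ∃ y : G → B.A, ∀ g h, permRep B (ρ g) (y h) - y (g * h) + y g = z' (g, h) - z (g, h) := by
  rw [groupCohomology.H2π_eq_iff]
  exact exists_congr fun y => ⟨fun H g h => congrFun H (g, h), fun H => funext fun p => H p.1 p.2⟩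

theorem IsTwist.of_H2π_eq {z z' : groupCohomology.cocycles₂ (moduleA ρ)}
    (hz : groupCohomology.H2π (moduleA ρ) z' = groupCohomology.H2π (moduleA ρ) z)
    (H : IsTwist z L L') : IsTwist z' L L' := by
  obtain ⟨η, hη⟩ := isTwist_iff.mp H
  obtain ⟨y, hy⟩ := (H2π_eq_iff z z').mp hz
  exact isTwist_iff.mpr ⟨fun g => y g +ᵥ η g, (twist_change η y hη).mpr hy⟩

theorem IsTwist.H2π_eq {z z' : groupCohomology.cocycles₂ (moduleA ρ)} (H : IsTwist z L L')
    (H' : IsTwist z' L L') :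
    groupCohomology.H2π (moduleA ρ) z' = groupCohomology.H2π (moduleA ρ) z := by
  obtain ⟨η, hη⟩ := isTwist_iff.mp H
  obtain ⟨θ, hθ⟩ := isTwist_iff.mp H'
  choose y hy _ using fun g => existsUnique_vadd (η g) (θ g)
  simp only [hy] at hθ
  exact (H2π_eq_iff z z').mpr ⟨y, (twist_change η y hη).mp hθ⟩

variable (L L') in
/-- Two actions which realize the same `ρ` differ by a 2-cocycle. -/
theorem exists_isTwist : ∃ z : groupCohomology.cocycles₂ (moduleA ρ), IsTwist z L L' := by
  have hne : ∀ g, Nonempty (L.aut g ⟶ L'.aut g) := fun g =>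
    nonempty_hom_of_perm_eq fun a => by rw [perm_aut, perm_aut]
  let η : ∀ g, L.aut g ⟶ L'.aut g := fun g => (hne g).some
  choose z hz _ using fun g h => existsUnique_vadd (L.mul g h ≫ η (g * h))
    ((η g ⊗ₘ η h) ≫ L'.mul g h)
  refine ⟨⟨fun p => z p.1 p.2, (mem_cocycles₂_iff _).mpr fun g h k => ?_⟩,
    isTwist_iff.mpr ⟨η, fun g h => (hz g h).symm⟩⟩
  -- Both sides of the associativity of `L'`, transported along `η`, are multiples of the
  -- same morphism for `L`.
  have hη : L.assocMap g h k ≫ η (g * (h * k)) = η (g * h * k) ≫ L'.assocMap g h k :=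
    family_naturality η _
  have h1 : ((η g ⊗ₘ η h) ⊗ₘ η k) ≫ L'.mul g h ▷ L'.aut k ≫ L'.mul (g * h) k ≫
      L'.assocMap g h k = (z g h + z (g * h) k) +ᵥ (L.mul g h ▷ L.aut k ≫ L.mul (g * h) k ≫
        L.assocMap g h k ≫ η (g * (h * k))) := by
    have e1 : ((η g ⊗ₘ η h) ⊗ₘ η k) ≫ L'.mul g h ▷ L'.aut k =
        z g h +ᵥ (L.mul g h ▷ L.aut k ≫ (η (g * h) ⊗ₘ η k)) := by
      rw [← tensorHom_id, tensorHom_comp_tensorHom, hz, Category.comp_id,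
        MonoidalCategory.tensorHom_def, vadd_whiskerRight, comp_whiskerRight, vadd_comp,
        Category.assoc, ← MonoidalCategory.tensorHom_def]
    rw [reassoc_of% e1, vadd_comp, Category.assoc, reassoc_of% hz (g * h) k, vadd_comp,
      comp_vadd, vadd_vadd, Category.assoc, hη]
  have h2 : ((η g ⊗ₘ η h) ⊗ₘ η k) ≫ (α_ _ _ _).hom ≫ L'.aut g ◁ L'.mul h k ≫
      L'.mul g (h * k) = (permRep B (ρ g) (z h k) + z g (h * k)) +ᵥ ((α_ _ _ _).hom ≫
        L.aut g ◁ L.mul h k ≫ L.mul g (h * k) ≫ η (g * (h * k))) := by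
    have e1 : (η g ⊗ₘ (η h ⊗ₘ η k)) ≫ L'.aut g ◁ L'.mul h k =
        permRep B (ρ g) (z h k) +ᵥ (L.aut g ◁ L.mul h k ≫ (η g ⊗ₘ η (h * k))) := by
      rw [← id_tensorHom, tensorHom_comp_tensorHom, hz, Category.comp_id,
        MonoidalCategory.tensorHom_def', whiskerLeft_vadd, MonoidalCategory.whiskerLeft_comp,
        vadd_comp, Category.assoc, ← MonoidalCategory.tensorHom_def', perm_aut]
    rw [associator_naturality_assoc, reassoc_of% e1, vadd_comp, comp_vadd, Category.assoc, hz,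
      comp_vadd, comp_vadd, vadd_vadd]
  rw [L'.mul_mul, h2] at h1
  have h3 := L.mul_mul g h k
  have h4 : L.mul g h ▷ L.aut k ≫ L.mul (g * h) k ≫ L.assocMap g h k ≫ η (g * (h * k)) =
    (α_ _ _ _).hom ≫ L.aut g ◁ L.mul h k ≫ L.mul g (h * k) ≫ η (g * (h * k)) := by
    rw [reassoc_of% h3]
  rw [h4] at h1
  exact (add_comm _ _).trans (vadd_injective _ h1).symm

/-- A family of tensor isomorphisms compatible with the isomorphisms `g_* ∘ h_* → (gh)_*` is
automatically compatible with the unit isomorphisms. -/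
theorem unit_comp_of_mul_comp (η : ∀ g, L.aut g ⟶ L'.aut g)
    (hη : ∀ g h, L.mul g h ≫ η (g * h) = (η g ⊗ₘ η h) ≫ L'.mul g h) : L.unit ≫ η 1 = L'.unit := by
  obtain ⟨a, ha, -⟩ := existsUnique_vadd (L.unit ≫ η 1) L'.unit
  have h1 : L.leftMap 1 ≫ η 1 = η (1 * 1) ≫ L'.leftMap 1 := family_naturality η _
  have h2 : 𝟙_ (BrAut B) ◁ η 1 ≫ (λ_ (L'.aut 1)).hom = (λ_ (L.aut 1)).hom ≫ η 1 :=
    leftUnitor_naturality (η 1)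
  rw [L.unit_mul, L'.unit_mul, ha, Category.assoc, Category.assoc, h1, reassoc_of% hη 1 1,
    vadd_whiskerRight, vadd_comp, comp_vadd, comp_whiskerRight, Category.assoc] at h2
  have h3 : 𝟙_ (BrAut B) ◁ η 1 ≫ L.unit ▷ L'.aut 1 ≫ η 1 ▷ L'.aut 1 =
      L.unit ▷ L.aut 1 ≫ (η 1 ⊗ₘ η 1) := by
    rw [whisker_exchange_assoc, MonoidalCategory.tensorHom_def']
  rw [reassoc_of% h3] at h2
  have h4 := vadd_injective _ (h2.trans (zero_vadd _ _).symm)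
  rw [ha, h4, zero_vadd]

theorem isTwist_zero_iff : IsTwist 0 L L' ↔ Equivalent L L' := by
  rw [isTwist_iff]
  simp only [Pi.zero_apply, zero_vadd]
  constructor
  · rintro ⟨η, hη⟩
    exact ⟨Discrete.natIso fun X => toIso (η X.as),
      { unit := unit_comp_of_mul_comp η hη
        tensor := fun X Y => hη X.as Y.as }⟩
  · rintro ⟨τ, hτ⟩
    exact ⟨fun g => τ.hom.app ⟨g⟩, fun g h => hτ.tensor _ _⟩

end Lifting

/-! ### Restriction to the subcategory generated by the fermion -/

namespace SpinDatum

open GrVec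

variable (B : SpinDatum)

theorem neg_one_pow_val_add (s t : ZMod 2) :
    (-1 : ℂ) ^ (s + t).val = (-1) ^ s.val * (-1) ^ t.val := by
  rw [ZMod.val_add, ← neg_one_pow_eq_pow_mod_two, pow_add]

theorem sign_comp (s t : ZMod 2) (X : B.Cat) : B.sign s X ≫ B.sign t X = B.sign (s + t) X := by
  refine (diag_comp _ _ X).trans (congrArg (fun s => diag s X) (funext fun x => ?_))
  split_ifs
  · rw [neg_one_pow_val_add]
  · rw [one_mul]

theorem sign_zero (X : B.Cat) : B.sign 0 X = 𝟙 X := by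
  refine (congrArg (fun s => diag s X) (funext fun x => ?_)).trans (diag_one X)
  simp

theorem b_fermion (a : B.A) : (B.Ω.b a B.f : ℂ) = (-1) ^ (B.restr a).val := by
  rcases zmod_two (B.restr a) with h | h
  · rw [h, (B.restr_eq_zero_iff a).mp h]
    simp
  · have h' : B.Ω.b a B.f ≠ 1 := fun hb => by
      rw [(B.restr_eq_zero_iff a).mpr hb] at h
      exact absurd h (by decide)
    rw [h, (B.b_f a).resolve_left h', ZMod.val_one]
    simp

theorem eq_zero_of_fermionProp {B : SpinDatum} {X : B.Cat} (hX : B.fermionProp X) {a : B.A}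
    {v : X.carrier} (hv : X.Homog a v) (h0 : a ≠ 0) (hf : a ≠ B.f) : v = 0 := by
  rw [← show X.proj a v = v from hv, hX a h0 hf]
  rfl

/-- On `⟨f⟩` the character `b(a, -)` is the sign character given by `r(a)`. -/
theorem Xi_eq_sign (a : B.A) {X : B.Cat} (hX : B.fermionProp X) :
    B.Xi a X = B.sign (B.restr a) X := by
  refine GrVec.hom_ext (ext₁ fun x v hv => ?_)
  refine (B.Xi_apply a hv).trans (Eq.symm ((diag_apply _ hv).trans ?_))
  by_cases hf : x = B.f
  · rw [if_pos hf, hf, b_fermion]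
  · rw [if_neg hf]
    by_cases h0 : x = 0
    · rw [h0, B.Ω.b_comm, B.Ω.b_zero, Units.val_one]
    · rw [eq_zero_of_fermionProp hX hv h0 hf, smul_zero, smul_zero]

/-- The fermion as an object of `⟨f⟩`. -/
def fermionObj : B.fermionProp.FullSubcategory := ⟨B.simpleObj B.f, fun _ _ ha => if_neg ha⟩

theorem sign_fermionObj (s : ZMod 2) (z : ℂ) :
    (B.sign s (B.simpleObj B.f)).lin z = ((-1) ^ s.val : ℂ) * z := by
  refine (diag_apply _ (line_homog B.f z)).trans ?_
  rw [if_pos rfl]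
  rfl

theorem sign_injective {s t : ZMod 2}
    (h : B.sign s (B.simpleObj B.f) = B.sign t (B.simpleObj B.f)) : s = t := by
  have h1 := LinearMap.congr_fun (congrArg GrVec.Hom.lin h) (1 : ℂ)
  rw [sign_fermionObj, sign_fermionObj, mul_one, mul_one] at h1
  rcases zmod_two s with rfl | rfl <;> rcases zmod_two t with rfl | rfl <;>
    first | rfl | (exfalso; norm_num [ZMod.val_one] at h1)

/-- A tensor automorphism of the inclusion of `⟨f⟩` acts on `f` by a sign: on `f ⊗ f ≅ 𝟏` it acts
trivially. -/
theorem exists_app_fermionObj (α : B.fermionInc ⟶ B.fermionInc) [NatTrans.IsMonoidal α] :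
    ∃ t, α.app B.fermionObj = B.sign t (B.simpleObj B.f) := by
  let X := B.fermionObj
  let k : 𝟙_ B.fermionProp.FullSubcategory ⟶ X ⊗ X :=
    ObjectProperty.homMk (lineTo (tensor X.obj X.obj) 0 ((1 : ℂ) ⊗ₜ[ℂ] (1 : ℂ)))
  have h1 : (tensor X.obj X.obj).proj 0 ((1 : ℂ) ⊗ₜ[ℂ] (1 : ℂ)) = (1 : ℂ) ⊗ₜ[ℂ] (1 : ℂ) := by
    have := (line_homog (Ω := B.Ω) B.f 1).tmul (line_homog (Ω := B.Ω) B.f 1)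
    rwa [B.f_add_f] at this
  have hk : (B.fermionInc.map k).lin (1 : ℂ) = (1 : ℂ) ⊗ₜ[ℂ] (1 : ℂ) :=
    (one_smul ℂ _).trans h1
  have hu : α.app (𝟙_ _) = 𝟙 _ := by
    have := NatTrans.IsMonoidal.unit (τ := α)
    exact (Category.id_comp _).symm.trans this
  have hn := LinearMap.congr_fun (congrArg GrVec.Hom.lin (α.naturality k)) (1 : ℂ)
  rw [hu, Category.id_comp, comp_lin, LinearMap.comp_apply, hk] at hn
  have ht : α.app (X ⊗ X) = tmap (α.app X) (α.app X) := by
    have := NatTrans.IsMonoidal.tensor (τ := α) X X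
    exact (Category.id_comp _).symm.trans (this.trans (Category.comp_id _))
  rw [ht] at hn
  set χ : ℂ := (α.app X).lin (1 : ℂ) with hχ
  have hχ2 : χ * χ = 1 := by
    have h2 : χ ⊗ₜ[ℂ] χ = (1 : ℂ) ⊗ₜ[ℂ] (1 : ℂ) := hn
    have h3 := congrArg (TensorProduct.lid ℂ ℂ) h2
    rw [TensorProduct.lid_tmul, TensorProduct.lid_tmul] at h3
    simpa using h3
  have hsign : ∀ t : ZMod 2, χ = (-1) ^ t.val → α.app B.fermionObj = B.sign t (B.simpleObj B.f) :=
    fun t h => GrVec.hom_ext (LinearMap.ext_ring (by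
      refine Eq.trans h (Eq.symm ?_)
      exact (B.sign_fermionObj t 1).trans (mul_one _)))
  rcases mul_self_eq_one_iff.mp hχ2 with h | h
  · exact ⟨0, hsign 0 (by simpa using h)⟩
  · exact ⟨1, hsign 1 (by rw [ZMod.val_one]; simpa using h)⟩

end SpinDatum

namespace Lifting

open Functor.LaxMonoidal BrAut

variable {B : SpinDatum} {G : Type} [Group G] {ρ : G →* AutGroup B} {L L' : Lifting ρ}

theorem RestrictsTo.twist {z : G × G → B.A} {w : G × G → ZMod 2} (H : IsTwist z L L')
    (hw : L.RestrictsTo w) : L'.RestrictsTo fun p => w p + B.restr (z p) := by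
  obtain ⟨η, hη⟩ := H
  obtain ⟨θ, hθ, hmul⟩ := hw
  refine ⟨fun g => Functor.isoWhiskerLeft B.fermionInc (η g).iso.symm ≪≫ θ g, fun g => ?_,
    fun g h X => ?_⟩
  · have := hθ g
    exact inferInstanceAs (NatTrans.IsMonoidal
      (Functor.whiskerLeft B.fermionInc (η g).iso.inv ≫ (θ g).hom))
  · let a : ∀ k, (L.aut k).F.obj X.obj ⟶ X.obj := fun k => (θ k).hom.app X
    change L'.mulApp g h X.obj ≫ (η (g * h)).iso.inv.app X.obj ≫ a (g * h) =
      (L'.aut g).F.map ((η h).iso.inv.app X.obj ≫ a h) ≫ ((η g).iso.inv.app X.obj ≫ a g) ≫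
        B.sign (w (g, h) + B.restr (z (g, h))) X.obj
    have h1 : (L.mulApp g h X.obj ≫ B.Xi (z (g, h)) _) ≫ (η (g * h)).iso.hom.app X.obj =
      ((η g).iso.hom.app ((L.aut h).F.obj X.obj) ≫ (L'.aut g).F.map ((η h).iso.hom.app X.obj)) ≫
        L'.mulApp g h X.obj := hη g h X.obj
    have h2 : L'.mulApp g h X.obj = (L'.aut g).F.map ((η h).iso.inv.app X.obj) ≫
        (η g).iso.inv.app _ ≫ (L.mulApp g h X.obj ≫ B.Xi (z (g, h)) _) ≫
          (η (g * h)).iso.hom.app X.obj := by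
      rw [h1]
      simp only [Category.assoc, Iso.inv_hom_id_app_assoc, ← Functor.map_comp_assoc,
        Iso.inv_hom_id_app, CategoryTheory.Functor.map_id, Category.id_comp]
    have h3 : (L'.aut g).F.map (a h) ≫ (η g).iso.inv.app X.obj =
        (η g).iso.inv.app ((L.aut h).F.obj X.obj) ≫ (L.aut g).F.map (a h) :=
      (η g).iso.inv.naturality (a h)
    have h4 : L.mulApp g h X.obj ≫ a (g * h) =
      (L.aut g).F.map (a h) ≫ a g ≫ B.sign (w (g, h)) X.obj := hmul g h X
    rw [h2]
    simp only [Category.assoc, Iso.hom_inv_id_app_assoc, Functor.map_comp]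
    rw [B.Xi_natural, reassoc_of% h4, reassoc_of% h3, B.Xi_eq_sign _ X.property, B.sign_comp]

/-- Two cochains which describe the restriction of `L` to `⟨f⟩` differ by a coboundary: the two
trivializations of `g_*` on `⟨f⟩` differ by a sign on `f`. -/
theorem RestrictsTo.exists_coboundary {w w' : G × G → ZMod 2} (hw : L.RestrictsTo w)
    (hw' : L.RestrictsTo w') :
    ∃ t : G → ZMod 2, ∀ g h, w (g, h) + t (g * h) = t h + (t g + w' (g, h)) := by
  obtain ⟨θ, hθ, hmul⟩ := hw
  obtain ⟨θ', hθ', hmul'⟩ := hw'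
  let a : ∀ g, (L.aut g).F.obj (B.simpleObj B.f) ≅ B.simpleObj B.f :=
    fun g => (θ g).app B.fermionObj
  let a' : ∀ g, (L.aut g).F.obj (B.simpleObj B.f) ≅ B.simpleObj B.f :=
    fun g => (θ' g).app B.fermionObj
  have key : ∀ g, ∃ t, (a g).inv ≫ (a' g).hom = B.sign t (B.simpleObj B.f) := fun g => by
    have := hθ g
    have := hθ' g
    exact B.exists_app_fermionObj ((θ g).inv ≫ (θ' g).hom)
  choose t ht using key
  have ht' : ∀ g, (a' g).hom = (a g).hom ≫ B.sign (t g) (B.simpleObj B.f) := fun g => by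
    rw [← ht, Iso.hom_inv_id_assoc]
  refine ⟨t, fun g h => B.sign_injective ?_⟩
  let σ : B.fermionObj ⟶ B.fermionObj := ObjectProperty.homMk (B.sign (t h) (B.simpleObj B.f))
  have h1 : (L.aut g).F.map (B.sign (t h) (B.simpleObj B.f)) ≫ (a g).hom =
    (a g).hom ≫ B.sign (t h) (B.simpleObj B.f) := (θ g).hom.naturality σ
  have h2 : L.mulApp g h (B.simpleObj B.f) ≫ (a (g * h)).hom =
    (L.aut g).F.map (a h).hom ≫ (a g).hom ≫ B.sign (w (g, h)) _ := hmul g h B.fermionObj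
  have h3 : L.mulApp g h (B.simpleObj B.f) ≫ (a' (g * h)).hom =
    (L.aut g).F.map (a' h).hom ≫ (a' g).hom ≫ B.sign (w' (g, h)) _ := hmul' g h B.fermionObj
  rw [ht', ht', ht', reassoc_of% h2, Functor.map_comp, Category.assoc, Category.assoc,
    reassoc_of% h1, cancel_epi, cancel_epi] at h3
  simpa only [B.sign_comp] using h3

/-- The class of the restriction of an action to `⟨f⟩` is unique. -/
theorem IsFermionic.unique {α α' : groupCohomology (zmodTwo G) 2} (h : L.IsFermionic α)
    (h' : L.IsFermionic α') : α = α' := by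
  obtain ⟨w, rfl, hw⟩ := h
  obtain ⟨w', rfl, hw'⟩ := h'
  obtain ⟨t, ht⟩ := hw.exists_coboundary hw'
  refine (groupCohomology.H2π_eq_iff _ _).mpr ⟨t, funext fun p => ?_⟩
  have h1 : w p + t (p.1 * p.2) = t p.2 + (t p.1 + w' p) := ht p.1 p.2
  change t p.2 - t (p.1 * p.2) + t p.1 = w p - w' p
  rw [eq_sub_of_add_eq h1]
  abel


/-- Twisting an action by `z` changes the class of its restriction to `⟨f⟩` by `r_*[z]`. -/
theorem IsFermionic.twist {α : groupCohomology (zmodTwo G) 2}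
    {z : groupCohomology.cocycles₂ (moduleA ρ)} (h : L.IsFermionic α) (H : IsTwist z L L') :
    L'.IsFermionic (α + rStar ρ (groupCohomology.H2π (moduleA ρ) z)) := by
  obtain ⟨w, rfl, hw⟩ := h
  let z' : groupCohomology.cocycles₂ (zmodTwo G) :=
    groupCohomology.mapCocycles₂ (MonoidHom.id G) (restrRep ρ) z
  have h1 : rStar ρ (groupCohomology.H2π (moduleA ρ) z) = groupCohomology.H2π (zmodTwo G) z' :=
    groupCohomology.H2π_comp_map_apply (A := moduleA ρ) (B := zmodTwo G) (MonoidHom.id G)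
      (restrRep ρ) z
  exact ⟨w + z', by rw [h1, map_add], hw.twist H⟩

end Lifting

/-! ### Autoequivalences defined by cochains -/

/-- A braided autoequivalence in cochain form: an automorphism `σ` of `A` which fixes `f`, together
with a normalized 2-cochain `m` which compares `(ω, c)` with its pullback along `σ`. -/
structure CochainAut (B : SpinDatum) where
  σ : B.A ≃+ B.A
  m : B.A → B.A → ℂˣ
  map_f : σ B.f = B.f
  zero_left : ∀ a, m 0 a = 1
  zero_right : ∀ a, m a 0 = 1
  assoc : ∀ a b d, m a b * m (a + b) d * (B.Ω.ω a b d)⁻¹ =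
    (B.Ω.ω (σ a) (σ b) (σ d))⁻¹ * m b d * m a (b + d)
  braid : ∀ a b, m a b * B.Ω.c a b = B.Ω.c (σ a) (σ b) * m b a

namespace GrVec

variable {A : Type} [AddCommGroup A] {Ω : AbelianCocycle A} [Fintype A]

/-- The graded vector space with the component of degree `a` moved to degree `σ a`. -/
abbrev reindexObj (σ : A ≃+ A) (X : GrVec Ω) : GrVec Ω where
  carrier := X.carrier
  proj a := X.proj (σ.symm a)
  complete := (CompleteOrthogonalIdempotents.equiv σ.symm.toEquiv).mpr X.complete

/-- The functor which moves the component of degree `a` to degree `σ a`, and does not change the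
underlying vector spaces and linear maps. -/
abbrev reindex (σ : A ≃+ A) : GrVec Ω ⥤ GrVec Ω where
  obj X := reindexObj σ X
  map {X Y} f := (⟨f.lin, fun a v => f.comm (σ.symm a) v⟩ : Hom (reindexObj σ X) (reindexObj σ Y))

theorem Homog.reindex (σ : A ≃+ A) {X : GrVec Ω} {a : A} {v : X.carrier} (hv : X.Homog a v) :
    (reindexObj σ X).Homog (σ a) v := by
  change X.proj (σ.symm (σ a)) v = v
  rw [AddEquiv.symm_apply_apply]
  exact hv

theorem Homog.of_reindex {σ : A ≃+ A} {X : GrVec Ω} {a : A} {v : X.carrier}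
    (hv : (reindexObj σ X).Homog a v) : X.Homog (σ.symm a) v := hv

instance (σ : A ≃+ A) : (reindex (Ω := Ω) σ).Additive where

instance (σ : A ≃+ A) : (reindex (Ω := Ω) σ).Linear ℂ where

instance (σ : A ≃+ A) : (reindex (Ω := Ω) σ).IsEquivalence where
  faithful := ⟨fun {X Y f g} h =>
    hom_ext (congrArg (fun k : reindexObj σ X ⟶ reindexObj σ Y => Hom.lin k) h)⟩
  full := ⟨fun {X Y} (f : reindexObj σ X ⟶ reindexObj σ Y) =>
    have h (a : A) (v : X.carrier) : Hom.lin f (X.proj a v) = Y.proj a (Hom.lin f v) := by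
      have := Hom.comm f (σ a) v
      change Hom.lin f (X.proj (σ.symm (σ a)) v) = Y.proj (σ.symm (σ a)) (Hom.lin f v) at this
      rwa [AddEquiv.symm_apply_apply] at this
    ⟨({ lin := Hom.lin (X := reindexObj σ X) (Y := reindexObj σ Y) f, comm := h } : Hom X Y), rfl⟩⟩
  essSurj := ⟨fun Y => ⟨reindexObj σ.symm Y, ⟨isoOfEquiv
    (X := reindexObj σ (reindexObj σ.symm Y)) (LinearEquiv.refl ℂ Y.carrier) fun a v hv => by
      have hv' : Y.proj (σ (σ.symm a)) v = v := hv
      rwa [AddEquiv.apply_symm_apply] at hv'⟩⟩⟩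

end GrVec

namespace CochainAut

open GrVec

variable {B : SpinDatum} (D : CochainAut B)

theorem homog_tmul {X Y : B.Cat} {a b : B.A} {v : X.carrier} {w : Y.carrier} (r : ℂ)
    (hv : (reindexObj D.σ X).Homog a v) (hw : (reindexObj D.σ Y).Homog b w) :
    (reindexObj D.σ (tensor X Y)).Homog (a + b) (r • v ⊗ₜ[ℂ] w) := by
  refine Homog.smul ?_ r
  have := (hv.of_reindex.tmul hw.of_reindex).reindex D.σ
  rwa [map_add, AddEquiv.apply_symm_apply, AddEquiv.apply_symm_apply] at this

/-- Multiplication by `m a b` on `V_a ⊗ W_b`. -/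
def muEquiv (X Y : B.Cat) : X.carrier ⊗[ℂ] Y.carrier ≃ₗ[ℂ] X.carrier ⊗[ℂ] Y.carrier :=
  LinearEquiv.ofLinearMap (scale₂ X Y fun a b => (D.m a b : ℂ))
    (scale₂ X Y fun a b => (((D.m a b)⁻¹ : ℂˣ) : ℂ))
    (ext₂ (X := X) (Y := Y) fun a b v w hv hw => by
      rw [LinearMap.comp_apply, scale₂_tmul hv hw, map_smul, scale₂_tmul hv hw, smul_smul,
        ← Units.val_mul, inv_mul_cancel, Units.val_one, one_smul, LinearMap.id_apply])
    (ext₂ (X := X) (Y := Y) fun a b v w hv hw => by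
      rw [LinearMap.comp_apply, scale₂_tmul hv hw, map_smul, scale₂_tmul hv hw, smul_smul,
        ← Units.val_mul, mul_inv_cancel, Units.val_one, one_smul, LinearMap.id_apply])

theorem muEquiv_tmul {X Y : B.Cat} {a b : B.A} {v : X.carrier} {w : Y.carrier}
    (hv : X.Homog a v) (hw : Y.Homog b w) :
    D.muEquiv X Y (v ⊗ₜ[ℂ] w) = (D.m a b : ℂ) • v ⊗ₜ[ℂ] w :=
  scale₂_tmul (s := fun a b => (D.m a b : ℂ)) hv hw

/-- The tensor structure: multiplication by `m a b` on `V_a ⊗ W_b`. -/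
def muIso (X Y : B.Cat) : tensor (reindexObj D.σ X) (reindexObj D.σ Y) ≅
    reindexObj D.σ (tensor X Y) :=
  isoOfEquiv (X := tensor (reindexObj D.σ X) (reindexObj D.σ Y))
    (Y := reindexObj D.σ (tensor X Y)) (D.muEquiv X Y) fun d t ht => by
    have h := comm_of_tmul (X := reindexObj D.σ X) (Y := reindexObj D.σ Y)
      (T := reindexObj D.σ (tensor X Y)) (D.muEquiv X Y).toLinearMap (fun a b v w hv hw => by
        have h := D.homog_tmul (D.m (D.σ.symm a) (D.σ.symm b)) hv hw
        rwa [← muEquiv_tmul D hv.of_reindex hw.of_reindex] at h) d t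
    have ht' : tproj (reindexObj D.σ X) (reindexObj D.σ Y) d t = t := ht
    rw [ht'] at h
    exact h.symm

theorem muIso_tmul {X Y : B.Cat} {a b : B.A} {v : X.carrier} {w : Y.carrier}
    (hv : X.Homog a v) (hw : Y.Homog b w) :
    (D.muIso X Y).hom.lin (v ⊗ₜ[ℂ] w) = (D.m a b : ℂ) • v ⊗ₜ[ℂ] w := D.muEquiv_tmul hv hw

/-- The unit isomorphism. -/
def epsIso : B.simpleObj 0 ≅ reindexObj D.σ (B.simpleObj 0) :=
  isoOfEquiv (LinearEquiv.refl ℂ ℂ) fun a v hv => by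
    rcases eq_zero_of_line hv with rfl | rfl
    · have := (line_homog (Ω := B.Ω) 0 v).reindex D.σ
      rwa [map_zero] at this
    · exact homog_zero _ _

/-- The underlying functor with its tensor structure. -/
instance monoidal : (reindex (Ω := B.Ω) D.σ).Monoidal := Functor.CoreMonoidal.toMonoidal
  { εIso := D.epsIso
    μIso := D.muIso
    μIso_hom_natural_left := fun {X Y} f Z => hom_ext (ext₂ (X := X) (Y := Z)
      fun a b v w hv hw => by
        change (D.muIso Y Z).hom.lin (f.lin v ⊗ₜ[ℂ] w) =
          (tmap f (𝟙 Z)).lin ((D.muIso X Z).hom.lin (v ⊗ₜ[ℂ] w))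
        rw [muIso_tmul D (hv.map f) hw, muIso_tmul D hv hw, map_smul]
        rfl)
    μIso_hom_natural_right := fun {X Y} Z f => hom_ext (ext₂ (X := Z) (Y := X)
      fun a b v w hv hw => by
        change (D.muIso Z Y).hom.lin (v ⊗ₜ[ℂ] f.lin w) =
          (tmap (𝟙 Z) f).lin ((D.muIso Z X).hom.lin (v ⊗ₜ[ℂ] w))
        rw [muIso_tmul D hv (hw.map f), muIso_tmul D hv hw, map_smul]
        rfl)
    associativity := fun X Y Z => hom_ext (ext₃' (X := X) (Y := Y) (Z := Z)
      fun a b d v w u hv hw hu => by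
        change assocLin X Y Z ((D.muIso (tensor X Y) Z).hom.lin
            ((D.muIso X Y).hom.lin (v ⊗ₜ[ℂ] w) ⊗ₜ[ℂ] u)) =
          (D.muIso X (tensor Y Z)).hom.lin (LinearMap.lTensor X.carrier (D.muIso Y Z).hom.lin
            (assocLin (reindexObj D.σ X) (reindexObj D.σ Y) (reindexObj D.σ Z)
              ((v ⊗ₜ[ℂ] w) ⊗ₜ[ℂ] u)))
        have h := congrArg Units.val (D.assoc a b d)
        have e := assocLin_tmul (hv.reindex D.σ) (hw.reindex D.σ) (hu.reindex D.σ)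
        rw [e]
        simp only [Units.val_mul] at h
        rw [muIso_tmul D hv hw, map_smul, map_smul, LinearMap.lTensor_tmul, muIso_tmul D hw hu,
          ← TensorProduct.smul_tmul', map_smul, muIso_tmul D (hv.tmul hw) hu, map_smul, map_smul,
          assocLin_tmul hv hw hu, TensorProduct.tmul_smul, map_smul,
          muIso_tmul D hv (hw.tmul hu)]
        simp only [smul_smul]
        rw [← mul_assoc, ← mul_assoc, h])
    left_unitality := fun X => hom_ext (ext₂ (X := B.simpleObj 0) (Y := X)
      fun a b r v hr hv => by
        change r • v = TensorProduct.lid ℂ X.carrier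
          ((D.muIso (B.simpleObj 0) X).hom.lin (r ⊗ₜ[ℂ] v))
        rw [muIso_tmul D (line_homog 0 r) hv, D.zero_left, Units.val_one, one_smul]
        rfl)
    right_unitality := fun X => hom_ext (ext₂ (X := X) (Y := B.simpleObj 0)
      fun a b v r hv hr => by
        change r • v = TensorProduct.rid ℂ X.carrier
          ((D.muIso X (B.simpleObj 0)).hom.lin (v ⊗ₜ[ℂ] r))
        rw [muIso_tmul D hv (line_homog 0 r), D.zero_right, Units.val_one, one_smul]
        rfl) }

/-- The braided autoequivalence defined by `D`. -/
def toBrAut : BrAut B where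
  F := reindex D.σ
  braided :=
    { D.monoidal with
      braided := fun X Y => hom_ext (ext₂ (X := X) (Y := Y) fun a b v w hv hw => by
        change braidLin X Y ((D.muIso X Y).hom.lin (v ⊗ₜ[ℂ] w)) =
          (D.muIso Y X).hom.lin (braidLin (reindexObj D.σ X) (reindexObj D.σ Y) (v ⊗ₜ[ℂ] w))
        have e := braidLin_tmul (hv.reindex D.σ) (hw.reindex D.σ)
        rw [e, map_smul, muIso_tmul D hv hw, muIso_tmul D hw hv, map_smul, braidLin_tmul hv hw]
        rw [smul_smul, smul_smul, ← Units.val_mul, D.braid, Units.val_mul]) }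
  fermion := ⟨isoOfEquiv (X := reindexObj D.σ (B.simpleObj B.f)) (LinearEquiv.refl ℂ ℂ)
    fun a v hv => by
      rcases eq_zero_of_line hv.of_reindex with h | rfl
      · rw [AddEquiv.symm_apply_eq, D.map_f] at h
        rw [h]
        exact line_homog _ _
      · exact homog_zero _ _⟩

theorem perm_toBrAut (a : B.A) : D.toBrAut.perm a = D.σ a :=
  BrAut.permFun_eq _ (isoOfEquiv (X := reindexObj D.σ (B.simpleObj a)) (LinearEquiv.refl ℂ ℂ)
    fun b v hv => by
      rcases eq_zero_of_line hv.of_reindex with h | rfl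
      · rw [AddEquiv.symm_apply_eq] at h
        rw [h]
        exact line_homog _ _
      · exact homog_zero _ _)

variable {D} {E K : CochainAut B}

/-- If the cochains compose strictly, the composite of the autoequivalences defined by `D` and `E`
is the one defined by `K`; the comparison is the identity on underlying vector spaces. -/
def compHom (hσ : K.σ = E.σ.trans D.σ)
    (hm : ∀ a b, K.m a b = D.m (E.σ a) (E.σ b) * E.m a b) :
    D.toBrAut ⊗ E.toBrAut ⟶ K.toBrAut :=
  ({ iso := NatIso.ofComponents (F := reindex E.σ ⋙ reindex D.σ) (G := reindex K.σ)
      (fun X => isoOfEquiv (X := reindexObj D.σ (reindexObj E.σ X)) (Y := reindexObj K.σ X)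
        (LinearEquiv.refl ℂ X.carrier) fun a v hv => by
          change X.proj (K.σ.symm a) v = v
          rw [hσ]
          exact hv) (fun f => rfl)
     isMonoidal :=
      { unit := rfl
        tensor := fun X Y => hom_ext (ext₂ (X := X) (Y := Y) fun a b v w hv hw => by
          change (E.muIso X Y).hom.lin
            ((D.muIso (reindexObj E.σ X) (reindexObj E.σ Y)).hom.lin (v ⊗ₜ[ℂ] w)) =
            (K.muIso X Y).hom.lin (v ⊗ₜ[ℂ] w)
          have e := D.muIso_tmul (hv.reindex E.σ) (hw.reindex E.σ)
          rw [e, map_smul, muIso_tmul E hv hw, muIso_tmul K hv hw, hm, smul_smul,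
            Units.val_mul]) } } : BrAut.Hom (BrAut.comp D.toBrAut E.toBrAut) K.toBrAut)

/-- If `K` is trivial, the autoequivalence which it defines is the identity functor. -/
def unitHom (hσ : K.σ = AddEquiv.refl B.A) (hm : ∀ a b, K.m a b = 1) :
    𝟙_ (BrAut B) ⟶ K.toBrAut :=
  ({ iso := NatIso.ofComponents (F := 𝟭 B.Cat) (G := reindex K.σ)
      (fun X => isoOfEquiv (X := X) (Y := reindexObj K.σ X)
        (LinearEquiv.refl ℂ X.carrier) fun a v hv => by
          change X.proj (K.σ.symm a) v = v
          rw [hσ]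
          exact hv) (fun f => rfl)
     isMonoidal :=
      { unit := rfl
        tensor := fun X Y => hom_ext (ext₂ (X := X) (Y := Y) fun a b v w hv hw => by
          change v ⊗ₜ[ℂ] w = (K.muIso X Y).hom.lin (v ⊗ₜ[ℂ] w)
          rw [muIso_tmul K hv hw, hm, Units.val_one, one_smul]) } } :
    BrAut.Hom (BrAut.one B) K.toBrAut)

end CochainAut

/-! ### The non-trivial autoequivalence of the explicit categories -/

namespace CochainAut

/-- The trivial cochain, which defines the identity functor. -/
def trivial (B : SpinDatum) : CochainAut B where
  σ := AddEquiv.refl B.A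
  m _ _ := 1
  map_f := rfl
  zero_left _ := rfl
  zero_right _ := rfl
  assoc _ _ _ := by simp
  braid _ _ := by simp

/-- `D` exchanges the two elements outside `{0, f}`, its square is the identity as a tensor functor
(`mul_self`), and its tensor structure is trivial on `⟨f⟩` (`m_f_f`). -/
structure IsSwap {B : SpinDatum} (D : CochainAut B) : Prop where
  σ_apply : ∀ a, a ≠ 0 → a ≠ B.f → D.σ a = a + B.f
  mul_self : ∀ a b, D.m (D.σ a) (D.σ b) * D.m a b = 1
  m_f_f : D.m B.f B.f = 1

/-- The exponent of `-1` in the cochain of `CochainAut.cyclic`: `1` if `x` is odd and `y = 2`, and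
`0` otherwise. Thus `m(x, y) / m(y, x) = (-1)^(x + y) = c(-x, -y) / c(x, y)` for `x, y ≠ 0`. -/
def cyclicExponent (x y : ZMod 4) : ℕ := if x.val % 2 = 1 ∧ y.val = 2 then 1 else 0

/-- The automorphism `x ↦ -x` of `ℤ/4`, with `m` the power of `-1` given by `cyclicExponent`. -/
def cyclic (κ : ℂˣ) (hκ : κ ^ 4 = -1) : CochainAut (cyclicDatum κ hκ) where
  σ := AddEquiv.neg (ZMod 4)
  m x y := (-1) ^ cyclicExponent x y
  map_f := by change -(2 : ZMod 4) = 2; decide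
  zero_left (a : ZMod 4) := by
    change (-1 : ℂˣ) ^ cyclicExponent 0 a = (-1) ^ 0
    congr 1
  zero_right (a : ZMod 4) := by
    change (-1 : ℂˣ) ^ cyclicExponent a 0 = (-1) ^ 0
    congr 1
    revert a; decide
  assoc (a b d : ZMod 4) := by
    have hω (x y z : ZMod 4) : ((cyclicDatum κ hκ).Ω.ω x y z)⁻¹ =
        (-1) ^ (if 4 ≤ y.val + z.val then x.val else 0) := by
      change (if 4 ≤ y.val + z.val then (-1 : ℂˣ) ^ x.val else 1)⁻¹ = _
      split_ifs
      · rw [← inv_pow, inv_neg, inv_one]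
      · rw [inv_one, pow_zero]
    change (-1 : ℂˣ) ^ cyclicExponent a b * (-1 : ℂˣ) ^ cyclicExponent (a + b) d *
      ((cyclicDatum κ hκ).Ω.ω a b d)⁻¹ =
      ((cyclicDatum κ hκ).Ω.ω (-a : ZMod 4) (-b : ZMod 4) (-d : ZMod 4))⁻¹ *
      (-1 : ℂˣ) ^ cyclicExponent b d * (-1 : ℂˣ) ^ cyclicExponent a (b + d)
    rw [hω, hω, ← pow_add, ← pow_add, ← pow_add, ← pow_add]
    refine pow_eq_of_mod (n := 2) (by simp) ?_
    revert a b d; decide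
  braid (a b : ZMod 4) := by
    have h8 : κ ^ 8 = 1 := by
      rw [show 8 = 4 * 2 from rfl, pow_mul, hκ]; simp
    change (-1 : ℂˣ) ^ cyclicExponent a b * κ ^ (a.val * b.val) =
      κ ^ ((-a).val * (-b).val) * (-1 : ℂˣ) ^ cyclicExponent b a
    rw [← hκ, ← pow_mul, ← pow_mul, ← pow_add, ← pow_add]
    refine pow_eq_of_mod h8 ?_
    revert a b; decide

theorem isSwap_cyclic (κ : ℂˣ) (hκ : κ ^ 4 = -1) : (cyclic κ hκ).IsSwap where
  σ_apply := show ∀ a : ZMod 4, a ≠ 0 → a ≠ 2 → -a = a + 2 by decide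
  mul_self (a b : ZMod 4) := by
    change (-1 : ℂˣ) ^ cyclicExponent (-a) (-b) * (-1 : ℂˣ) ^ cyclicExponent a b = (-1) ^ 0
    rw [← pow_add]
    refine pow_eq_of_mod (n := 2) (by simp) ?_
    revert a b; decide
  m_f_f := by
    change (-1 : ℂˣ) ^ cyclicExponent 2 2 = (-1) ^ 0
    congr 1

/-- The square root `i` of `-1` as a unit. -/
def unitI : ℂˣ := Units.mk0 Complex.I Complex.I_ne_zero

theorem unitI_sq : unitI ^ 2 = -1 := Units.ext (by simp [unitI])

theorem unitI_pow_four : unitI ^ 4 = 1 := by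
  rw [show 4 = 2 * 2 from rfl, pow_mul, unitI_sq]; simp

/-- The exponent of `i` in the cochain of `CochainAut.klein`: the bilinear form `2 x_f y_v`, which
accounts for the braiding, plus the coboundary of the indicator function `x_v x_f` of `v + f`, which
makes the cochain inverse to its translate under the swap. Exponents are only relevant modulo `4`,
so `3` stands for `-1`. -/
def kleinExponent (x y : ZMod 2 × ZMod 2) : ℕ :=
  2 * (x.2.val * y.1.val) + x.1.val * x.2.val + y.1.val * y.2.val +
    3 * ((x + y).1.val * (x + y).2.val)

/-- The automorphism `(x_v, x_f) ↦ (x_v, x_v + x_f)` of `ℤ/2 ⊕ ℤ/2`. -/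
def kleinShear : ZMod 2 × ZMod 2 ≃+ ZMod 2 × ZMod 2 where
  toFun x := (x.1, x.1 + x.2)
  invFun x := (x.1, x.1 + x.2)
  left_inv := by decide
  right_inv := by decide
  map_add' := by decide

/-- The automorphism `(x_v, x_f) ↦ (x_v, x_v + x_f)` of `ℤ/2 ⊕ ℤ/2`, with `m` the power of `i`
given by `kleinExponent`. -/
def klein (κ : ℂˣ) (hκ : κ ^ 4 = 1) : CochainAut (kleinDatum κ hκ) where
  σ := kleinShear
  m x y := unitI ^ kleinExponent x y
  map_f := by change kleinShear (0, 1) = (0, 1); decide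
  zero_left (a : ZMod 2 × ZMod 2) := by
    change unitI ^ kleinExponent 0 a = unitI ^ 0
    refine pow_eq_of_mod unitI_pow_four ?_
    revert a; decide
  zero_right (a : ZMod 2 × ZMod 2) := by
    change unitI ^ kleinExponent a 0 = unitI ^ 0
    refine pow_eq_of_mod unitI_pow_four ?_
    revert a; decide
  assoc (a b d : ZMod 2 × ZMod 2) := by
    -- `ω` only depends on the coordinate `x_v`, which the automorphism preserves
    change unitI ^ kleinExponent a b * unitI ^ kleinExponent (a + b) d *
        ((kleinDatum κ hκ).Ω.ω a b d)⁻¹ =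
      ((kleinDatum κ hκ).Ω.ω a b d)⁻¹ * unitI ^ kleinExponent b d *
        unitI ^ kleinExponent a (b + d)
    rw [mul_comm, mul_assoc]
    congr 1
    rw [← pow_add, ← pow_add]
    refine pow_eq_of_mod unitI_pow_four ?_
    revert a b d; decide
  braid (a b : ZMod 2 × ZMod 2) := by
    change unitI ^ kleinExponent a b *
        ((-1) ^ ((a.1.val + a.2.val) * b.2.val) * κ ^ (a.1.val * b.1.val)) =
      (-1) ^ ((a.1.val + (a.1 + a.2).val) * (b.1 + b.2).val) * κ ^ (a.1.val * b.1.val) *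
        unitI ^ kleinExponent b a
    rw [mul_right_comm, ← mul_assoc]
    congr 1
    rw [← unitI_sq, ← pow_mul, ← pow_mul, ← pow_add, ← pow_add]
    refine pow_eq_of_mod unitI_pow_four ?_
    revert a b; decide

theorem isSwap_klein (κ : ℂˣ) (hκ : κ ^ 4 = 1) : (klein κ hκ).IsSwap where
  σ_apply := show ∀ a : ZMod 2 × ZMod 2, a ≠ 0 → a ≠ (0, 1) → kleinShear a = a + (0, 1) by decide
  mul_self (a b : ZMod 2 × ZMod 2) := by
    change unitI ^ kleinExponent (kleinShear a) (kleinShear b) * unitI ^ kleinExponent a b =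
      unitI ^ 0
    rw [← pow_add]
    refine pow_eq_of_mod unitI_pow_four ?_
    revert a b; decide
  m_f_f := by
    change unitI ^ kleinExponent (0, 1) (0, 1) = unitI ^ 0
    exact pow_eq_of_mod unitI_pow_four (by decide)

theorem exists_isSwap (k : RankFour) : ∃ D : CochainAut k.datum, D.IsSwap :=
  match k with
  | .klein κ hκ => ⟨klein κ hκ, isSwap_klein κ hκ⟩
  | .cyclic κ hκ => ⟨cyclic κ hκ, isSwap_cyclic κ hκ⟩

end CochainAut

/-! ### The automorphism group and strict actions -/

/-- `Aut_⊗^br(𝓑, f)` acts faithfully on `A`. -/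
theorem permRep_injective (B : SpinDatum) {x y : AutGroup B}
    (h : ∀ a, permRep B x a = permRep B y a) : x = y := by
  obtain ⟨η⟩ := BrAut.nonempty_hom_of_perm_eq (S := x.out) (T := y.out) h
  have := congr_toSkeleton_of_iso (BrAut.toIso η)
  rwa [show toSkeleton x.out = x from toSkeleton_fromSkeleton_obj x,
    show toSkeleton y.out = y from toSkeleton_fromSkeleton_obj y] at this

/-- A braided autoequivalence preserves the cosets of `{0, f}` and fixes `0` and `f`, hence is
determined on `A` by the element by which it translates the non-trivial coset. -/
theorem exists_permRep_eq (B : SpinDatum) (x : AutGroup B) :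
    (∀ a, permRep B x a = a) ∨ ∀ a, a ≠ 0 → a ≠ B.f → permRep B x a = a + B.f := by
  obtain ⟨v, hv⟩ := B.exists_restr
  have hfix : ∀ a, B.restr a = 0 → permRep B x a = a := fun a ha => by
    rcases B.restr_eq_zero ha with rfl | rfl
    · exact map_zero _
    · exact permRep_fermion B x
  have hcoset : ∀ a, B.restr a = 1 → permRep B x a = a + (permRep B x v - v) := fun a ha => by
    have h := hfix (a - v) (by rw [map_sub, ha, hv, sub_self])
    rw [map_sub, sub_eq_iff_eq_add] at h
    rw [h]
    abel
  have hd : B.restr (permRep B x v - v) = 0 := by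
    rw [map_sub, B.restr_permRep, sub_self]
  rcases B.restr_eq_zero hd with hd | hd
  · refine Or.inl fun a => ?_
    rcases SpinDatum.zmod_two (B.restr a) with ha | ha
    · exact hfix a ha
    · rw [hcoset a ha, hd, add_zero]
  · refine Or.inr fun a h0 hf => ?_
    rcases SpinDatum.zmod_two (B.restr a) with ha | ha
    · rcases B.restr_eq_zero ha with h | h
      exacts [absurd h h0, absurd h hf]
    · rw [hcoset a ha, hd]

namespace CochainAut

variable {B : SpinDatum} {D : CochainAut B}

theorem IsSwap.σ_σ (h : D.IsSwap) (a : B.A) : D.σ (D.σ a) = a := by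
  by_cases h0 : a = 0
  · rw [h0, map_zero, map_zero]
  by_cases hf : a = B.f
  · rw [hf, D.map_f, D.map_f]
  · rw [h.σ_apply a h0 hf, map_add, h.σ_apply a h0 hf, D.map_f, add_assoc, B.f_add_f, add_zero]

open Classical in
/-- The strict action of `ℤ/2` generated by a swap. -/
def power (D : CochainAut B) (s : ZMod 2) : CochainAut B := if s = 0 then trivial B else D

theorem power_zero (D : CochainAut B) : D.power 0 = trivial B := if_pos rfl

theorem power_one (D : CochainAut B) : D.power 1 = D := if_neg one_ne_zero

theorem IsSwap.power_σ (h : D.IsSwap) (s t : ZMod 2) :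
    (D.power (s + t)).σ = (D.power t).σ.trans (D.power s).σ := by
  have h2 : (1 + 1 : ZMod 2) = 0 := rfl
  rcases SpinDatum.zmod_two s with rfl | rfl <;> rcases SpinDatum.zmod_two t with rfl | rfl <;>
    simp only [h2, add_zero, zero_add, power_zero, power_one]
  · rfl
  · rfl
  · rfl
  · exact AddEquiv.ext fun a => (h.σ_σ a).symm

theorem IsSwap.power_m (h : D.IsSwap) (s t : ZMod 2) (a b : B.A) :
    (D.power (s + t)).m a b =
      (D.power s).m ((D.power t).σ a) ((D.power t).σ b) * (D.power t).m a b := by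
  have h2 : (1 + 1 : ZMod 2) = 0 := rfl
  rcases SpinDatum.zmod_two s with rfl | rfl <;> rcases SpinDatum.zmod_two t with rfl | rfl <;>
    simp only [h2, add_zero, zero_add, power_zero, power_one]
  · exact (one_mul _).symm
  · exact (one_mul _).symm
  · exact (mul_one _).symm
  · exact (h.mul_self a b).symm

theorem IsSwap.power_m_f_f (h : D.IsSwap) (s : ZMod 2) : (D.power s).m B.f B.f = 1 := by
  rcases SpinDatum.zmod_two s with rfl | rfl
  · rw [power_zero]; rfl
  · rw [power_one, h.m_f_f]

/-- The tensor isomorphism `s_* ∘ t_* ≅ (s + t)_*` of the strict action. -/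
def IsSwap.compIso (h : D.IsSwap) (s t : ZMod 2) :
    (D.power s).toBrAut ⊗ (D.power t).toBrAut ≅ (D.power (s + t)).toBrAut :=
  BrAut.toIso (compHom (h.power_σ s t) (h.power_m s t))

theorem permRep_power (D : CochainAut B) (s : ZMod 2) (a : B.A) :
    permRep B (toSkeleton (D.power s).toBrAut) a = (D.power s).σ a := by
  rw [permRep_toSkeleton, perm_toBrAut]

theorem IsSwap.exists_ne (h : D.IsSwap) : ∃ a, D.σ a ≠ a := by
  obtain ⟨v, hv⟩ := B.exists_restr
  refine ⟨v, fun hfix => ?_⟩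
  rw [h.σ_apply v (by rintro rfl; simp at hv)
    (by rintro rfl; rw [B.restr_f] at hv; exact absurd hv (by decide))] at hfix
  exact B.f_ne_zero (by simpa using hfix)

theorem IsSwap.power_injective (h : D.IsSwap) {s t : ZMod 2}
    (hst : ∀ a, (D.power s).σ a = (D.power t).σ a) : s = t := by
  obtain ⟨v, hv⟩ := h.exists_ne
  have := hst v
  rcases SpinDatum.zmod_two s with rfl | rfl <;> rcases SpinDatum.zmod_two t with rfl | rfl
  · rfl
  · rw [power_zero, power_one] at this
    exact absurd this.symm hv
  · rw [power_zero, power_one] at this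
    exact absurd this hv
  · rfl

theorem IsSwap.exists_power (h : D.IsSwap) (x : AutGroup B) :
    ∃ s, toSkeleton (D.power s).toBrAut = x := by
  rcases exists_permRep_eq B x with hx | hx
  · refine ⟨0, permRep_injective B fun a => ?_⟩
    rw [permRep_power, power_zero, hx]
    rfl
  · refine ⟨1, permRep_injective B fun a => ?_⟩
    rw [permRep_power, power_one]
    by_cases h0 : a = 0
    · rw [h0, map_zero, map_zero]
    by_cases hf : a = B.f
    · rw [hf, D.map_f, permRep_fermion]
    · rw [h.σ_apply a h0 hf, hx a h0 hf]

/-- The group of isomorphism classes of autoequivalences is generated by the class of a swap. -/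
def IsSwap.mulEquiv (h : D.IsSwap) : Multiplicative (ZMod 2) ≃* AutGroup B :=
  MulEquiv.ofBijective
    ({ toFun := fun s => toSkeleton (D.power s.toAdd).toBrAut
       map_mul' := fun s t => by
        rw [← Skeleton.toSkeleton_tensorObj]
        exact (congr_toSkeleton_of_iso (h.compIso s.toAdd t.toAdd)).symm } :
      Multiplicative (ZMod 2) →ₙ* AutGroup B)
    ⟨fun s t hst => h.power_injective (s := s.toAdd) (t := t.toAdd) fun a => by
      rw [← permRep_power, ← permRep_power]
      exact congrArg (fun x => permRep B x a) hst, h.exists_power⟩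

section Strict

variable {G : Type} [Group G] {ρ : G →* AutGroup B}

/-- The element of `ℤ/2` by which `g` acts. -/
def IsSwap.exponent (h : D.IsSwap) (ρ : G →* AutGroup B) (g : G) : ZMod 2 :=
  (h.mulEquiv.symm (ρ g)).toAdd

theorem IsSwap.exponent_mul (h : D.IsSwap) (ρ : G →* AutGroup B) (g g' : G) :
    h.exponent ρ (g * g') = h.exponent ρ g + h.exponent ρ g' := by
  rw [exponent, map_mul, map_mul, toAdd_mul]; rfl

theorem IsSwap.exponent_one (h : D.IsSwap) (ρ : G →* AutGroup B) : h.exponent ρ 1 = 0 := by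
  rw [exponent, map_one, map_one, toAdd_one]

/-- The strict action of `G` through powers of a swap. -/
abbrev IsSwap.strictFunctor (h : D.IsSwap) (ρ : G →* AutGroup B) : Discrete G ⥤ BrAut B :=
  Discrete.functor fun g => (D.power (h.exponent ρ g)).toBrAut

/-- The structure morphisms of `Discrete G`, which are only propositionally identities, act as the
identity on underlying vector spaces. -/
theorem IsSwap.strictFunctor_map (h : D.IsSwap) (ρ : G →* AutGroup B) {g g' : Discrete G}
    (φ : g ⟶ g') (X : B.Cat) (v : X.carrier) :
    GrVec.Hom.lin (((h.strictFunctor ρ).map φ).iso.hom.app X) v = v := by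
  obtain ⟨g⟩ := g
  obtain ⟨g'⟩ := g'
  obtain rfl : g = g' := Discrete.eq_of_hom φ
  obtain rfl : φ = 𝟙 _ := Subsingleton.elim _ _
  rw [CategoryTheory.Functor.map_id]
  rfl

instance (h : D.IsSwap) (ρ : G →* AutGroup B) : (h.strictFunctor ρ).Monoidal :=
  Functor.CoreMonoidal.toMonoidal
  { εIso := BrAut.toIso (unitHom
      (by
        change (D.power (h.exponent ρ 1)).σ = _
        rw [h.exponent_one, power_zero]
        rfl)
      fun a b => by
        change (D.power (h.exponent ρ 1)).m a b = _
        rw [h.exponent_one, power_zero]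
        rfl)
    μIso := fun g g' => BrAut.toIso (compHom
      (by
        change (D.power (h.exponent ρ (g.as * g'.as))).σ = _
        rw [h.exponent_mul, h.power_σ])
      fun a b => by
        change (D.power (h.exponent ρ (g.as * g'.as))).m a b = _
        rw [h.exponent_mul, h.power_m])
    μIso_hom_natural_left := fun {g₁ g₂} φ g => by
      obtain rfl : g₁ = g₂ := Discrete.ext (Discrete.eq_of_hom φ)
      obtain rfl : φ = 𝟙 _ := Subsingleton.elim _ _
      rw [id_whiskerRight, CategoryTheory.Functor.map_id, CategoryTheory.Functor.map_id,
        id_whiskerRight, Category.id_comp, Category.comp_id]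
    μIso_hom_natural_right := fun {g₁ g₂} g φ => by
      obtain rfl : g₁ = g₂ := Discrete.ext (Discrete.eq_of_hom φ)
      obtain rfl : φ = 𝟙 _ := Subsingleton.elim _ _
      rw [whiskerLeft_id, CategoryTheory.Functor.map_id, CategoryTheory.Functor.map_id,
        whiskerLeft_id, Category.id_comp, Category.comp_id]
    associativity := fun g g' g'' => BrAut.hom_ext fun X =>
      GrVec.hom_ext (LinearMap.ext fun v => by
        have h1 := h.strictFunctor_map ρ (α_ g g' g'').hom X v
        exact h1)
    left_unitality := fun g => BrAut.hom_ext fun X =>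
      GrVec.hom_ext (LinearMap.ext fun v => by
        have h1 := h.strictFunctor_map ρ (λ_ g).hom X v
        exact h1.symm)
    right_unitality := fun g => BrAut.hom_ext fun X =>
      GrVec.hom_ext (LinearMap.ext fun v => by
        have h1 := h.strictFunctor_map ρ (ρ_ g).hom X v
        exact h1.symm) }

/-- The strict lifting of `ρ`. -/
def IsSwap.strictLifting (h : D.IsSwap) (ρ : G →* AutGroup B) : Lifting ρ where
  toFunctor := h.strictFunctor ρ
  lifts g := h.mulEquiv.apply_symm_apply (ρ g)

/-- Since `σ` fixes `0` and `f`, reindexing along `σ` does not change the degrees of objects of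
`⟨f⟩`. -/
theorem homog_of_reindex (D : CochainAut B) {X : B.Cat} (hX : B.fermionProp X) {a : B.A}
    {v : X.carrier} (hv : (GrVec.reindexObj D.σ X).Homog a v) : X.Homog a v := by
  have hv' : X.Homog (D.σ.symm a) v := hv
  by_cases h0 : D.σ.symm a = 0
  · rw [AddEquiv.symm_apply_eq, map_zero] at h0
    rwa [h0, map_zero, ← h0] at hv'
  by_cases hf : D.σ.symm a = B.f
  · have ha := hf
    rw [AddEquiv.symm_apply_eq, D.map_f] at ha
    rwa [hf, ← ha] at hv'
  · rw [SpinDatum.eq_zero_of_fermionProp hX hv' h0 hf]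
    exact GrVec.homog_zero _ _

/-- On `⟨f⟩` the tensor structure of the strict action is trivial. -/
theorem IsSwap.muEquiv_power (h : D.IsSwap) (s : ZMod 2) {X Y : B.Cat} (hX : B.fermionProp X)
    (hY : B.fermionProp Y) {a b : B.A} {v : X.carrier} {w : Y.carrier} (hv : X.Homog a v)
    (hw : Y.Homog b w) : (D.power s).muEquiv X Y (v ⊗ₜ[ℂ] w) = v ⊗ₜ[ℂ] w := by
  rw [muEquiv_tmul _ hv hw]
  by_cases ha : a = 0
  · rw [ha, zero_left, Units.val_one, one_smul]
  by_cases hb : b = 0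
  · rw [hb, zero_right, Units.val_one, one_smul]
  by_cases haf : a = B.f
  · by_cases hbf : b = B.f
    · rw [haf, hbf, h.power_m_f_f, Units.val_one, one_smul]
    · rw [SpinDatum.eq_zero_of_fermionProp hY hw hb hbf, tmul_zero, smul_zero]
  · rw [SpinDatum.eq_zero_of_fermionProp hX hv ha haf, zero_tmul, smul_zero]

theorem IsSwap.restrictsTo_zero (h : D.IsSwap) (ρ : G →* AutGroup B) :
    (h.strictLifting ρ).RestrictsTo 0 :=
  ⟨fun g => NatIso.ofComponents
      (F := B.fermionInc ⋙ GrVec.reindex (D.power (h.exponent ρ g)).σ) (G := B.fermionInc)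
      (fun X => GrVec.isoOfEquiv
        (X := GrVec.reindexObj (D.power (h.exponent ρ g)).σ X.obj) (Y := X.obj)
        (LinearEquiv.refl ℂ X.obj.carrier) fun a v hv => homog_of_reindex _ X.property hv)
      (fun f => rfl),
    fun g =>
      { unit := rfl
        tensor := fun X Y => GrVec.hom_ext (GrVec.ext₂ (X := X.obj) (Y := Y.obj)
          fun a b v w hv hw => h.muEquiv_power _ X.property Y.property hv hw) },
    fun g g' X => GrVec.hom_ext (LinearMap.ext fun v => by
      rw [Pi.zero_apply, B.sign_zero]
      rfl)⟩

theorem IsSwap.isFermionic_zero (h : D.IsSwap) (ρ : G →* AutGroup B) :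
    (h.strictLifting ρ).IsFermionic 0 :=
  ⟨0, map_zero _, h.restrictsTo_zero ρ⟩

end Strict

end CochainAut

/-! ### The torsor of actions -/

/-- An additive torsor from its difference function. -/
theorem exists_addTorsor_of_difference {V P : Type*} [AddCommGroup V] [Nonempty P] (d : P → P → V)
    (d_add : ∀ p q r, d p q + d q r = d p r) (eq_of_d : ∀ p q, d p q = 0 → p = q)
    (exists_d : ∀ v p, ∃ q, d p q = v) :
    ∃ _ : AddTorsor V P, ∀ (v : V) (p q : P), v +ᵥ p = q ↔ d p q = v := by
  choose act d_act using exists_d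
  have act_eq (v : V) (p q : P) : act v p = q ↔ d p q = v := by
    refine ⟨fun h => h ▸ d_act v p, fun h => eq_of_d _ _ ?_⟩
    have := d_add p (act v p) q
    rwa [d_act, h, add_eq_left] at this
  exact ⟨{
    vadd := act
    vsub := fun q p => d p q
    zero_vadd := fun p => (act_eq 0 p p).mpr (by simpa using d_add p p p)
    add_vadd := fun v w p => (act_eq (v + w) p (act v (act w p))).mpr (by
      rw [← d_add p (act w p), d_act, d_act, add_comm])
    vsub_vadd' := fun q p => (act_eq _ _ _).mpr rfl
    vadd_vsub' := fun v p => d_act v p }, act_eq⟩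

namespace Lifting

variable {B : SpinDatum} {G : Type} [Group G] {ρ : G →* AutGroup B} {L L' L'' : Lifting ρ}
  {α : groupCohomology (zmodTwo G) 2}

/-- The class of the cocycles by which `L` has to be twisted to obtain `L'`. -/
def difference (L L' : Lifting ρ) : groupCohomology (moduleA ρ) 2 :=
  groupCohomology.H2π (moduleA ρ) (exists_isTwist L L').choose

theorem isTwist_iff_difference (z : groupCohomology.cocycles₂ (moduleA ρ)) (L L' : Lifting ρ) :
    IsTwist z L L' ↔ difference L L' = groupCohomology.H2π (moduleA ρ) z :=
  ⟨fun H => H.H2π_eq (exists_isTwist L L').choose_spec,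
    fun h => (exists_isTwist L L').choose_spec.of_H2π_eq h.symm⟩

theorem difference_add (L L' L'' : Lifting ρ) :
    difference L L' + difference L' L'' = difference L L'' := by
  obtain ⟨z, hz⟩ := exists_isTwist L L'
  obtain ⟨z', hz'⟩ := exists_isTwist L' L''
  rw [(isTwist_iff_difference z L L').mp hz, (isTwist_iff_difference z' L' L'').mp hz', ← map_add]
  exact ((isTwist_iff_difference (z + z') L L'').mp (hz.trans hz')).symm

theorem difference_eq_zero_iff : difference L L' = 0 ↔ Equivalent L L' := by
  rw [← isTwist_zero_iff, ← map_zero (groupCohomology.H2π (moduleA ρ)).hom]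
  exact (isTwist_iff_difference 0 L L').symm

theorem exists_difference_eq (L : Lifting ρ) (c : groupCohomology (moduleA ρ) 2) :
    ∃ L', difference L L' = c := by
  induction c using groupCohomology.H2_induction_on with
  | h z => exact ⟨L.twist z.2, (isTwist_iff_difference z L _).mp (L.isTwist_twist z.2)⟩

theorem IsFermionic.add_difference (hL : L.IsFermionic α) (L' : Lifting ρ) :
    L'.IsFermionic (α + rStar ρ (difference L L')) :=
  hL.twist (exists_isTwist L L').choose_spec

/-- Among all liftings, those with the same class on `⟨f⟩` as `L` are the twists of `L` by the
kernel of `r_*`. -/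
theorem IsFermionic.iff_difference_mem (hL : L.IsFermionic α) :
    L'.IsFermionic α ↔ difference L L' ∈ kerRStar ρ := by
  refine ⟨fun h => ?_, fun h => ?_⟩
  · have := h.unique (hL.add_difference L')
    exact left_eq_add.mp this
  · have := hL.add_difference L'
    rwa [show rStar ρ (difference L L') = 0 from h, add_zero] at this

/-- The torsor structure on the fermionic classes, whose difference function is induced by
`Lifting.difference`. -/
theorem exists_addTorsor_fermionicClass (L₀ : Lifting ρ) (hL₀ : L₀.IsFermionic α) :
    ∃ _ : AddTorsor (kerRStar ρ) (FermionicClass ρ α),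
      ∀ (z : groupCohomology.cocycles₂ (moduleA ρ))
        (hz : groupCohomology.H2π (moduleA ρ) z ∈ kerRStar ρ)
        (L L' : Lifting ρ) (hL : L.IsFermionic α) (hL' : L'.IsFermionic α),
        (⟨groupCohomology.H2π (moduleA ρ) z, hz⟩ : kerRStar ρ) +ᵥ fermionicClass L hL =
          fermionicClass L' hL' ↔ IsTwist z L L' := by
  have : Nonempty (FermionicClass ρ α) := ⟨fermionicClass L₀ hL₀⟩
  have difference_out (L L' : Lifting ρ) (hL : L.IsFermionic α) (hL' : L'.IsFermionic α) :
      difference (fermionicClass L hL).out.1 (fermionicClass L' hL').out.1 = difference L L' := by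
    have h : Equivalent (fermionicClass L hL).out.1 L :=
      Quotient.mk_out (s := fermionicSetoid ρ α) _
    have h' : Equivalent L' (fermionicClass L' hL').out.1 :=
      equivalent_equivalence.symm (Quotient.mk_out (s := fermionicSetoid ρ α) _)
    rw [← difference_add _ L, ← difference_add L L', difference_eq_zero_iff.mpr h,
      difference_eq_zero_iff.mpr h', zero_add, add_zero]
  obtain ⟨T, hT⟩ := exists_addTorsor_of_difference
    (fun p q : FermionicClass ρ α =>
      (⟨difference p.out.1 q.out.1, p.out.2.iff_difference_mem.mp q.out.2⟩ : kerRStar ρ))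
    (fun p q r => Subtype.ext (difference_add _ _ _))
    (fun p q h => by
      have h1 : Equivalent p.out.1 q.out.1 := difference_eq_zero_iff.mp (congrArg Subtype.val h)
      rw [← p.out_eq, ← q.out_eq]
      exact Quotient.sound h1)
    (fun v p => by
      obtain ⟨L', hL'⟩ := exists_difference_eq p.out.1 v.1
      have hF : L'.IsFermionic α := p.out.2.iff_difference_mem.mpr (hL'.symm ▸ v.2)
      refine ⟨fermionicClass L' hF, Subtype.ext ?_⟩
      have h := difference_out p.out.1 L' p.out.2 hF
      rw [show fermionicClass p.out.1 p.out.2 = p from p.out_eq, hL'] at h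
      exact h)
  refine ⟨T, fun z hz L L' hL hL' => (hT _ _ _).trans ?_⟩
  rw [isTwist_iff_difference, ← difference_out L L' hL hL']
  exact Subtype.ext_iff

/-- If `ρ` has a lifting with trivial restriction to `⟨f⟩`, then the classes `α` of its fermionic
actions are those in the image of `r_*`, which is the kernel of `d₂`. -/
theorem exists_isFermionic_iff (hL : L.IsFermionic 0) (α : groupCohomology (zmodTwo G) 2) :
    (∃ L' : Lifting ρ, L'.IsFermionic α) ↔ d₂ ρ α = 0 := by
  have hex : d₂ ρ α = 0 ↔ ∃ c, rStar ρ c = α := by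
    have := (ShortComplex.moduleCat_exact_iff _).mp
      (groupCohomology.mapShortComplex₃_exact (fermionSeq_shortExact ρ) (i := 2) (j := 3) rfl)
    refine ⟨fun h => this α h, ?_⟩
    rintro ⟨c, rfl⟩
    have h0 := (groupCohomology.mapShortComplex₃ (fermionSeq_shortExact ρ) (i := 2) (j := 3)
      rfl).zero
    exact congrArg (fun φ => φ.hom c) h0
  rw [hex]
  constructor
  · rintro ⟨L', hL'⟩
    have := hL.add_difference L'
    rw [zero_add] at this
    exact ⟨_, this.unique hL'⟩
  · rintro ⟨c, rfl⟩
    obtain ⟨L', rfl⟩ := exists_difference_eq L c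
    have := hL.add_difference L'
    rw [zero_add] at this
    exact ⟨L', this⟩

end Lifting

end

theorem mainTheorem5 (k : RankFour) (G : Type) [Group G] [Finite G] :
    Nonempty (AutGroup k.datum ≃* Multiplicative (ZMod 2)) ∧
    ∀ ρ : G →* AutGroup k.datum,
      Nonempty (Lifting ρ) ∧
      ∀ α : groupCohomology (zmodTwo G) 2,
        ((∃ L : Lifting ρ, L.IsFermionic α) ↔ d₂ ρ α = 0) ∧
        (d₂ ρ α = 0 →
          ∃ _ : AddTorsor (kerRStar ρ) (FermionicClass ρ α),
            ∀ (z : groupCohomology.cocycles₂ (moduleA ρ))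
              (hz : groupCohomology.H2π (moduleA ρ) z ∈ kerRStar ρ)
              (L L' : Lifting ρ) (hL : L.IsFermionic α) (hL' : L'.IsFermionic α),
              (⟨groupCohomology.H2π (moduleA ρ) z, hz⟩ : kerRStar ρ) +ᵥ fermionicClass L hL =
                fermionicClass L' hL' ↔ Lifting.IsTwist z L L') := by
  obtain ⟨D, h⟩ := CochainAut.exists_isSwap k
  refine ⟨⟨h.mulEquiv.symm⟩, fun ρ => ⟨⟨h.strictLifting ρ⟩, fun α => ?_⟩⟩
  have hc := Lifting.exists_isFermionic_iff (h.isFermionic_zero ρ) α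
  refine ⟨hc, fun hα => ?_⟩
  obtain ⟨L, hL⟩ := hc.mpr hα
  exact Lifting.exists_addTorsor_fermionicClass L hL
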